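/- Let $\alpha>-2$, $\beta<-2$, and let $\Phi:(0,\infty)\to(0,\infty)$ be twice continuously differentiable and such that, for some constants $C_0,C_\infty>0$, $\Phi(r)=C_0r^{\alpha}+o(r^{\alpha})$ as $r\to0$ and $\Phi(r)=C_\infty r^{\beta}+o(r^{\beta})$ as $r\to\infty$, and such that, for some constant $K$, $r|\Phi'(r)|\le Kr^{\alpha}$ and $r^2|\Phi''(r)|\le Kr^{\alpha}$ for $r\in(0,1)$, while $r|\Phi'(r)|\le Kr^{\beta}$ and $r^2|\Phi''(r)|\le Kr^{\beta}$ for $r\in(1,\infty)$. Let $\ell\in\{0,1,2,\dots\}$. For each $\lambda>0$ there is a unique solution $w_{\lambda,\ell}:(0,\infty)\to\mathbb R$ of $$w''(x)=\Bigl[\frac{\ell(\ell+1)}{x^2}-\lambda^2\Phi(x)\Bigr]w(x)\qquad(x>0)$$ with $x^{-\ell-1}w(x)\to1$ and $x^{-\ell}w'(x)\to\ell+1$ as $x\to0$. The integral $\int_0^x\bigl[\Phi(y)-\frac{(\ell+\frac12)^2}{\lambda^2y^2}\bigr]_+^{1/2}dy$, where $[t]_+=\max(t,0)$, converges for all $\lambda,x>0$.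 Moreover there are constants $a_{\lambda,\ell}\neq0$ ($\lambda>0$) such that, for all real-valued functions $x_-(\lambda)$, $x_+(\lambda)$ with $\lambda^{2/(2+\alpha)}x_-(\lambda)\to\infty$ and $\lambda^{2/(2+\beta)}x_+(\lambda)\to0$ as $\lambda\to\infty$, $$w_{\lambda,\ell}(x)=a_{\lambda,\ell}\,\Phi(x)^{-1/4}\Bigl(\cos\Bigl(\lambda\int_0^x\Bigl[\Phi(y)-\frac{(\ell+\frac12)^2}{\lambda^2y^2}\Bigr]_+^{1/2}dy-\frac{\pi}{4}\Bigr)+\varepsilon_\lambda(x)\Bigr)$$ for all $x>0$ with $x_-(\lambda)<x<x_+(\lambda)$, where $\sup\{|\varepsilon_\lambda(x)| : x>0,\ x_-(\lambda)<x<x_+(\lambda)\}\to0$ as $\lambda\to\infty$ (the supremum over the empty set being $0$); the function $\varepsilon_\lambda$ may depend on $x_\pm$, the constants $a_{\lambda,\ell}$ do not. -/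

import Mathlib

open Set Filter Topology Asymptotics

/-- The standing assumptions on the potential `Φ`, as a function of the radius `r > 0`, with
exponents `α > -2` at the origin and `β < -2` at infinity. Values of `Φ` at `r ≤ 0` play no role. -/
structure IsAdmissiblePotential (Φ : ℝ → ℝ) (α β : ℝ) : Prop where
  pos : ∀ r > 0, 0 < Φ r
  neg_two_lt : -2 < α
  lt_neg_two : β < -2
  asymp_zero : ∃ C₀ > 0, (fun r => Φ r - C₀ * r ^ α) =o[𝓝[>] 0] fun r => r ^ α
  asymp_top : ∃ C > 0, (fun r => Φ r - C * r ^ β) =o[atTop] fun r => r ^ β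
  contDiffOn : ContDiffOn ℝ 2 Φ (Ioi 0)
  bound_zero : ∃ K, ∀ r ∈ Ioo (0 : ℝ) 1,
    r * |deriv Φ r| ≤ K * r ^ α ∧ r ^ 2 * |deriv (deriv Φ) r| ≤ K * r ^ α
  bound_top : ∃ K, ∀ r ∈ Ioi (1 : ℝ),
    r * |deriv Φ r| ≤ K * r ^ β ∧ r ^ 2 * |deriv (deriv Φ) r| ≤ K * r ^ β

/-- `w` is a classical solution on `(0, ∞)` of `w'' = [ℓ(ℓ+1)/x² - lam² Φ] w` with
`x^(-ℓ-1) w(x) → 1` and `x^(-ℓ) w'(x) → ℓ + 1` as `x → 0+`.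
Values of `w` at `x ≤ 0` play no role. -/
structure IsRegularSolution (Φ : ℝ → ℝ) (ℓ : ℕ) (lam : ℝ) (w : ℝ → ℝ) : Prop where
  differentiableAt : ∀ x > 0, DifferentiableAt ℝ w x
  hasDerivAt_deriv : ∀ x > 0,
    HasDerivAt (deriv w) (((ℓ : ℝ) * (ℓ + 1) / x ^ 2 - lam ^ 2 * Φ x) * w x) x
  tendsto_zero : Tendsto (fun x => w x / x ^ (ℓ + 1)) (𝓝[>] 0) (𝓝 1)
  tendsto_deriv_zero : Tendsto (fun x => deriv w x / x ^ ℓ) (𝓝[>] 0) (𝓝 (ℓ + 1))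

/-- `[Φ(y) - (ℓ + 1/2)² / (lam² y²)]₊ ^ (1/2)`. -/
noncomputable def langerIntegrand (Φ : ℝ → ℝ) (ℓ : ℕ) (lam y : ℝ) : ℝ :=
  √(max (Φ y - ((ℓ : ℝ) + 1 / 2) ^ 2 / (lam ^ 2 * y ^ 2)) 0)

/-- `lam ∫₀ˣ [Φ(y) - (ℓ + 1/2)² / (lam² y²)]₊ ^ (1/2) dy - π/4`. -/
noncomputable def langerPhase (Φ : ℝ → ℝ) (ℓ : ℕ) (lam x : ℝ) : ℝ :=
  lam * (∫ y in (0 : ℝ)..x, langerIntegrand Φ ℓ lam y) - Real.pi / 4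

/-!
## Why the asymptotic formula holds

Put `κ = 1 + α/2`, `μ = (ℓ + 1/2) / κ`, and let `S = lam * x ^ κ` measure the distance from the
origin. Two regimes are matched at the point `x = a` where `S` is a large constant.

*Up to the matching point* only `Φ ≈ C₀ x^α` matters. Writing `w = x ^ (ℓ + 1) g` turns the equation
into a first-order system with an integrable singularity, and a weighted sup-norm estimate
(`IsRegularSystem.comparison`) gives continuous dependence on the potential, hence uniqueness; the
same weight makes Picard's operator a contraction, hence existence (`exists_isRegularSystem`). For
the pure power the solution is a Bessel function of order `μ` of `c lam x ^ κ`, `c = √C₀ / κ`,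
represented by Poisson's integral (`isRegularSystem_poissonIntegral`). Moving the contour of that
integral to the branch points gives the asymptotics `cos (z - μ π/2 - π/4)`
(`tendsto_poissonIntegral`), so the amplitude and the phase of `w` at `a` are known as `lam → ∞` and
then `S → ∞` (`eventually_wkbAmplitude_matchingPoint`).

*Beyond the matching point* the Liouville–Green amplitude `ζ = V - i V'`, with `V = lam Φ^(1/4) w`
and the derivative taken in the variable `lam ∫ √Φ`, rotates with that variable, up to a relative
error `∫ dx / (lam x² √Φ)`, which is `O(1/S)` plus a quantity that tends to `0` on the window
(`IsAdmissiblePotential.exists_wkbAmplitude_le`).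

*The phase.* With Langer's correction, `∫₀^a` of the integrand tends to the explicit
`√(z² - μ²) - μ arctan (√(z² - μ²) / μ)` at `z = c S`, which is `z - μ π/2 + o(1)`
(`tendsto_phase_matchingPoint`, `tendsto_besselPhase_sub`): exactly the phase shift of the Bessel
function. Beyond `a` the correction changes the phase by another multiple of `∫ dx / (lam x² √Φ)`
(`IsAdmissiblePotential.exists_phase_sub_le`).
-/

/-! ### The Poisson integral for Bessel functions -/

/-- The Poisson integral of order `m`: `∫ (cos θ)^(2m) cos (z sin θ)` over `[-π/2, π/2]`. Up to a
constant it is `z ^ (-m) * J_m(z)`; unlike that expression it is smooth at `z = 0`. -/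
noncomputable def poissonIntegral (m z : ℝ) : ℝ :=
  ∫ θ in (-(Real.pi / 2))..(Real.pi / 2), Real.cos θ ^ (2 * m) * Real.cos (z * Real.sin θ)

lemma cos_nonneg_of_mem_uIcc {θ : ℝ} (h : θ ∈ uIcc (-(Real.pi / 2)) (Real.pi / 2)) :
    0 ≤ Real.cos θ := by
  rw [uIcc_of_le (by linarith [Real.pi_pos])] at h
  exact Real.cos_nonneg_of_mem_Icc h

lemma continuous_cos_rpow {p : ℝ} (hp : 0 ≤ p) : Continuous fun θ : ℝ => Real.cos θ ^ p :=
  Real.continuous_cos.rpow_const fun _ => Or.inr hp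

lemma hasDerivAt_cos_rpow {p : ℝ} (hp : 0 ≤ p) (θ : ℝ) :
    HasDerivAt (fun θ => Real.cos θ ^ (p + 1)) (-(p + 1) * Real.sin θ * Real.cos θ ^ p) θ := by
  have h := (Real.hasDerivAt_cos θ).rpow_const (p := p + 1) (Or.inr (by linarith))
  convert h using 1
  rw [add_sub_cancel_right]; ring

lemma integral_cos_rpow_mul_sin {m : ℝ} (hm : 0 ≤ m) (z : ℝ) :
    ∫ θ in (-(Real.pi / 2))..(Real.pi / 2),
      -(Real.cos θ ^ (2 * m) * Real.sin θ * Real.sin (z * Real.sin θ)) =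
      -(z / (2 * m + 1)) * poissonIntegral (m + 1) z := by
  have hd : ∀ θ ∈ uIcc (-(Real.pi / 2)) (Real.pi / 2),
      HasDerivAt (fun θ => Real.cos θ ^ (2 * m + 1) * Real.sin (z * Real.sin θ))
        ((2 * m + 1) * -(Real.cos θ ^ (2 * m) * Real.sin θ * Real.sin (z * Real.sin θ)) +
          z * (Real.cos θ ^ (2 * (m + 1)) * Real.cos (z * Real.sin θ))) θ := by
    intro θ hθ
    have h1 := (hasDerivAt_cos_rpow (p := 2 * m) (by linarith) θ).mul
      (((Real.hasDerivAt_sin θ).const_mul z).sin)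
    refine h1.congr_deriv ?_
    have h2 : Real.cos θ ^ (2 * (m + 1)) = Real.cos θ ^ (2 * m + 1) * Real.cos θ := by
      rw [show 2 * (m + 1) = (2 * m + 1) + 1 by ring,
        Real.rpow_add_of_nonneg (cos_nonneg_of_mem_uIcc hθ) (by linarith) zero_le_one,
        Real.rpow_one]
    rw [h2]; ring
  have c1 : Continuous fun θ : ℝ =>
      -(Real.cos θ ^ (2 * m) * Real.sin θ * Real.sin (z * Real.sin θ)) := by
    have := continuous_cos_rpow (p := 2 * m) (by linarith)
    fun_prop
  have c2 : Continuous fun θ : ℝ =>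
      Real.cos θ ^ (2 * (m + 1)) * Real.cos (z * Real.sin θ) := by
    have := continuous_cos_rpow (p := 2 * (m + 1)) (by linarith)
    fun_prop
  have hI := intervalIntegral.integral_eq_sub_of_hasDerivAt hd
    (((c1.const_mul _).add (c2.const_mul _)).intervalIntegrable _ _)
  rw [intervalIntegral.integral_add ((c1.const_mul _).intervalIntegrable _ _)
    ((c2.const_mul _).intervalIntegrable _ _), intervalIntegral.integral_const_mul,
    intervalIntegral.integral_const_mul] at hI
  have h0 : (0 : ℝ) ^ (2 * m + 1) = 0 := Real.zero_rpow (by linarith)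
  rw [Real.cos_neg, Real.cos_pi_div_two, h0] at hI
  have hm' : (2 * m + 1) ≠ 0 := by linarith
  rw [show poissonIntegral (m + 1) z = ∫ θ in (-(Real.pi / 2))..(Real.pi / 2),
    Real.cos θ ^ (2 * (m + 1)) * Real.cos (z * Real.sin θ) from rfl]
  rw [show ∀ y : ℝ, -(z / (2 * m + 1)) * y = -(z * y) / (2 * m + 1) from fun y => by ring,
    eq_div_iff hm']
  linarith

lemma hasDerivAt_poissonIntegral {m : ℝ} (hm : 0 ≤ m) (z : ℝ) :
    HasDerivAt (poissonIntegral m) (-(z / (2 * m + 1)) * poissonIntegral (m + 1) z) z := by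
  rw [← integral_cos_rpow_mul_sin hm z]
  have hc := continuous_cos_rpow (p := 2 * m) (by linarith)
  refine (intervalIntegral.hasDerivAt_integral_of_dominated_loc_of_deriv_le (s := univ)
    (bound := fun θ => |Real.cos θ ^ (2 * m)|)
    (F' := fun z θ => -(Real.cos θ ^ (2 * m) * Real.sin θ * Real.sin (z * Real.sin θ)))
    univ_mem ?_ ?_ ?_ ?_ ?_ ?_).2
  · exact Eventually.of_forall fun x => Continuous.aestronglyMeasurable (by fun_prop)
  · exact Continuous.intervalIntegrable (by fun_prop) _ _
  · exact Continuous.aestronglyMeasurable (by fun_prop)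
  · refine Eventually.of_forall fun θ _ x _ => ?_
    rw [norm_neg, norm_mul, norm_mul, Real.norm_eq_abs, Real.norm_eq_abs, Real.norm_eq_abs, mul_assoc]
    exact mul_le_of_le_one_right (abs_nonneg _) (mul_le_one₀ (Real.abs_sin_le_one _) (abs_nonneg _)
      (Real.abs_sin_le_one _))
  · exact Continuous.intervalIntegrable (by fun_prop) _ _
  · refine Eventually.of_forall fun θ _ x _ => ?_
    have h := (((hasDerivAt_id x).mul_const (Real.sin θ)).cos).const_mul (Real.cos θ ^ (2 * m))
    refine h.congr_deriv ?_
    simp only [one_mul, id]; ring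

/-- The three-term recurrence between consecutive orders. -/
lemma poissonIntegral_recurrence {m : ℝ} (hm : 0 ≤ m) (z : ℝ) :
    z ^ 2 / (2 * m + 3) * poissonIntegral (m + 2) z =
      (2 * m + 2) * poissonIntegral (m + 1) z - (2 * m + 1) * poissonIntegral m z := by
  have hd : ∀ θ ∈ uIcc (-(Real.pi / 2)) (Real.pi / 2),
      HasDerivAt (fun θ => Real.cos θ ^ (2 * m + 1) * (Real.sin θ * Real.cos (z * Real.sin θ)))
        (-(2 * m + 1) * (Real.cos θ ^ (2 * m) * Real.cos (z * Real.sin θ)) +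
          (2 * m + 2) * (Real.cos θ ^ (2 * (m + 1)) * Real.cos (z * Real.sin θ)) +
          z * -(Real.cos θ ^ (2 * (m + 1)) * Real.sin θ * Real.sin (z * Real.sin θ))) θ := by
    intro θ hθ
    have h1 := (hasDerivAt_cos_rpow (p := 2 * m) (by linarith) θ).mul
      ((Real.hasDerivAt_sin θ).mul (((Real.hasDerivAt_sin θ).const_mul z).cos))
    refine h1.congr_deriv ?_
    have hc := cos_nonneg_of_mem_uIcc hθ
    have h2 : Real.cos θ ^ (2 * m + 1) = Real.cos θ ^ (2 * m) * Real.cos θ := by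
      rw [Real.rpow_add_of_nonneg hc (by linarith) zero_le_one, Real.rpow_one]
    have h3 : Real.cos θ ^ (2 * (m + 1)) = Real.cos θ ^ (2 * m) * (1 - Real.sin θ ^ 2) := by
      rw [show 2 * (m + 1) = 2 * m + 2 by ring,
        Real.rpow_add_of_nonneg hc (by linarith) zero_le_two, Real.rpow_two, ← Real.cos_sq']
    have h4 := Real.cos_sq' θ
    simp only [Pi.mul_apply]
    rw [h2, h3]
    linear_combination (Real.cos θ ^ (2 * m) * Real.cos (z * Real.sin θ)
      - z * Real.cos θ ^ (2 * m) * Real.sin θ * Real.sin (z * Real.sin θ)) * h4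
  have c1 : Continuous fun θ : ℝ => Real.cos θ ^ (2 * m) * Real.cos (z * Real.sin θ) := by
    have := continuous_cos_rpow (p := 2 * m) (by linarith)
    fun_prop
  have c2 : Continuous fun θ : ℝ =>
      Real.cos θ ^ (2 * (m + 1)) * Real.cos (z * Real.sin θ) := by
    have := continuous_cos_rpow (p := 2 * (m + 1)) (by linarith)
    fun_prop
  have c3 : Continuous fun θ : ℝ =>
      -(Real.cos θ ^ (2 * (m + 1)) * Real.sin θ * Real.sin (z * Real.sin θ)) := by
    have := continuous_cos_rpow (p := 2 * (m + 1)) (by linarith)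
    fun_prop
  have hI := intervalIntegral.integral_eq_sub_of_hasDerivAt hd
    ((((c1.const_mul _).add (c2.const_mul _)).add (c3.const_mul _)).intervalIntegrable _ _)
  have c12 : Continuous fun θ : ℝ =>
      -(2 * m + 1) * (Real.cos θ ^ (2 * m) * Real.cos (z * Real.sin θ)) +
        (2 * m + 2) * (Real.cos θ ^ (2 * (m + 1)) * Real.cos (z * Real.sin θ)) :=
    (c1.const_mul _).add (c2.const_mul _)
  rw [intervalIntegral.integral_add (c12.intervalIntegrable _ _) ((c3.const_mul _).intervalIntegrable _ _),
    intervalIntegral.integral_add ((c1.const_mul _).intervalIntegrable _ _)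
    ((c2.const_mul _).intervalIntegrable _ _), intervalIntegral.integral_const_mul,
    intervalIntegral.integral_const_mul, intervalIntegral.integral_const_mul,
    integral_cos_rpow_mul_sin (by linarith) z] at hI
  have h0 : (0 : ℝ) ^ (2 * m + 1) = 0 := Real.zero_rpow (by linarith)
  rw [Real.cos_neg, Real.cos_pi_div_two, h0] at hI
  rw [show m + 1 + 1 = m + 2 by ring] at hI
  change _ * poissonIntegral m z + _ * poissonIntegral (m + 1) z + _ = _ at hI
  have e : 2 * (m + 1) + 1 = 2 * m + 3 := by ring
  rw [e] at hI
  linear_combination (-1) * hI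

lemma poissonIntegral_zero_pos {m : ℝ} (hm : 0 ≤ m) : 0 < poissonIntegral m 0 := by
  have hc := continuous_cos_rpow (p := 2 * m) (by linarith)
  unfold poissonIntegral
  refine intervalIntegral.intervalIntegral_pos_of_pos_on ?_ ?_ (by linarith [Real.pi_pos])
  · exact Continuous.intervalIntegrable (by fun_prop) _ _
  · intro x hx
    have := Real.cos_pos_of_mem_Ioo hx
    simp only [zero_mul, Real.cos_zero, mul_one]
    positivity

lemma continuous_poissonIntegral {m : ℝ} (hm : 0 ≤ m) : Continuous (poissonIntegral m) :=
  continuous_iff_continuousAt.2 fun z => (hasDerivAt_poissonIntegral hm z).continuousAt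

/-! ### Asymptotics of the Poisson integral -/

/-- The amplitude of `z ^ (m + 1/2) * poissonIntegral m z` at infinity. -/
noncomputable def poissonAmplitude (m : ℝ) : ℝ := 2 ^ (m + 1 / 2) * Real.Gamma (m + 1 / 2)

lemma norm_cpow_ofReal_le (w : ℂ) (s : ℝ) : ‖w ^ (s : ℂ)‖ ≤ ‖w‖ ^ s := by
  simp

lemma ofReal_mul_cpow {s y : ℝ} (hs : 0 < s) (hy : 0 ≤ y) (w : ℂ) (hw : w ≠ 0) :
    ((y : ℂ) * w) ^ (s : ℂ) = ((y ^ s : ℝ) : ℂ) * w ^ (s : ℂ) := by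
  rcases hy.eq_or_lt with rfl | hy
  · have : (s : ℂ) ≠ 0 := by exact_mod_cast hs.ne'
    simp [Real.zero_rpow hs.ne', this]
  · have hy' : (y : ℂ) ≠ 0 := by exact_mod_cast hy.ne'
    rw [Complex.cpow_def_of_ne_zero (mul_ne_zero hy' hw), Complex.log_ofReal_mul hy hw,
      Complex.cpow_def_of_ne_zero hw, add_mul, Complex.exp_add, Real.rpow_def_of_pos hy]
    push_cast
    rfl

lemma neg_two_I_cpow (s : ℝ) :
    (((-2 : ℝ) : ℂ) * Complex.I) ^ (s : ℂ) =
      ((2 ^ s : ℝ) : ℂ) * Complex.exp (((-(Real.pi * s / 2) : ℝ) : ℂ) * Complex.I) := by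
  have h : ((-2 : ℝ) : ℂ) * Complex.I = ((2 : ℝ) : ℂ) * (-Complex.I) := by push_cast; ring
  have hI : (-Complex.I) ≠ 0 := neg_ne_zero.2 Complex.I_ne_zero
  have h2 : ((2 : ℝ) : ℂ) ≠ 0 := by norm_num
  rw [h, Complex.cpow_def_of_ne_zero (mul_ne_zero h2 hI), Complex.log_ofReal_mul two_pos hI,
    Complex.log_neg_I, add_mul, Complex.exp_add, Real.rpow_def_of_pos two_pos]
  push_cast
  congr 2
  ring

/-- The Laplace-type integral along the vertical line through the branch point `1`, after
rescaling by `z`. -/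
lemma tendsto_integral_branch {s : ℝ} (hs : 0 < s) :
    Tendsto (fun z : ℝ => ∫ u in (0 : ℝ)..z,
      ((u ^ s * Real.exp (-u) : ℝ) : ℂ) * (((u / z : ℝ) : ℂ) + ((-2 : ℝ) : ℂ) * Complex.I) ^ (s : ℂ))
      atTop (𝓝 ((Real.Gamma (s + 1) : ℂ) * (((-2 : ℝ) : ℂ) * Complex.I) ^ (s : ℂ))) := by
  set G : ℝ → ℝ → ℂ := fun z u => ((u ^ s * Real.exp (-u) : ℝ) : ℂ) *
    (((u / z : ℝ) : ℂ) + ((-2 : ℝ) : ℂ) * Complex.I) ^ (s : ℂ) with hG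
  have hslit : ∀ r : ℝ, ((r : ℂ) + ((-2 : ℝ) : ℂ) * Complex.I) ∈ Complex.slitPlane := by
    intro r; rw [Complex.mem_slitPlane_iff]; right; simp
  have hcont : ∀ z, Continuous (G z) := by
    intro z
    have h1 : Continuous fun u : ℝ => u ^ s := continuous_id.rpow_const fun _ => Or.inr hs.le
    have h2 : Continuous fun u : ℝ => (((u / z : ℝ) : ℂ) + ((-2 : ℝ) : ℂ) * Complex.I) ^ (s : ℂ) :=
      Continuous.cpow (by fun_prop) continuous_const fun u => hslit _
    have h3 : Continuous fun u : ℝ => ((u ^ s * Real.exp (-u) : ℝ) : ℂ) := by fun_prop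
    exact h3.mul h2
  have key := MeasureTheory.tendsto_integral_filter_of_dominated_convergence
    (μ := MeasureTheory.volume) (l := atTop)
    (F := fun z : ℝ => (Ioc 0 z).indicator (G z))
    (f := (Ioi 0).indicator fun u => ((Real.exp (-u) * u ^ (s + 1 - 1) : ℝ) : ℂ) *
      (((-2 : ℝ) : ℂ) * Complex.I) ^ (s : ℂ))
    (bound := (Ioi 0).indicator fun u => (Real.exp (-u) * u ^ (s + 1 - 1)) * 3 ^ s) ?_ ?_ ?_ ?_
  · rw [MeasureTheory.integral_indicator measurableSet_Ioi,
      MeasureTheory.integral_mul_const, integral_complex_ofReal, ← Real.Gamma_eq_integral (by linarith)] at key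
    refine key.congr' ?_
    filter_upwards [eventually_gt_atTop 0] with z hz
    rw [MeasureTheory.integral_indicator measurableSet_Ioc, intervalIntegral.integral_of_le hz.le]
  · exact Eventually.of_forall fun z =>
      ((hcont z).aestronglyMeasurable).indicator measurableSet_Ioc
  · filter_upwards [eventually_gt_atTop 0] with z hz
    refine Eventually.of_forall fun u => ?_
    by_cases hu : u ∈ Ioc 0 z
    · have hu0 : u ∈ Ioi (0 : ℝ) := hu.1
      rw [indicator_of_mem hu, indicator_of_mem hu0, hG]
      have hu1 : (0 : ℝ) < u := hu.1
      simp only [norm_mul, Complex.norm_real, add_sub_cancel_right]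
      rw [Real.norm_of_nonneg (by positivity), Real.norm_of_nonneg (by positivity),
        mul_comm (u ^ s)]
      refine mul_le_mul_of_nonneg_left ((norm_cpow_ofReal_le _ _).trans ?_) (by positivity)
      refine Real.rpow_le_rpow (norm_nonneg _) ?_ hs.le
      refine (norm_add_le _ _).trans ?_
      rw [norm_mul, Complex.norm_I, Complex.norm_real, Complex.norm_real, Real.norm_eq_abs,
        Real.norm_eq_abs, abs_of_pos (div_pos hu1 hz)]
      have := (div_le_one hz).2 hu.2
      norm_num
      linarith
    · rw [indicator_of_notMem hu, norm_zero]
      refine indicator_nonneg (fun u hu => ?_) u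
      have hu1 : (0 : ℝ) < u := hu
      positivity
  · exact (MeasureTheory.integrable_indicator_iff measurableSet_Ioi).2
      (MeasureTheory.Integrable.mul_const (Real.GammaIntegral_convergent (by linarith)) _)
  · refine Eventually.of_forall fun u => ?_
    by_cases hu : 0 < u
    · have hu0 : u ∈ Ioi (0 : ℝ) := hu
      rw [indicator_of_mem hu0]
      have h1 : Tendsto (fun z : ℝ => ((u / z : ℝ) : ℂ) + ((-2 : ℝ) : ℂ) * Complex.I) atTop
          (𝓝 (((0 : ℝ) : ℂ) + ((-2 : ℝ) : ℂ) * Complex.I)) := by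
        refine Tendsto.add_const _ ?_
        exact (Complex.continuous_ofReal.tendsto 0).comp
          (tendsto_const_nhds.div_atTop tendsto_id)
      have h2 := (h1.cpow tendsto_const_nhds (hslit 0) (b := (s : ℂ))).const_mul
        (((u ^ s * Real.exp (-u) : ℝ) : ℂ))
      rw [add_sub_cancel_right, mul_comm (Real.exp (-u))]
      rw [Complex.ofReal_zero, zero_add] at h2
      refine h2.congr' ?_
      filter_upwards [eventually_ge_atTop u] with z hz
      rw [indicator_of_mem (show u ∈ Ioc 0 z from ⟨hu, hz⟩)]
    · have : u ∉ Ioi (0 : ℝ) := hu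
      rw [indicator_of_notMem this]
      refine tendsto_const_nhds.congr fun z => ?_
      rw [indicator_of_notMem fun h => hu h.1]

lemma poissonIntegral_eq_two_mul (m z : ℝ) (hm : 1 / 2 < m) :
    poissonIntegral m z =
      2 * ∫ t in (0 : ℝ)..1, (1 - t ^ 2) ^ (m - 1 / 2) * Real.cos (z * t) := by
  have hc := continuous_cos_rpow (p := 2 * m) (by linarith)
  set F : ℝ → ℝ := fun θ => Real.cos θ ^ (2 * m) * Real.cos (z * Real.sin θ) with hF
  have hFc : Continuous F := by fun_prop
  have h1 : poissonIntegral m z = 2 * ∫ θ in (0 : ℝ)..(Real.pi / 2), F θ := by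
    have hneg : ∫ θ in (-(Real.pi / 2))..0, F θ = ∫ θ in (0 : ℝ)..(Real.pi / 2), F θ := by
      have h := intervalIntegral.integral_comp_neg (a := 0) (b := Real.pi / 2) F
      rw [neg_zero] at h
      rw [← h]
      refine intervalIntegral.integral_congr fun θ _ => ?_
      simp [hF]
    rw [two_mul]
    nth_rewrite 1 [← hneg]
    exact (intervalIntegral.integral_add_adjacent_intervals (hFc.intervalIntegrable _ _)
      (hFc.intervalIntegrable _ _)).symm
  have hg : Continuous fun t : ℝ => (1 - t ^ 2) ^ (m - 1 / 2) * Real.cos (z * t) := by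
    have : Continuous fun t : ℝ => (1 - t ^ 2) ^ (m - 1 / 2) :=
      Continuous.rpow_const (by fun_prop) fun _ => Or.inr (by linarith)
    fun_prop
  have h2 := intervalIntegral.integral_comp_mul_deriv (a := 0) (b := Real.pi / 2)
    (fun θ _ => Real.hasDerivAt_sin θ) Real.continuous_cos.continuousOn hg
  rw [Real.sin_zero, Real.sin_pi_div_two] at h2
  rw [h1, ← h2]
  congr 1
  refine intervalIntegral.integral_congr fun θ hθ => ?_
  have hθ' : 0 ≤ Real.cos θ := by
    rw [uIcc_of_le (by linarith [Real.pi_pos])] at hθ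
    exact Real.cos_nonneg_of_mem_Icc ⟨by linarith [hθ.1, Real.pi_pos], hθ.2⟩
  have h3 : Real.cos θ ^ (2 * m) = (1 - Real.sin θ ^ 2) ^ (m - 1 / 2) * Real.cos θ := by
    rw [← Real.cos_sq', ← Real.rpow_two, ← Real.rpow_mul hθ']
    nth_rewrite 3 [← Real.rpow_one (Real.cos θ)]
    rw [← Real.rpow_add_of_nonneg hθ' (by linarith) zero_le_one]
    congr 1; ring
  simp only [hF, Function.comp]
  rw [h3]; ring

/-- Moving the contour `[0, 1]` to the other three sides of the unit square; the left side
contributes an imaginary number. -/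
lemma integral_eq_contour {s : ℝ} (hs : 0 < s) {z : ℝ} (hz : 0 < z) :
    ∃ top : ℝ, |top| ≤ 3 ^ s * Real.exp (-z) ∧
    z ^ (s + 1) * ∫ t in (0 : ℝ)..1, (1 - t ^ 2) ^ s * Real.cos (z * t) =
      z ^ (s + 1) * top - (Complex.I * Complex.exp ((z : ℂ) * Complex.I) * ∫ u in (0 : ℝ)..z,
      ((u ^ s * Real.exp (-u) : ℝ) : ℂ) *
        (((u / z : ℝ) : ℂ) + ((-2 : ℝ) : ℂ) * Complex.I) ^ (s : ℂ)).re := by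
  set f : ℂ → ℂ := fun t => (1 - t ^ 2) ^ (s : ℂ) * Complex.exp ((z : ℂ) * Complex.I * t) with hf
  have hsre : 0 < ((s : ℂ)).re := by simpa using hs
  have hre : ∀ t : ℂ, (1 - t ^ 2).re = 1 - t.re ^ 2 + t.im ^ 2 := by
    intro t; simp [pow_two]; ring
  have hcf : ∀ t : ℂ, 0 ≤ (1 - t ^ 2).re → ContinuousAt f t := by
    intro t ht
    have h1 := Complex.continuousAt_cpow_const_of_re_pos (Or.inl ht) hsre
    have h2 : ContinuousAt (fun t : ℂ => 1 - t ^ 2) t := by fun_prop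
    have h3 : ContinuousAt (fun t : ℂ => (1 - t ^ 2) ^ (s : ℂ)) t :=
      ContinuousAt.comp (f := fun t : ℂ => 1 - t ^ 2) (g := fun w : ℂ => w ^ (s : ℂ)) h1 h2
    have h4 : ContinuousAt (fun t : ℂ => Complex.exp ((z : ℂ) * Complex.I * t)) t := by fun_prop
    exact h3.mul h4
  have hdf : ∀ t : ℂ, 0 < (1 - t ^ 2).re → DifferentiableAt ℂ f t := by
    intro t ht
    have h1 : DifferentiableAt ℂ (fun t : ℂ => (1 - t ^ 2) ^ (s : ℂ)) t :=
      DifferentiableAt.cpow_const (by fun_prop) (Or.inl ht)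
    have h4 : DifferentiableAt ℂ (fun t : ℂ => Complex.exp ((z : ℂ) * Complex.I * t)) t := by
      fun_prop
    exact h1.mul h4
  have hrect := Complex.integral_boundary_rect_eq_zero_of_continuousOn_of_differentiableOn f 0
    (1 + Complex.I) ?_ ?_
  rotate_left
  · intro t ht
    rw [Complex.mem_reProdIm] at ht
    simp only [Complex.zero_re, Complex.zero_im, Complex.add_re, Complex.add_im, Complex.one_re,
      Complex.one_im, Complex.I_re, Complex.I_im, add_zero, zero_add,
      uIcc_of_le (zero_le_one' ℝ)] at ht
    refine (hcf t ?_).continuousWithinAt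
    rw [hre]
    nlinarith [ht.1.1, ht.1.2, sq_nonneg t.im]
  · intro t ht
    rw [Complex.mem_reProdIm] at ht
    simp only [Complex.zero_re, Complex.zero_im, Complex.add_re, Complex.add_im, Complex.one_re,
      Complex.one_im, Complex.I_re, Complex.I_im, add_zero, zero_add, min_eq_left (zero_le_one' ℝ),
      max_eq_right (zero_le_one' ℝ)] at ht
    refine (hdf t ?_).differentiableWithinAt
    rw [hre]
    nlinarith [ht.1.1, ht.1.2, sq_nonneg t.im]
  simp only [Complex.zero_re, Complex.zero_im, Complex.add_re, Complex.add_im, Complex.one_re,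
      Complex.one_im, Complex.I_re, Complex.I_im, add_zero, zero_add, Complex.ofReal_zero,
      Complex.ofReal_one, zero_mul, one_mul, smul_eq_mul] at hrect
  -- the bottom side
  have hbot : (∫ x in (0 : ℝ)..1, f x).re =
      ∫ t in (0 : ℝ)..1, (1 - t ^ 2) ^ s * Real.cos (z * t) := by
    have hi : IntervalIntegrable (fun x : ℝ => f x) MeasureTheory.volume 0 1 := by
      refine ContinuousOn.intervalIntegrable fun x hx => ?_
      rw [uIcc_of_le zero_le_one] at hx
      refine ContinuousAt.continuousWithinAt ?_
      refine ContinuousAt.comp (f := fun x : ℝ => (x : ℂ)) (hcf _ ?_)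
        Complex.continuous_ofReal.continuousAt
      rw [hre]
      simp only [Complex.ofReal_re, Complex.ofReal_im]
      nlinarith [hx.1, hx.2]
    have h1 := Complex.reCLM.intervalIntegral_comp_comm hi
    simp only [Complex.reCLM_apply] at h1
    rw [← h1]
    refine intervalIntegral.integral_congr fun x hx => ?_
    rw [uIcc_of_le zero_le_one] at hx
    have h2 : 0 ≤ 1 - x ^ 2 := by nlinarith [hx.1, hx.2]
    have h3 : f x = (((1 - x ^ 2) ^ s : ℝ) : ℂ) * Complex.exp (((z * x : ℝ) : ℂ) * Complex.I) := by
      simp only [hf]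
      rw [Complex.ofReal_cpow h2]
      push_cast
      congr 2; ring
    simp only [h3, Complex.re_ofReal_mul, Complex.exp_ofReal_mul_I_re]
  -- the left side
  have hleft : (Complex.I * ∫ y in (0 : ℝ)..1, f (y * Complex.I)).re = 0 := by
    have h1 : ∫ y in (0 : ℝ)..1, f (y * Complex.I) =
        ((∫ y in (0 : ℝ)..1, (1 + y ^ 2) ^ s * Real.exp (-(z * y)) : ℝ) : ℂ) := by
      rw [← intervalIntegral.integral_ofReal]
      refine intervalIntegral.integral_congr fun y _ => ?_
      simp only [hf]
      rw [mul_pow, Complex.I_sq, Complex.ofReal_mul, Complex.ofReal_cpow (by positivity)]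
      push_cast
      congr 2
      · ring
      · linear_combination ((z : ℂ) * y) * Complex.I_sq
    rw [h1]; simp
  -- the right side
  have hright : ((z ^ (s + 1) : ℝ) : ℂ) * ∫ y in (0 : ℝ)..1, f (1 + y * Complex.I) =
      Complex.exp ((z : ℂ) * Complex.I) * ∫ u in (0 : ℝ)..z, ((u ^ s * Real.exp (-u) : ℝ) : ℂ) *
        (((u / z : ℝ) : ℂ) + ((-2 : ℝ) : ℂ) * Complex.I) ^ (s : ℂ) := by
    have h1 := intervalIntegral.smul_integral_comp_mul_left (a := 0) (b := 1)
      (fun u : ℝ => ((u ^ s * Real.exp (-u) : ℝ) : ℂ) *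
        (((u / z : ℝ) : ℂ) + ((-2 : ℝ) : ℂ) * Complex.I) ^ (s : ℂ)) z
    rw [mul_zero, mul_one] at h1
    rw [← h1, Complex.real_smul, ← mul_assoc, ← intervalIntegral.integral_const_mul,
      ← intervalIntegral.integral_const_mul]
    refine intervalIntegral.integral_congr fun y hy => ?_
    rw [uIcc_of_le zero_le_one] at hy
    have h2 : (1 : ℂ) - (1 + y * Complex.I) ^ 2 =
        (y : ℂ) * ((y : ℂ) + ((-2 : ℝ) : ℂ) * Complex.I) := by
      push_cast
      linear_combination (-(y : ℂ) ^ 2) * Complex.I_sq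
    have h3 : ((y : ℂ) + ((-2 : ℝ) : ℂ) * Complex.I) ≠ 0 := by
      intro h
      have := congrArg Complex.im h
      simp at this
    simp only [hf]
    rw [h2, ofReal_mul_cpow hs hy.1 _ h3, mul_div_cancel_left₀ _ hz.ne',
      Real.mul_rpow hz.le hy.1, Real.rpow_add_one hz.ne',
      show (z : ℂ) * Complex.I * (1 + y * Complex.I) = z * Complex.I + ((-(z * y) : ℝ) : ℂ) by
        push_cast; linear_combination ((z : ℂ) * y) * Complex.I_sq,
      Complex.exp_add]
    push_cast
    ring
  refine ⟨(∫ x in (0 : ℝ)..1, f (x + Complex.I)).re, ?_, ?_⟩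
  · refine (Complex.abs_re_le_norm _).trans ?_
    have h1 := intervalIntegral.norm_integral_le_of_norm_le_const (a := 0) (b := 1)
      (f := fun x : ℝ => f (x + Complex.I)) (C := 3 ^ s * Real.exp (-z)) ?_
    · simpa using h1
    · intro x hx
      rw [uIoc_of_le zero_le_one] at hx
      simp only [hf, norm_mul]
      refine mul_le_mul ((norm_cpow_ofReal_le _ _).trans
        (Real.rpow_le_rpow (norm_nonneg _) ?_ hs.le)) ?_ (norm_nonneg _) (by positivity)
      · have h5 : (1 : ℂ) - (x + Complex.I) ^ 2 =
            ((2 - x ^ 2 : ℝ) : ℂ) + ((-2 * x : ℝ) : ℂ) * Complex.I := by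
          push_cast; linear_combination -Complex.I_sq
        rw [h5, Complex.norm_add_mul_I]
        refine Real.sqrt_le_iff.2 ⟨by norm_num, ?_⟩
        nlinarith [hx.1, hx.2, pow_pos hx.1 2, mul_nonneg hx.1.le (sub_nonneg.2 hx.2),
          pow_le_one₀ hx.1.le hx.2 (n := 4)]
      · rw [Complex.norm_exp]
        refine (Real.exp_le_exp.2 (le_of_eq ?_))
        simp
  · rw [mul_assoc, ← hright, ← hbot]
    have h6 : ∫ x in (0 : ℝ)..1, f x = (∫ x in (0 : ℝ)..1, f (x + Complex.I)) -
      Complex.I * (∫ y in (0 : ℝ)..1, f (1 + y * Complex.I)) +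
      Complex.I * ∫ y in (0 : ℝ)..1, f (y * Complex.I) := by
      linear_combination hrect
    rw [h6, Complex.add_re, hleft, add_zero, Complex.sub_re, mul_sub,
      mul_left_comm Complex.I, Complex.re_ofReal_mul]

/-- Leading asymptotics of the Poisson integral, for orders for which the weight
`(1 - t^2) ^ (m - 1/2)` is continuous at the branch points. -/
lemma tendsto_poissonIntegral_of_half_lt {m : ℝ} (hm : 1 / 2 < m) :
    Tendsto (fun z => z ^ (m + 1 / 2) * poissonIntegral m z -
      poissonAmplitude m * Real.cos (z - (m * Real.pi / 2 + Real.pi / 4))) atTop (𝓝 0) := by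
  set s := m - 1 / 2 with hs'
  have hs : 0 < s := by linarith
  set K : ℝ → ℂ := fun z => ∫ u in (0 : ℝ)..z,
      ((u ^ s * Real.exp (-u) : ℝ) : ℂ) *
        (((u / z : ℝ) : ℂ) + ((-2 : ℝ) : ℂ) * Complex.I) ^ (s : ℂ) with hK
  set L : ℂ := (Real.Gamma (s + 1) : ℂ) * (((-2 : ℝ) : ℂ) * Complex.I) ^ (s : ℂ) with hL
  have hlim : Tendsto K atTop (𝓝 L) := tendsto_integral_branch hs
  have hLre : ∀ z : ℝ, -2 * (Complex.I * Complex.exp ((z : ℂ) * Complex.I) * L).re =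
      poissonAmplitude m * Real.cos (z - (m * Real.pi / 2 + Real.pi / 4)) := by
    intro z
    rw [hL, neg_two_I_cpow]
    have h1 : Complex.I * Complex.exp ((z : ℂ) * Complex.I) * ((Real.Gamma (s + 1) : ℂ) *
        (((2 ^ s : ℝ) : ℂ) * Complex.exp (((-(Real.pi * s / 2) : ℝ) : ℂ) * Complex.I))) =
        ((Real.Gamma (s + 1) * 2 ^ s : ℝ) : ℂ) *
          (Complex.I * Complex.exp (((z - Real.pi * s / 2 : ℝ) : ℂ) * Complex.I)) := by
      rw [show ((z - Real.pi * s / 2 : ℝ) : ℂ) * Complex.I = (z : ℂ) * Complex.I +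
        ((-(Real.pi * s / 2) : ℝ) : ℂ) * Complex.I by push_cast; ring, Complex.exp_add]
      push_cast
      ring
    rw [h1, Complex.re_ofReal_mul, Complex.I_mul_re, Complex.exp_ofReal_mul_I_im, poissonAmplitude,
      show m + 1 / 2 = s + 1 by rw [hs']; ring, Real.rpow_add_one two_ne_zero,
      show z - (m * Real.pi / 2 + Real.pi / 4) = (z - Real.pi * s / 2) - Real.pi / 2 by
        rw [hs']; ring, Real.cos_sub_pi_div_two]
    ring
  have htop : Tendsto (fun z : ℝ => 2 * (3 ^ s * (z ^ (s + 1) * Real.exp (-1 * z))) +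
      2 * ‖K z - L‖) atTop (𝓝 0) := by
    have h1 := ((tendsto_rpow_mul_exp_neg_mul_atTop_nhds_zero (s + 1) 1 one_pos).const_mul
      ((3 : ℝ) ^ s)).const_mul 2
    have h2 := ((tendsto_iff_norm_sub_tendsto_zero.1 hlim)).const_mul 2
    simpa using h1.add h2
  refine squeeze_zero_norm' ?_ htop
  filter_upwards [eventually_gt_atTop 0] with z hz
  obtain ⟨top, ht, h⟩ := integral_eq_contour hs hz
  rw [poissonIntegral_eq_two_mul m z hm, ← hLre, show m + 1 / 2 = s + 1 by rw [hs']; ring,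
    ← mul_assoc, mul_comm _ (2 : ℝ), mul_assoc, h]
  have e : 2 * (z ^ (s + 1) * top - (Complex.I * Complex.exp ((z : ℂ) * Complex.I) * K z).re) -
      -2 * (Complex.I * Complex.exp ((z : ℂ) * Complex.I) * L).re =
      2 * (z ^ (s + 1) * top) -
        2 * (Complex.I * Complex.exp ((z : ℂ) * Complex.I) * (K z - L)).re := by
    rw [mul_sub _ (K z) L, Complex.sub_re]; ring
  rw [e]
  have hp : 0 < z ^ (s + 1) := Real.rpow_pos_of_pos hz _
  refine (norm_sub_le _ _).trans (add_le_add ?_ ?_)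
  · rw [norm_mul, norm_mul, Real.norm_eq_abs, Real.norm_eq_abs, Real.norm_eq_abs, abs_two,
      abs_of_pos hp, neg_one_mul]
    nlinarith [mul_le_mul_of_nonneg_left ht hp.le]
  · rw [norm_mul, Real.norm_eq_abs, abs_two, Real.norm_eq_abs]
    refine mul_le_mul_of_nonneg_left ((Complex.abs_re_le_norm _).trans ?_) zero_le_two
    rw [norm_mul, norm_mul, Complex.norm_I, Complex.norm_exp_ofReal_mul_I, one_mul, one_mul]

lemma poissonAmplitude_pos {m : ℝ} (hm : 0 ≤ m) : 0 < poissonAmplitude m :=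
  mul_pos (by positivity) (Real.Gamma_pos_of_pos (by linarith))

lemma poissonAmplitude_add_one {m : ℝ} (hm : 0 ≤ m) :
    poissonAmplitude (m + 1) = (2 * m + 1) * poissonAmplitude m := by
  unfold poissonAmplitude
  rw [show m + 1 + 1 / 2 = (m + 1 / 2) + 1 by ring, Real.Gamma_add_one (by linarith),
    Real.rpow_add_one two_ne_zero]
  ring

/-- Leading asymptotics of the Poisson integral, i.e. of the Bessel function of order `m`. Small
orders are reached from larger ones by the recurrence. -/
theorem tendsto_poissonIntegral {m : ℝ} (hm : 0 < m) :
    Tendsto (fun z => z ^ (m + 1 / 2) * poissonIntegral m z -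
      poissonAmplitude m * Real.cos (z - (m * Real.pi / 2 + Real.pi / 4))) atTop (𝓝 0) := by
  have h1 := tendsto_poissonIntegral_of_half_lt (m := m + 1) (by linarith)
  have h2 := tendsto_poissonIntegral_of_half_lt (m := m + 2) (by linarith)
  have hA1 := poissonAmplitude_add_one hm.le
  have hA2 : poissonAmplitude (m + 2) = (2 * m + 3) * ((2 * m + 1) * poissonAmplitude m) := by
    rw [← hA1, show m + 2 = (m + 1) + 1 by ring, poissonAmplitude_add_one (by linarith)]; ring
  have hb : Tendsto (fun z : ℝ => (2 * m + 2) * (poissonAmplitude (m + 1) *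
      Real.cos (z - ((m + 1) * Real.pi / 2 + Real.pi / 4))) * z⁻¹) atTop (𝓝 0) := by
    refine squeeze_zero_norm (a := fun z : ℝ => ((2 * m + 2) * poissonAmplitude (m + 1)) * ‖z⁻¹‖)
      (fun z => ?_) ?_
    · rw [norm_mul, norm_mul, norm_mul]
      rw [Real.norm_of_nonneg (show 0 ≤ 2 * m + 2 by linarith),
        Real.norm_of_nonneg (poissonAmplitude_pos (by linarith)).le, ← mul_assoc]
      refine mul_le_mul_of_nonneg_right ?_ (norm_nonneg _)
      exact mul_le_of_le_one_right (mul_nonneg (by linarith)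
        (poissonAmplitude_pos (by linarith)).le) (Real.abs_cos_le_one _)
    · simpa using (tendsto_inv_atTop_zero (𝕜 := ℝ)).norm.const_mul ((2 * m + 2) * poissonAmplitude (m + 1))
  have h3 : Tendsto (fun z : ℝ => ((2 * m + 2) * (z ^ (m + 1 + 1 / 2) * poissonIntegral (m + 1) z -
      poissonAmplitude (m + 1) * Real.cos (z - ((m + 1) * Real.pi / 2 + Real.pi / 4))) * z⁻¹ +
      (2 * m + 2) * (poissonAmplitude (m + 1) *
        Real.cos (z - ((m + 1) * Real.pi / 2 + Real.pi / 4))) * z⁻¹ -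
      (2 * m + 3)⁻¹ * (z ^ (m + 2 + 1 / 2) * poissonIntegral (m + 2) z -
      poissonAmplitude (m + 2) * Real.cos (z - ((m + 2) * Real.pi / 2 + Real.pi / 4)))) *
      (2 * m + 1)⁻¹) atTop (𝓝 0) := by
    have := ((((h1.const_mul (2 * m + 2)).mul tendsto_inv_atTop_zero).add hb).sub
      (h2.const_mul (2 * m + 3)⁻¹)).mul_const (2 * m + 1)⁻¹
    simpa using this
  refine h3.congr' ?_
  filter_upwards [eventually_gt_atTop 0] with z hz
  have hr := poissonIntegral_recurrence hm.le z
  have e1 : z ^ (m + 1 + 1 / 2) = z ^ (m + 1 / 2) * z := by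
    rw [← Real.rpow_add_one hz.ne']; congr 1; ring
  have e2 : z ^ (m + 2 + 1 / 2) = z ^ (m + 1 / 2) * z ^ 2 := by
    rw [← Real.rpow_two, ← Real.rpow_add hz]; congr 1; ring
  have e3 : Real.cos (z - ((m + 2) * Real.pi / 2 + Real.pi / 4)) =
      -Real.cos (z - (m * Real.pi / 2 + Real.pi / 4)) := by
    rw [← Real.cos_sub_pi]; congr 1; ring
  rw [e1, e2, e3, hA2]
  have p1 : (2 * m + 1) ≠ 0 := by linarith
  have p3 : (2 * m + 3) ≠ 0 := by linarith
  have hr' : poissonIntegral m z = ((2 * m + 2) * poissonIntegral (m + 1) z -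
      z ^ 2 / (2 * m + 3) * poissonIntegral (m + 2) z) / (2 * m + 1) := by
    rw [eq_div_iff p1]; linarith
  rw [hr']
  field_simp
  ring

/-! ### Mean value inequalities and bounds on the potential -/

/-- Mean value inequality with a variable bound on the derivative. -/
lemma norm_sub_le_of_norm_deriv_le {E : Type*} [NormedAddCommGroup E] [NormedSpace ℝ E]
    {f f' : ℝ → E} {B B' : ℝ → ℝ} {a b : ℝ}
    (hf : ∀ x ∈ Icc a b, HasDerivAt f (f' x) x) (hB : ∀ x ∈ Icc a b, HasDerivAt B (B' x) x)
    (h : ∀ x ∈ Icc a b, ‖f' x‖ ≤ B' x) {x : ℝ} (hx : x ∈ Icc a b) :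
    ‖f x - f a‖ ≤ B x - B a := by
  refine image_norm_le_of_norm_deriv_right_le_deriv_boundary' (f := fun y => f y - f a)
    (f' := f') (B := fun y => B y - B a) (B' := B') (a := a) (b := b) ?_ ?_ ?_ ?_ ?_ ?_ hx
  · exact fun y hy => ((hf y hy).continuousAt.sub continuousAt_const).continuousWithinAt
  · exact fun y hy => ((hf y (Ico_subset_Icc_self hy)).sub_const _).hasDerivWithinAt
  · simp
  · exact fun y hy => ((hB y hy).continuousAt.sub continuousAt_const).continuousWithinAt
  · exact fun y hy => ((hB y (Ico_subset_Icc_self hy)).sub_const _).hasDerivWithinAt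
  · exact fun y hy => h y (Ico_subset_Icc_self hy)

/-- Mean value inequality starting from a possibly singular endpoint `0`, where both the function
and its majorant vanish. -/
lemma norm_le_of_norm_deriv_le {E : Type*} [NormedAddCommGroup E] [NormedSpace ℝ E]
    {f f' : ℝ → E} {B B' : ℝ → ℝ} {X : ℝ}
    (hf : ∀ x ∈ Ioc 0 X, HasDerivAt f (f' x) x) (hB : ∀ x ∈ Ioc 0 X, HasDerivAt B (B' x) x)
    (h : ∀ x ∈ Ioc 0 X, ‖f' x‖ ≤ B' x) (hf0 : Tendsto f (𝓝[>] 0) (𝓝 0))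
    (hB0 : Tendsto B (𝓝[>] 0) (𝓝 0)) {x : ℝ} (hx : x ∈ Ioc 0 X) : ‖f x‖ ≤ B x := by
  have h1 : Tendsto (fun a => ‖f x - f a‖) (𝓝[>] 0) (𝓝 ‖f x - 0‖) :=
    (tendsto_const_nhds.sub hf0).norm
  have h2 : Tendsto (fun a => B x - B a) (𝓝[>] 0) (𝓝 (B x - 0)) := tendsto_const_nhds.sub hB0
  rw [sub_zero] at h1 h2
  refine le_of_tendsto_of_tendsto h1 h2 ?_
  filter_upwards [Ioo_mem_nhdsGT hx.1] with a ha
  have hs : ∀ y ∈ Icc a x, y ∈ Ioc 0 X := fun y hy => ⟨ha.1.trans_le hy.1, hy.2.trans hx.2⟩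
  exact norm_sub_le_of_norm_deriv_le (fun y hy => hf y (hs y hy)) (fun y hy => hB y (hs y hy))
    (fun y hy => h y (hs y hy)) ⟨ha.2.le, le_rfl⟩

lemma exists_forall_pos_le {F : ℝ → ℝ} (hF : ContinuousOn F (Ioi 0))
    (h0 : ∃ K, ∀ᶠ r in 𝓝[>] 0, F r ≤ K) (h1 : ∃ K, ∀ᶠ r in atTop, F r ≤ K) :
    ∃ K > 0, ∀ r > 0, F r ≤ K := by
  obtain ⟨K0, h0⟩ := h0
  obtain ⟨K1, h1⟩ := h1
  obtain ⟨R, hR⟩ := eventually_atTop.1 h1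
  obtain ⟨d, hd, hd'⟩ := mem_nhdsGT_iff_exists_Ioo_subset.1 h0
  have hd0 : (0 : ℝ) < d := hd
  obtain ⟨K2, hK2⟩ := (isCompact_Icc (a := d) (b := R)).bddAbove_image
    (hF.mono fun x hx => hd0.trans_le hx.1)
  refine ⟨max (max (max K0 K1) K2) 1, by positivity, fun r hr => ?_⟩
  rcases lt_or_ge r d with h | h
  · exact (show F r ≤ K0 from hd' ⟨hr, h⟩).trans (by simp)
  · rcases le_or_gt r R with h' | h'
    · exact (hK2 ⟨r, ⟨h, h'⟩, rfl⟩).trans (by simp)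
    · exact (hR r h'.le).trans (by simp)

namespace IsAdmissiblePotential

variable {Φ : ℝ → ℝ} {α β : ℝ}

lemma tendsto_div_zero (h : IsAdmissiblePotential Φ α β) :
    ∃ C₀ > 0, Tendsto (fun r => Φ r / r ^ α) (𝓝[>] 0) (𝓝 C₀) := by
  obtain ⟨C, hC, ho⟩ := h.asymp_zero
  refine ⟨C, hC, ?_⟩
  have h1 := ho.tendsto_div_nhds_zero.add_const C
  rw [zero_add] at h1
  refine h1.congr' ?_
  filter_upwards [self_mem_nhdsWithin] with r hr
  have : r ^ α ≠ 0 := (Real.rpow_pos_of_pos hr _).ne'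
  field_simp
  ring

lemma tendsto_div_top (h : IsAdmissiblePotential Φ α β) :
    ∃ C > 0, Tendsto (fun r => Φ r / r ^ β) atTop (𝓝 C) := by
  obtain ⟨C, hC, ho⟩ := h.asymp_top
  refine ⟨C, hC, ?_⟩
  have h1 := ho.tendsto_div_nhds_zero.add_const C
  rw [zero_add] at h1
  refine h1.congr' ?_
  filter_upwards [eventually_gt_atTop 0] with r hr
  have : r ^ β ≠ 0 := (Real.rpow_pos_of_pos hr _).ne'
  field_simp
  ring

lemma contDiffOn_deriv (h : IsAdmissiblePotential Φ α β) :
    ContDiffOn ℝ 1 (deriv Φ) (Ioi 0) :=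
  ((contDiffOn_succ_iff_deriv_of_isOpen (n := 1) isOpen_Ioi).1 h.contDiffOn).2.2

lemma hasDerivAt (h : IsAdmissiblePotential Φ α β) {r : ℝ} (hr : 0 < r) :
    HasDerivAt Φ (deriv Φ r) r :=
  ((h.contDiffOn.differentiableOn (by norm_num)).differentiableAt (Ioi_mem_nhds hr)).hasDerivAt

lemma hasDerivAt_deriv (h : IsAdmissiblePotential Φ α β) {r : ℝ} (hr : 0 < r) :
    HasDerivAt (deriv Φ) (deriv (deriv Φ) r) r :=
  ((h.contDiffOn_deriv.differentiableOn (by norm_num)).differentiableAt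
    (Ioi_mem_nhds hr)).hasDerivAt

lemma continuousOn (h : IsAdmissiblePotential Φ α β) : ContinuousOn Φ (Ioi 0) :=
  h.contDiffOn.continuousOn

lemma continuousOn_deriv_deriv (h : IsAdmissiblePotential Φ α β) :
    ContinuousOn (deriv (deriv Φ)) (Ioi 0) :=
  h.contDiffOn_deriv.continuousOn_deriv_of_isOpen isOpen_Ioi le_rfl

lemma exists_le_rpow (h : IsAdmissiblePotential Φ α β) :
    ∃ C > 0, ∀ r > 0, Φ r ≤ C * r ^ α := by
  have hc : ContinuousOn (fun r => Φ r / r ^ α) (Ioi 0) :=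
    h.continuousOn.div (fun r hr => (Real.continuousAt_rpow_const _ _
      (Or.inl (ne_of_gt hr))).continuousWithinAt) fun r hr => (Real.rpow_pos_of_pos hr _).ne'
  obtain ⟨C₀, -, h0⟩ := h.tendsto_div_zero
  obtain ⟨C₁, hC₁, h1⟩ := h.tendsto_div_top
  have htop : ∀ᶠ r in atTop, Φ r / r ^ α ≤ C₁ + 1 := by
    filter_upwards [h1.eventually_le_const (show C₁ < C₁ + 1 by linarith),
      eventually_ge_atTop 1] with r hr hr1
    have hr0 : 0 < r := by linarith
    refine le_trans ?_ hr
    refine div_le_div_of_nonneg_left (h.pos r hr0).le (Real.rpow_pos_of_pos hr0 _) ?_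
    exact Real.rpow_le_rpow_of_exponent_le hr1 (by linarith [h.neg_two_lt, h.lt_neg_two])
  obtain ⟨K, hK, hb⟩ := exists_forall_pos_le hc
    ⟨C₀ + 1, h0.eventually_le_const (by linarith)⟩ ⟨C₁ + 1, htop⟩
  exact ⟨K, hK, fun r hr => (div_le_iff₀ (Real.rpow_pos_of_pos hr _)).1 (hb r hr)⟩

lemma eventually_mul_rpow_le_zero (h : IsAdmissiblePotential Φ α β) :
    ∃ c > 0, ∀ᶠ r in 𝓝[>] 0, c * r ^ α ≤ Φ r := by
  obtain ⟨C₀, hC, h0⟩ := h.tendsto_div_zero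
  refine ⟨C₀ / 2, by positivity, ?_⟩
  filter_upwards [h0.eventually_const_le (show C₀ / 2 < C₀ by linarith), self_mem_nhdsWithin]
    with r hr hr0
  exact (le_div_iff₀ (Real.rpow_pos_of_pos hr0 _)).1 hr

lemma eventually_mul_rpow_le_top (h : IsAdmissiblePotential Φ α β) :
    ∃ c > 0, ∀ᶠ r in atTop, c * r ^ β ≤ Φ r := by
  obtain ⟨C₀, hC, h0⟩ := h.tendsto_div_top
  refine ⟨C₀ / 2, by positivity, ?_⟩
  filter_upwards [h0.eventually_const_le (show C₀ / 2 < C₀ by linarith), eventually_gt_atTop 0]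
    with r hr hr0
  exact (le_div_iff₀ (Real.rpow_pos_of_pos hr0 _)).1 hr

lemma exists_inv_sqrt_le (h : IsAdmissiblePotential Φ α β) :
    ∃ C > 0, ∀ r > 0, (√(Φ r))⁻¹ ≤ C * (r ^ (-α / 2) + r ^ (-β / 2)) := by
  have hrp : ∀ p : ℝ, ContinuousOn (fun r : ℝ => r ^ p) (Ioi 0) := fun p r hr =>
    (Real.continuousAt_rpow_const _ _ (Or.inl (ne_of_gt hr))).continuousWithinAt
  have hp : ∀ r > 0, 0 < Φ r * (r ^ (-α) + r ^ (-β)) := fun r hr => by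
    have := h.pos r hr
    positivity
  have hc : ContinuousOn (fun r => (Φ r * (r ^ (-α) + r ^ (-β)))⁻¹) (Ioi 0) :=
    (h.continuousOn.mul ((hrp _).add (hrp _))).inv₀ fun r hr => (hp r hr).ne'
  obtain ⟨c0, hc0, h0⟩ := h.eventually_mul_rpow_le_zero
  obtain ⟨c1, hc1, h1⟩ := h.eventually_mul_rpow_le_top
  have hz : ∀ᶠ r in 𝓝[>] 0, (Φ r * (r ^ (-α) + r ^ (-β)))⁻¹ ≤ c0⁻¹ := by
    filter_upwards [h0, self_mem_nhdsWithin] with r hr hr0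
    have hr0' : (0 : ℝ) < r := hr0
    refine inv_anti₀ hc0 ?_
    have e : r ^ α * r ^ (-α) = 1 := by rw [← Real.rpow_add hr0']; simp
    have e2 : 0 ≤ Φ r * r ^ (-β) := mul_nonneg (h.pos r hr0).le (Real.rpow_nonneg hr0'.le _)
    have := mul_le_mul_of_nonneg_right hr (Real.rpow_nonneg hr0'.le (-α))
    rw [mul_assoc, e] at this
    linarith
  have ht : ∀ᶠ r in atTop, (Φ r * (r ^ (-α) + r ^ (-β)))⁻¹ ≤ c1⁻¹ := by
    filter_upwards [h1, eventually_gt_atTop 0] with r hr hr0'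
    refine inv_anti₀ hc1 ?_
    have e : r ^ β * r ^ (-β) = 1 := by rw [← Real.rpow_add hr0']; simp
    have e2 : 0 ≤ Φ r * r ^ (-α) := mul_nonneg (h.pos r hr0').le (Real.rpow_nonneg hr0'.le _)
    have := mul_le_mul_of_nonneg_right hr (Real.rpow_nonneg hr0'.le (-β))
    rw [mul_assoc, e] at this
    linarith
  obtain ⟨K, hK, hb⟩ := exists_forall_pos_le hc ⟨c0⁻¹, hz⟩ ⟨c1⁻¹, ht⟩
  refine ⟨√K, Real.sqrt_pos.2 hK, fun r hr => ?_⟩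
  have hΦ := h.pos r hr
  have h2 : (Φ r)⁻¹ ≤ K * (r ^ (-α) + r ^ (-β)) := by
    have := hb r hr
    rw [mul_inv, ← div_eq_mul_inv, div_le_iff₀ (by positivity)] at this
    exact this
  have h3 : ∀ p : ℝ, r ^ (-p) = (r ^ (-p / 2)) ^ 2 := fun p => by
    rw [← Real.rpow_natCast, ← Real.rpow_mul hr.le]; congr 1; push_cast; ring
  rw [← Real.sqrt_inv]
  refine Real.sqrt_le_iff.2 ⟨by positivity, h2.trans ?_⟩
  rw [mul_pow, Real.sq_sqrt hK.le, h3 α, h3 β]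
  refine mul_le_mul_of_nonneg_left ?_ hK.le
  have : 0 ≤ r ^ (-α / 2) * r ^ (-β / 2) := by positivity
  nlinarith

lemma exists_le_mul_self (h : IsAdmissiblePotential Φ α β) {F : ℝ → ℝ}
    (hF : ContinuousOn F (Ioi 0)) (h0 : ∃ K, ∀ r ∈ Ioo (0 : ℝ) 1, F r ≤ K * r ^ α)
    (h1 : ∃ K, ∀ r ∈ Ioi (1 : ℝ), F r ≤ K * r ^ β) : ∃ K > 0, ∀ r > 0, F r ≤ K * Φ r := by
  obtain ⟨c0, hc0, h0'⟩ := h.eventually_mul_rpow_le_zero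
  obtain ⟨c1, hc1, h1'⟩ := h.eventually_mul_rpow_le_top
  obtain ⟨K0, h0⟩ := h0
  obtain ⟨K1, h1⟩ := h1
  have key : ∀ {r c K p : ℝ}, 0 < r → 0 < c → F r ≤ K * r ^ p → c * r ^ p ≤ Φ r →
      F r / Φ r ≤ |K| / c := by
    intro r c K p hr hc hF hΦ
    have hrp : 0 < r ^ p := Real.rpow_pos_of_pos hr _
    rw [div_le_div_iff₀ (h.pos r hr) hc]
    calc F r * c ≤ (K * r ^ p) * c := mul_le_mul_of_nonneg_right hF hc.le
      _ ≤ (|K| * r ^ p) * c := by gcongr; exact le_abs_self K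
      _ = |K| * (c * r ^ p) := by ring
      _ ≤ |K| * Φ r := mul_le_mul_of_nonneg_left hΦ (abs_nonneg _)
  have hz : ∀ᶠ r in 𝓝[>] 0, F r / Φ r ≤ |K0| / c0 := by
    filter_upwards [h0', Ioo_mem_nhdsGT zero_lt_one] with r hr hr0
    exact key hr0.1 hc0 (h0 r hr0) hr
  have ht : ∀ᶠ r in atTop, F r / Φ r ≤ |K1| / c1 := by
    filter_upwards [h1', eventually_gt_atTop 1] with r hr hr0
    exact key (by linarith) hc1 (h1 r hr0) hr
  obtain ⟨K, hK, hb⟩ := exists_forall_pos_le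
    (hF.div h.continuousOn fun r hr => (h.pos r hr).ne') ⟨|K0| / c0, hz⟩ ⟨|K1| / c1, ht⟩
  exact ⟨K, hK, fun r hr => (div_le_iff₀ (h.pos r hr)).1 (hb r hr)⟩

lemma exists_deriv_le (h : IsAdmissiblePotential Φ α β) :
    ∃ K > 0, ∀ r > 0, r * |deriv Φ r| ≤ K * Φ r := by
  obtain ⟨K0, h0⟩ := h.bound_zero
  obtain ⟨K1, h1⟩ := h.bound_top
  exact h.exists_le_mul_self (continuousOn_id.mul h.contDiffOn_deriv.continuousOn.abs)
    ⟨K0, fun r hr => (h0 r hr).1⟩ ⟨K1, fun r hr => (h1 r hr).1⟩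

lemma exists_deriv_deriv_le (h : IsAdmissiblePotential Φ α β) :
    ∃ K > 0, ∀ r > 0, r ^ 2 * |deriv (deriv Φ) r| ≤ K * Φ r := by
  obtain ⟨K0, h0⟩ := h.bound_zero
  obtain ⟨K1, h1⟩ := h.bound_top
  exact h.exists_le_mul_self ((continuousOn_id.pow 2).mul h.continuousOn_deriv_deriv.abs)
    ⟨K0, fun r hr => (h0 r hr).2⟩ ⟨K1, fun r hr => (h1 r hr).2⟩

end IsAdmissiblePotential

/-! ### The regular solution as a first-order system -/

/-- The singular first-order system satisfied by `g = w / x ^ (ℓ + 1)` and `h = -x ^ (2ℓ+2) g'`,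
for `w'' = (ℓ(ℓ+1)/x² - Q) w`, with the initial values singled out by the regular solution. -/
structure IsRegularSystem (ℓ : ℕ) (Q g h : ℝ → ℝ) : Prop where
  hasDerivAt_left : ∀ x > 0, HasDerivAt g (-(h x / x ^ (2 * ℓ + 2))) x
  hasDerivAt_right : ∀ x > 0, HasDerivAt h (x ^ (2 * ℓ + 2) * (Q x * g x)) x
  tendsto_left : Tendsto g (𝓝[>] 0) (𝓝 1)
  tendsto_right : Tendsto h (𝓝[>] 0) (𝓝 0)

/-- The weight `exp (2 ∫₀ˣ C t^(α+1) dt)` that controls the growth of regular solutions for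
potentials bounded by `C t^α`; it is constant for `x ≤ 0`. -/
noncomputable def growthWeight (C α x : ℝ) : ℝ :=
  Real.exp (2 * (C * max x 0 ^ (α + 2) / (α + 2)))

section growthWeight

variable {C α : ℝ}

lemma growthWeight_pos (x : ℝ) : 0 < growthWeight C α x := Real.exp_pos _

lemma growthWeight_of_nonpos (hα : -2 < α) {x : ℝ} (hx : x ≤ 0) : growthWeight C α x = 1 := by
  rw [growthWeight, max_eq_right hx, Real.zero_rpow (by linarith)]
  simp

lemma continuous_growthWeight (hα : -2 < α) : Continuous (growthWeight C α) := by
  have : Continuous fun x : ℝ => max x 0 ^ (α + 2) :=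
    Continuous.rpow_const (by fun_prop) fun _ => Or.inr (by linarith)
  unfold growthWeight
  fun_prop

lemma growthWeight_mono (hα : -2 < α) (hC : 0 ≤ C) : Monotone (growthWeight C α) := by
  intro x y hxy
  have h2 : 0 < α + 2 := by linarith
  unfold growthWeight
  gcongr

lemma one_le_growthWeight (hα : -2 < α) (hC : 0 ≤ C) (x : ℝ) : 1 ≤ growthWeight C α x := by
  have h2 : 0 < α + 2 := by linarith
  have : 0 ≤ max x 0 := le_max_right _ _
  exact Real.one_le_exp (by positivity)

lemma hasDerivAt_growthWeight (hα : -2 < α) {x : ℝ} (hx : 0 < x) :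
    HasDerivAt (growthWeight C α) (growthWeight C α x * (2 * (C * x ^ (α + 1)))) x := by
  have h1 : HasDerivAt (fun x : ℝ => Real.exp (2 * (C * x ^ (α + 2) / (α + 2))))
      (growthWeight C α x * (2 * (C * x ^ (α + 1)))) x := by
    have := ((((Real.hasDerivAt_rpow_const (x := x) (p := α + 2) (Or.inl hx.ne')).const_mul
      C).div_const (α + 2)).const_mul 2).exp
    refine this.congr_deriv ?_
    rw [growthWeight, max_eq_left hx.le, show α + 2 - 1 = α + 1 by ring]
    have h2 : α + 2 ≠ 0 := by linarith
    field_simp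
  refine h1.congr_of_eventuallyEq ?_
  filter_upwards [Ioi_mem_nhds hx] with y hy
  rw [growthWeight, max_eq_left (le_of_lt hy)]

end growthWeight

section Estimate

variable {ℓ : ℕ} {α C b X : ℝ} {D E Δ : ℝ → ℝ}

lemma tendsto_rpow_nhdsGT_zero {p : ℝ} (hp : 0 < p) :
    Tendsto (fun x : ℝ => x ^ p) (𝓝[>] 0) (𝓝 0) := by
  have := (Real.continuousAt_rpow_const 0 p (Or.inr hp.le)).tendsto
  rw [Real.zero_rpow hp.ne'] at this
  exact this.mono_left nhdsWithin_le_nhds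

lemma abs_le_growthWeight_mul_rpow (hα : -2 < α) (hC : 0 ≤ C) (hb : 0 ≤ b)
    (hE : ∀ x ∈ Ioc 0 X, HasDerivAt E (x ^ (2 * ℓ + 2) * Δ x) x)
    (hE0 : Tendsto E (𝓝[>] 0) (𝓝 0))
    (hΔ : ∀ x ∈ Ioc 0 X, |Δ x| ≤ b * (C * x ^ α) * growthWeight C α x) {x : ℝ}
    (hx : x ∈ Ioc 0 X) :
    |E x| ≤ b * C * (growthWeight C α x * x ^ ((2 * ℓ + 2 : ℕ) + (α + 1))) := by
  set k : ℝ := (2 * ℓ + 2 : ℕ) + (α + 1) with hk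
  have hk1 : 1 ≤ k := by
    have : (0 : ℝ) ≤ ℓ := Nat.cast_nonneg _
    rw [hk]; push_cast; linarith
  refine norm_le_of_norm_deriv_le hE (B := fun x => b * C * (growthWeight C α x * x ^ k))
    (B' := fun x => b * C * ((growthWeight C α x * (2 * (C * x ^ (α + 1)))) * x ^ k +
      growthWeight C α x * (k * x ^ (k - 1)))) ?_ ?_ hE0 ?_ hx
  · intro y hy
    exact ((hasDerivAt_growthWeight hα hy.1).mul
      (Real.hasDerivAt_rpow_const (Or.inl hy.1.ne'))).const_mul _
  · intro y hy
    have hy0 := hy.1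
    have hW := growthWeight_pos (C := C) (α := α) y
    have e : y ^ (2 * ℓ + 2) * y ^ α = y ^ (k - 1) := by
      rw [← Real.rpow_natCast, ← Real.rpow_add hy0]; congr 1; rw [hk]; push_cast; ring
    rw [Real.norm_eq_abs, abs_mul, abs_of_pos (pow_pos hy0 _)]
    calc y ^ (2 * ℓ + 2) * |Δ y| ≤ y ^ (2 * ℓ + 2) * (b * (C * y ^ α) * growthWeight C α y) :=
          mul_le_mul_of_nonneg_left (hΔ y hy) (pow_pos hy0 _).le
      _ = b * C * (growthWeight C α y * (1 * (y ^ (2 * ℓ + 2) * y ^ α))) := by ring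
      _ = b * C * (growthWeight C α y * (1 * y ^ (k - 1))) := by rw [e]
      _ ≤ b * C * (growthWeight C α y * (k * y ^ (k - 1))) := by
          have := Real.rpow_nonneg hy0.le (k - 1)
          gcongr
      _ ≤ _ := by
          refine mul_le_mul_of_nonneg_left (le_add_of_nonneg_left ?_) (by positivity)
          positivity
  · have h1 := ((continuous_growthWeight (C := C) hα).tendsto 0).mono_left
      (nhdsWithin_le_nhds (s := Ioi 0))
    have h2 := (h1.mul (tendsto_rpow_nhdsGT_zero (show 0 < k by linarith))).const_mul (b * C)
    simpa using h2

lemma abs_le_half_growthWeight (hα : -2 < α)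
    (hD : ∀ x ∈ Ioc 0 X, HasDerivAt D (-(E x / x ^ (2 * ℓ + 2))) x)
    (hD0 : Tendsto D (𝓝[>] 0) (𝓝 0))
    (hE : ∀ x ∈ Ioc 0 X,
      |E x| ≤ b * C * (growthWeight C α x * x ^ ((2 * ℓ + 2 : ℕ) + (α + 1)))) {x : ℝ}
    (hx : x ∈ Ioc 0 X) :
    |D x| ≤ b / 2 * (growthWeight C α x - 1) := by
  refine norm_le_of_norm_deriv_le hD (B := fun x => b / 2 * (growthWeight C α x - 1))
    (B' := fun x => b / 2 * (growthWeight C α x * (2 * (C * x ^ (α + 1))))) ?_ ?_ hD0 ?_ hx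
  · intro y hy
    exact ((hasDerivAt_growthWeight hα hy.1).sub_const 1).const_mul _
  · intro y hy
    have hy0 := hy.1
    rw [norm_neg, Real.norm_eq_abs, abs_div, abs_of_pos (pow_pos hy0 _),
      div_le_iff₀ (pow_pos hy0 _)]
    refine (hE y hy).trans (le_of_eq ?_)
    rw [Real.rpow_add hy0, Real.rpow_natCast]
    ring
  · have h1 := ((continuous_growthWeight (C := C) hα).tendsto 0).mono_left
      (nhdsWithin_le_nhds (s := Ioi 0))
    rw [growthWeight_of_nonpos hα le_rfl] at h1
    simpa using (h1.sub_const 1).const_mul (b / 2)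

end Estimate

namespace IsRegularSystem

variable {ℓ : ℕ} {α C ε G X : ℝ} {Q₁ Q₂ g₁ g₂ h₁ h₂ : ℝ → ℝ}

lemma bddAbove_abs_sub (s₁ : IsRegularSystem ℓ Q₁ g₁ h₁) (s₂ : IsRegularSystem ℓ Q₂ g₂ h₂)
    (X : ℝ) : ∃ B, ∀ x ∈ Ioc 0 X, |g₁ x - g₂ x| ≤ B := by
  have h0 : Tendsto (fun x => |g₁ x - g₂ x|) (𝓝[>] 0) (𝓝 0) := by
    simpa using (s₁.tendsto_left.sub s₂.tendsto_left).abs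
  obtain ⟨d, hd, hd'⟩ := mem_nhdsGT_iff_exists_Ioo_subset.1
    (h0.eventually_le_const zero_lt_one)
  have hd0 : (0 : ℝ) < d := hd
  have hc : ContinuousOn (fun x => |g₁ x - g₂ x|) (Icc d X) := fun x hx =>
    ((s₁.hasDerivAt_left x (hd0.trans_le hx.1)).continuousAt.sub
      (s₂.hasDerivAt_left x (hd0.trans_le hx.1)).continuousAt).abs.continuousWithinAt
  obtain ⟨K, hK⟩ := isCompact_Icc.bddAbove_image hc
  refine ⟨max 1 K, fun x hx => ?_⟩
  rcases lt_or_ge x d with h | h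
  · exact (show |g₁ x - g₂ x| ≤ 1 from hd' ⟨hx.1, h⟩).trans (le_max_left _ _)
  · exact (hK ⟨x, ⟨h, hx.2⟩, rfl⟩).trans (le_max_right _ _)

/-- Continuous dependence of the regular solution on the potential. The optimal constant `b` in
`|g₁ - g₂| ≤ b * growthWeight` satisfies `b ≤ (b + ε G) / 2`. -/
theorem comparison (hα : -2 < α) (hC : 0 ≤ C) (hε : 0 ≤ ε) (hG : 0 ≤ G)
    (s₁ : IsRegularSystem ℓ Q₁ g₁ h₁) (s₂ : IsRegularSystem ℓ Q₂ g₂ h₂)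
    (hQ₁ : ∀ x ∈ Ioc 0 X, |Q₁ x| ≤ C * x ^ α)
    (hQ : ∀ x ∈ Ioc 0 X, |Q₁ x - Q₂ x| ≤ ε * (C * x ^ α))
    (hg₂ : ∀ x ∈ Ioc 0 X, |g₂ x| ≤ G * growthWeight C α x) {x : ℝ} (hx : x ∈ Ioc 0 X) :
    |g₁ x - g₂ x| ≤ ε * G * growthWeight C α x ∧
    |h₁ x - h₂ x| ≤
      2 * (ε * G) * C * (growthWeight C α x * x ^ ((2 * ℓ + 2 : ℕ) + (α + 1))) := by
  have hX : 0 < X := hx.1.trans_le hx.2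
  have hD : ∀ x ∈ Ioc 0 X, HasDerivAt (fun y => g₁ y - g₂ y)
      (-((h₁ x - h₂ x) / x ^ (2 * ℓ + 2))) x := fun x hx =>
    ((s₁.hasDerivAt_left x hx.1).sub (s₂.hasDerivAt_left x hx.1)).congr_deriv (by ring)
  have hE : ∀ x ∈ Ioc 0 X, HasDerivAt (fun y => h₁ y - h₂ y)
      (x ^ (2 * ℓ + 2) * (Q₁ x * g₁ x - Q₂ x * g₂ x)) x := fun x hx =>
    ((s₁.hasDerivAt_right x hx.1).sub (s₂.hasDerivAt_right x hx.1)).congr_deriv (by ring)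
  have hD0 : Tendsto (fun y => g₁ y - g₂ y) (𝓝[>] 0) (𝓝 0) := by
    simpa using s₁.tendsto_left.sub s₂.tendsto_left
  have hE0 : Tendsto (fun y => h₁ y - h₂ y) (𝓝[>] 0) (𝓝 0) := by
    simpa using s₁.tendsto_right.sub s₂.tendsto_right
  set S : Set ℝ := (fun y => |g₁ y - g₂ y| / growthWeight C α y) '' Ioc 0 X with hS
  obtain ⟨B, hB⟩ := s₁.bddAbove_abs_sub s₂ X
  have hSb : BddAbove S := by
    refine ⟨B, ?_⟩
    rintro _ ⟨y, hy, rfl⟩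
    exact (div_le_self (abs_nonneg _) (one_le_growthWeight hα hC y)).trans (hB y hy)
  set b := sSup S with hb
  have hb1 : ∀ y ∈ Ioc 0 X, |g₁ y - g₂ y| ≤ b * growthWeight C α y := fun y hy =>
    (div_le_iff₀ (growthWeight_pos y)).1 (le_csSup hSb ⟨y, hy, rfl⟩)
  have hb0 : 0 ≤ b := by
    refine le_trans ?_ (le_csSup hSb ⟨X, ⟨hX, le_rfl⟩, rfl⟩)
    exact div_nonneg (abs_nonneg _) (growthWeight_pos _).le
  have hΔ : ∀ y ∈ Ioc 0 X, |Q₁ y * g₁ y - Q₂ y * g₂ y| ≤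
      (b + ε * G) * (C * y ^ α) * growthWeight C α y := by
    intro y hy
    have hyα : 0 ≤ C * y ^ α := mul_nonneg hC (Real.rpow_nonneg hy.1.le _)
    have hW := growthWeight_pos (C := C) (α := α) y
    rw [show Q₁ y * g₁ y - Q₂ y * g₂ y = Q₁ y * (g₁ y - g₂ y) + (Q₁ y - Q₂ y) * g₂ y by ring]
    refine (abs_add_le _ _).trans ?_
    rw [abs_mul, abs_mul]
    calc _ ≤ (C * y ^ α) * (b * growthWeight C α y) +
          ε * (C * y ^ α) * (G * growthWeight C α y) :=
        add_le_add (mul_le_mul (hQ₁ y hy) (hb1 y hy) (abs_nonneg _) hyα)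
          (mul_le_mul (hQ y hy) (hg₂ y hy) (abs_nonneg _) (mul_nonneg hε hyα))
      _ = _ := by ring
  have hbG : 0 ≤ b + ε * G := add_nonneg hb0 (mul_nonneg hε hG)
  have hE1 : ∀ y ∈ Ioc 0 X, |h₁ y - h₂ y| ≤
      (b + ε * G) * C * (growthWeight C α y * y ^ ((2 * ℓ + 2 : ℕ) + (α + 1))) :=
    fun y hy => abs_le_growthWeight_mul_rpow hα hC hbG hE hE0 hΔ hy
  have hD1 : ∀ y ∈ Ioc 0 X, |g₁ y - g₂ y| ≤ (b + ε * G) / 2 * (growthWeight C α y - 1) :=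
    fun y hy => abs_le_half_growthWeight hα hD hD0 hE1 hy
  have hb2 : b ≤ (b + ε * G) / 2 := by
    refine csSup_le ⟨_, X, ⟨hX, le_rfl⟩, rfl⟩ ?_
    rintro _ ⟨y, hy, rfl⟩
    refine (div_le_iff₀ (growthWeight_pos y)).2 ((hD1 y hy).trans ?_)
    exact mul_le_mul_of_nonneg_left (by linarith) (by positivity)
  have hb3 : b ≤ ε * G := by linarith
  refine ⟨(hb1 x hx).trans (mul_le_mul_of_nonneg_right hb3 (growthWeight_pos _).le),
    (hE1 x hx).trans ?_⟩
  have hW := growthWeight_pos (C := C) (α := α) x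
  have := Real.rpow_nonneg hx.1.le ((2 * ℓ + 2 : ℕ) + (α + 1))
  refine mul_le_mul_of_nonneg_right (mul_le_mul_of_nonneg_right (by linarith) hC) (by positivity)

lemma const (ℓ : ℕ) : IsRegularSystem ℓ (fun _ => 0) (fun _ => 1) (fun _ => 0) where
  hasDerivAt_left x _ := by simpa using hasDerivAt_const x (1 : ℝ)
  hasDerivAt_right x _ := by simpa using hasDerivAt_const x (0 : ℝ)
  tendsto_left := tendsto_const_nhds
  tendsto_right := tendsto_const_nhds

lemma abs_le_two_mul (hα : -2 < α) (hC : 0 ≤ C) (s₁ : IsRegularSystem ℓ Q₁ g₁ h₁)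
    (hQ₁ : ∀ x ∈ Ioc 0 X, |Q₁ x| ≤ C * x ^ α) {x : ℝ} (hx : x ∈ Ioc 0 X) :
    |g₁ x| ≤ 2 * growthWeight C α x ∧
    |h₁ x| ≤ 2 * C * (growthWeight C α x * x ^ ((2 * ℓ + 2 : ℕ) + (α + 1))) := by
  have h := comparison (ε := 1) (G := 1) hα hC zero_le_one zero_le_one s₁ (const ℓ) hQ₁
    (fun x hx => by simpa using hQ₁ x hx)
    (fun x _ => by simpa using one_le_growthWeight hα hC x) hx
  simp only [mul_one, one_mul, sub_zero] at h
  refine ⟨?_, h.2⟩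
  have h1 := one_le_growthWeight hα hC x
  have h2 := abs_sub_abs_le_abs_sub (g₁ x) 1
  rw [abs_one] at h2
  linarith [h.1]

lemma eqOn (hα : -2 < α) (hC : 0 ≤ C) {Q : ℝ → ℝ} (s₁ : IsRegularSystem ℓ Q g₁ h₁)
    (s₂ : IsRegularSystem ℓ Q g₂ h₂) (hQ : ∀ x > 0, |Q x| ≤ C * x ^ α) : EqOn g₁ g₂ (Ioi 0) := by
  intro x hx
  have h := comparison (ε := 0) (G := 2) hα hC le_rfl zero_le_two s₁ s₂ (X := x)
    (fun x hx => hQ x hx.1) (fun x hx => by simp)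
    (fun y hy => (abs_le_two_mul hα hC s₂ (fun x hx => hQ x hx.1) hy).1) ⟨hx, le_rfl⟩
  have h1 := h.1
  rw [zero_mul, zero_mul] at h1
  exact sub_eq_zero.1 (abs_nonpos_iff.1 h1)

end IsRegularSystem

/-- Passage from the regular solution to the first-order system. -/
lemma IsRegularSolution.isRegularSystem {Φ : ℝ → ℝ} {ℓ : ℕ} {lam : ℝ} {w : ℝ → ℝ}
    (hw : IsRegularSolution Φ ℓ lam w) :
    IsRegularSystem ℓ (fun x => lam ^ 2 * Φ x) (fun x => w x / x ^ (ℓ + 1))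
      (fun x => (ℓ + 1) * (x ^ ℓ * w x) - x ^ (ℓ + 1) * deriv w x) where
  hasDerivAt_left x hx := by
    have h := (hw.differentiableAt x hx).hasDerivAt.div (hasDerivAt_pow (ℓ + 1) x)
      (pow_pos hx _).ne'
    refine h.congr_deriv ?_
    have hx' : x ≠ 0 := ne_of_gt hx
    rw [Nat.add_sub_cancel]
    field_simp
    push_cast
    ring
  hasDerivAt_right x hx := by
    have h := (((hasDerivAt_pow ℓ x).mul (hw.differentiableAt x hx).hasDerivAt).const_mul
      ((ℓ : ℝ) + 1)).sub ((hasDerivAt_pow (ℓ + 1) x).mul (hw.hasDerivAt_deriv x hx))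
    refine h.congr_deriv ?_
    have hx' : x ≠ 0 := ne_of_gt hx
    rw [Nat.add_sub_cancel]
    rcases ℓ with _ | n
    · field_simp
      push_cast
      ring
    · rw [Nat.add_sub_cancel]
      field_simp
      push_cast
      ring
  tendsto_left := hw.tendsto_zero
  tendsto_right := by
    have h1 : Tendsto (fun x : ℝ => x ^ (2 * ℓ + 1)) (𝓝[>] 0) (𝓝 0) := by
      have := (continuous_pow (M := ℝ) (2 * ℓ + 1)).tendsto 0
      rw [zero_pow (by omega)] at this
      exact this.mono_left nhdsWithin_le_nhds
    have h2 := h1.mul ((hw.tendsto_zero.const_mul ((ℓ : ℝ) + 1)).sub hw.tendsto_deriv_zero)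
    rw [zero_mul] at h2
    refine h2.congr' ?_
    filter_upwards [self_mem_nhdsWithin] with x hx
    have hx' : x ≠ 0 := ne_of_gt hx
    field_simp
    ring

/-- Passage from the first-order system back to the regular solution. -/
lemma IsRegularSystem.isRegularSolution {Φ : ℝ → ℝ} {ℓ : ℕ} {lam α C : ℝ} {g h : ℝ → ℝ}
    (hα : -2 < α) (hC : 0 ≤ C) (hQ : ∀ x > 0, |lam ^ 2 * Φ x| ≤ C * x ^ α)
    (s : IsRegularSystem ℓ (fun x => lam ^ 2 * Φ x) g h) :
    IsRegularSolution Φ ℓ lam (fun x => x ^ (ℓ + 1) * g x) := by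
  have hd : ∀ x > 0, HasDerivAt (fun x => x ^ (ℓ + 1) * g x)
      ((ℓ + 1) * (x ^ ℓ * g x) - h x / x ^ (ℓ + 1)) x := by
    intro x hx
    have h1 := (hasDerivAt_pow (ℓ + 1) x).mul (s.hasDerivAt_left x hx)
    refine h1.congr_deriv ?_
    have hx' : x ≠ 0 := ne_of_gt hx
    rw [Nat.add_sub_cancel]
    field_simp
    push_cast
    ring
  refine ⟨fun x hx => (hd x hx).differentiableAt, fun x hx => ?_, ?_, ?_⟩
  · have h1 : HasDerivAt (fun x => (ℓ + 1) * (x ^ ℓ * g x) - h x / x ^ (ℓ + 1))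
        (((ℓ : ℝ) * (ℓ + 1) / x ^ 2 - lam ^ 2 * Φ x) * (x ^ (ℓ + 1) * g x)) x := by
      have h2 := (((hasDerivAt_pow ℓ x).mul (s.hasDerivAt_left x hx)).const_mul
        ((ℓ : ℝ) + 1)).sub ((s.hasDerivAt_right x hx).div (hasDerivAt_pow (ℓ + 1) x)
        (pow_pos hx _).ne')
      refine h2.congr_deriv ?_
      have hx' : x ≠ 0 := ne_of_gt hx
      rw [Nat.add_sub_cancel]
      rcases ℓ with _ | n
      · field_simp
        push_cast
        ring
      · rw [Nat.add_sub_cancel]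
        field_simp
        push_cast
        ring
    refine h1.congr_of_eventuallyEq ?_
    filter_upwards [Ioi_mem_nhds hx] with y hy
    exact (hd y hy).deriv
  · refine s.tendsto_left.congr' ?_
    filter_upwards [self_mem_nhdsWithin] with x hx
    have hx' : x ≠ 0 := ne_of_gt hx
    field_simp
  · have hb : Tendsto (fun x => h x / x ^ (2 * ℓ + 1)) (𝓝[>] 0) (𝓝 0) := by
      have h1 := ((continuous_growthWeight (C := C) hα).tendsto 0).mono_left
        (nhdsWithin_le_nhds (s := Ioi 0))
      have h2 := ((h1.mul (tendsto_rpow_nhdsGT_zero (show 0 < α + 2 by linarith))).const_mul (2 * C))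
      rw [mul_zero, mul_zero] at h2
      refine squeeze_zero_norm' ?_ h2
      filter_upwards [self_mem_nhdsWithin] with x hx
      have hx0 : 0 < x := hx
      rw [Real.norm_eq_abs, abs_div, abs_of_pos (pow_pos hx0 _), div_le_iff₀ (pow_pos hx0 _)]
      refine (s.abs_le_two_mul (X := x) hα hC (fun y hy => hQ y hy.1) ⟨hx, le_rfl⟩).2.trans
        (le_of_eq ?_)
      rw [mul_assoc (2 * C), mul_assoc (growthWeight C α x), ← Real.rpow_natCast x (2 * ℓ + 1),
        ← Real.rpow_add hx0]
      congr 3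
      push_cast; ring
    have h3 := (s.tendsto_left.const_mul ((ℓ : ℝ) + 1)).sub hb
    rw [mul_one, sub_zero] at h3
    refine h3.congr' ?_
    filter_upwards [self_mem_nhdsWithin] with x hx
    have hx' : x ≠ 0 := ne_of_gt hx
    rw [(hd x hx).deriv]
    field_simp
    ring

/-! ### Existence of the regular solution -/

section Existence

open MeasureTheory

variable {ℓ : ℕ} {Q : ℝ → ℝ} {α C : ℝ}

/-- The integrand `t ^ (2ℓ+2) Q(t) W(t) u(t)`, `W` the growth weight, extended by `0` to `t ≤ 0`. -/
noncomputable def innerIntegrand (ℓ : ℕ) (Q : ℝ → ℝ) (C α : ℝ) (u : ℝ → ℝ) (t : ℝ) : ℝ :=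
  if 0 < t then t ^ (2 * ℓ + 2) * (Q t * (growthWeight C α t * u t)) else 0

/-- The candidate for the second component `h` of the regular system whose first component is
the growth weight times `u`. -/
noncomputable def innerPrimitive (ℓ : ℕ) (Q : ℝ → ℝ) (C α : ℝ) (u : ℝ → ℝ) (y : ℝ) : ℝ :=
  ∫ t in (0 : ℝ)..y, innerIntegrand ℓ Q C α u t

/-- The integrand of the outer integral in Picard's operator, extended by `0` to `y ≤ 0`. -/
noncomputable def outerIntegrand (ℓ : ℕ) (Q : ℝ → ℝ) (C α : ℝ) (u : ℝ → ℝ) (y : ℝ) : ℝ :=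
  if 0 < y then innerPrimitive ℓ Q C α u y / y ^ (2 * ℓ + 2) else 0

lemma continuous_innerIntegrand (hα : -2 < α) (hQc : ContinuousOn Q (Ioi 0))
    (hQ : ∀ x > 0, |Q x| ≤ C * x ^ α) {u : ℝ → ℝ} (hu : Continuous u) :
    Continuous (innerIntegrand ℓ Q C α u) := by
  have hW := continuous_growthWeight (C := C) hα
  rw [continuous_iff_continuousAt]
  intro t
  rcases lt_trichotomy t 0 with ht | rfl | ht
  · refine (continuousAt_const (y := (0 : ℝ))).congr ?_
    filter_upwards [Iio_mem_nhds ht] with s hs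
    rw [innerIntegrand, if_neg (not_lt.2 (le_of_lt hs))]
  · have h0 : innerIntegrand ℓ Q C α u 0 = 0 := by rw [innerIntegrand, if_neg (lt_irrefl _)]
    have hp : 0 < ((2 * ℓ + 2 : ℕ) : ℝ) + α := by
      have : (0 : ℝ) ≤ ℓ := Nat.cast_nonneg _
      push_cast; linarith
    have hlim : Tendsto (fun t : ℝ => |t| ^ (((2 * ℓ + 2 : ℕ) : ℝ) + α) * (C *
        |growthWeight C α t * u t|)) (𝓝 0) (𝓝 0) := by
      have h1 : Continuous fun t : ℝ => |t| ^ (((2 * ℓ + 2 : ℕ) : ℝ) + α) * (C *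
          |growthWeight C α t * u t|) :=
        (continuous_abs.rpow_const fun _ => Or.inr hp.le).mul
          (continuous_const.mul (hW.mul hu).abs)
      have h2 := h1.tendsto 0
      rwa [abs_zero, Real.zero_rpow hp.ne', zero_mul] at h2
    rw [ContinuousAt, h0]
    refine squeeze_zero_norm (fun t => ?_) hlim
    rw [innerIntegrand]
    split_ifs with ht
    · rw [Real.norm_eq_abs, abs_mul, abs_mul, abs_of_pos ht, abs_of_pos (pow_pos ht _),
        Real.rpow_add ht, Real.rpow_natCast, mul_assoc, ← mul_assoc (t ^ α), mul_comm (t ^ α)]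
      have := hQ t ht
      gcongr
    · have hC : 0 ≤ C := by
        have := (abs_nonneg _).trans (hQ 1 one_pos)
        simpa using this
      rw [norm_zero]; positivity
  · have h1 : ContinuousAt (fun t => t ^ (2 * ℓ + 2) * (Q t * (growthWeight C α t * u t))) t :=
      (continuousAt_id.pow _).mul ((hQc.continuousAt (Ioi_mem_nhds ht)).mul
        (hW.mul hu).continuousAt)
    refine h1.congr ?_
    filter_upwards [Ioi_mem_nhds ht] with s hs
    rw [innerIntegrand, if_pos (show 0 < s from hs)]

lemma hasDerivAt_innerPrimitive (hα : -2 < α) (hQc : ContinuousOn Q (Ioi 0))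
    (hQ : ∀ x > 0, |Q x| ≤ C * x ^ α) {u : ℝ → ℝ} (hu : Continuous u) (y : ℝ) :
    HasDerivAt (innerPrimitive ℓ Q C α u) (innerIntegrand ℓ Q C α u y) y :=
  have hc := continuous_innerIntegrand (ℓ := ℓ) hα hQc hQ hu
  intervalIntegral.integral_hasDerivAt_right (hc.intervalIntegrable _ _)
    (hc.stronglyMeasurableAtFilter _ _) hc.continuousAt

lemma tendsto_innerPrimitive (hα : -2 < α) (hQc : ContinuousOn Q (Ioi 0))
    (hQ : ∀ x > 0, |Q x| ≤ C * x ^ α) {u : ℝ → ℝ} (hu : Continuous u) :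
    Tendsto (innerPrimitive ℓ Q C α u) (𝓝[>] 0) (𝓝 0) := by
  have h := (hasDerivAt_innerPrimitive (ℓ := ℓ) hα hQc hQ hu 0).continuousAt.tendsto
  rw [show innerPrimitive ℓ Q C α u 0 = 0 from intervalIntegral.integral_same] at h
  exact h.mono_left nhdsWithin_le_nhds

lemma abs_innerPrimitive_sub_le (hα : -2 < α) (hQc : ContinuousOn Q (Ioi 0))
    (hQ : ∀ x > 0, |Q x| ≤ C * x ^ α) {u v : ℝ → ℝ} (hu : Continuous u) (hv : Continuous v)
    {b : ℝ} (hb : ∀ x, |u x - v x| ≤ b) {x : ℝ} (hx : 0 < x) :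
    |innerPrimitive ℓ Q C α u x - innerPrimitive ℓ Q C α v x| ≤
      b * C * (growthWeight C α x * x ^ ((2 * ℓ + 2 : ℕ) + (α + 1))) := by
  have hC : 0 ≤ C := by simpa using (abs_nonneg _).trans (hQ 1 one_pos)
  have hb0 : 0 ≤ b := (abs_nonneg _).trans (hb 0)
  refine abs_le_growthWeight_mul_rpow (X := x) (Δ := fun t => Q t * (growthWeight C α t *
    (u t - v t))) (E := fun x => innerPrimitive ℓ Q C α u x - innerPrimitive ℓ Q C α v x)
    hα hC hb0 ?_ ?_ ?_ ⟨hx, le_rfl⟩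
  · intro y hy
    refine ((hasDerivAt_innerPrimitive hα hQc hQ hu y).sub
      (hasDerivAt_innerPrimitive hα hQc hQ hv y)).congr_deriv ?_
    rw [innerIntegrand, innerIntegrand, if_pos hy.1, if_pos hy.1]
    ring
  · simpa using (tendsto_innerPrimitive hα hQc hQ hu).sub (tendsto_innerPrimitive hα hQc hQ hv)
  · intro y hy
    have hW := growthWeight_pos (C := C) (α := α) y
    have hyα : 0 ≤ C * y ^ α := mul_nonneg hC (Real.rpow_nonneg hy.1.le _)
    rw [abs_mul, abs_mul, abs_of_pos hW]
    calc |Q y| * (growthWeight C α y * |u y - v y|)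
        ≤ (C * y ^ α) * (growthWeight C α y * b) := by
          have h1 := hQ y hy.1
          have h2 := hb y
          gcongr
      _ = _ := by ring

lemma innerPrimitive_zero (y : ℝ) : innerPrimitive ℓ Q C α (fun _ => 0) y = 0 := by
  have : innerIntegrand ℓ Q C α (fun _ => 0) = fun _ => 0 := by
    funext t; simp [innerIntegrand]
  rw [innerPrimitive, this, intervalIntegral.integral_zero]

lemma continuousOn_outerIntegrand (hα : -2 < α) (hQc : ContinuousOn Q (Ioi 0))
    (hQ : ∀ x > 0, |Q x| ≤ C * x ^ α) {u : ℝ → ℝ} (hu : Continuous u) :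
    ContinuousOn (outerIntegrand ℓ Q C α u) (Ioi 0) := by
  have h1 : ContinuousOn (fun y => innerPrimitive ℓ Q C α u y / y ^ (2 * ℓ + 2)) (Ioi 0) :=
    fun y hy => ((hasDerivAt_innerPrimitive hα hQc hQ hu y).continuousAt.div
      (continuousAt_id.pow _) (pow_pos hy _).ne').continuousWithinAt
  refine h1.congr fun y hy => ?_
  rw [outerIntegrand, if_pos (show 0 < y from hy)]

lemma intervalIntegrable_outerIntegrand (hα : -2 < α) (hQc : ContinuousOn Q (Ioi 0))
    (hQ : ∀ x > 0, |Q x| ≤ C * x ^ α) {u : ℝ → ℝ} (hu : Continuous u) {b : ℝ}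
    (hb : ∀ x, |u x| ≤ b) (x y : ℝ) :
    IntervalIntegrable (outerIntegrand ℓ Q C α u) volume x y := by
  suffices h : ∀ x, IntervalIntegrable (outerIntegrand ℓ Q C α u) volume 0 x from
    (h x).symm.trans (h y)
  intro x
  have hC : 0 ≤ C := by simpa using (abs_nonneg _).trans (hQ 1 one_pos)
  have hb0 : 0 ≤ b := (abs_nonneg _).trans (hb 0)
  rcases le_or_gt x 0 with hx | hx
  · refine (intervalIntegrable_const (c := (0 : ℝ))).congr ?_
    intro t ht
    rw [uIoc_of_ge hx] at ht
    simp only [outerIntegrand]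
    rw [if_neg (not_lt.2 ht.2)]
  · have hmaj : IntervalIntegrable (fun t : ℝ => b * C * (growthWeight C α x) * t ^ (α + 1))
        volume 0 x :=
      (intervalIntegral.intervalIntegrable_rpow' (by linarith)).const_mul _
    refine hmaj.mono_fun' ?_ ?_
    · rw [uIoc_of_le hx.le]
      exact ((continuousOn_outerIntegrand hα hQc hQ hu).mono fun t ht => ht.1).aestronglyMeasurable
        measurableSet_Ioc
    · rw [uIoc_of_le hx.le]
      refine (ae_restrict_iff' measurableSet_Ioc).2 (Eventually.of_forall fun t ht => ?_)
      have ht0 : 0 < t := ht.1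
      simp only [outerIntegrand]
      rw [if_pos ht0, Real.norm_eq_abs, abs_div, abs_of_pos (pow_pos ht0 _),
        div_le_iff₀ (pow_pos ht0 _)]
      have h1 := abs_innerPrimitive_sub_le (ℓ := ℓ) (v := fun _ => 0) hα hQc hQ hu continuous_const
        (b := b) (fun x => by simpa using hb x) ht0
      rw [innerPrimitive_zero, sub_zero] at h1
      refine h1.trans ?_
      rw [Real.rpow_add ht0, Real.rpow_natCast]
      have hm : growthWeight C α t ≤ growthWeight C α x := growthWeight_mono hα hC ht.2
      have : 0 ≤ t ^ (α + 1) := Real.rpow_nonneg ht0.le _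
      calc b * C * (growthWeight C α t * (t ^ (2 * ℓ + 2) * t ^ (α + 1))) ≤
            b * C * (growthWeight C α x * (t ^ (2 * ℓ + 2) * t ^ (α + 1))) := by gcongr
        _ = _ := by ring

/-- The double primitive in Picard's operator. -/
noncomputable def outerPrimitive (ℓ : ℕ) (Q : ℝ → ℝ) (C α : ℝ) (u : ℝ → ℝ) (x : ℝ) : ℝ :=
  ∫ y in (0 : ℝ)..x, outerIntegrand ℓ Q C α u y

lemma outerPrimitive_of_nonpos (u : ℝ → ℝ) {x : ℝ} (hx : x ≤ 0) :
    outerPrimitive ℓ Q C α u x = 0 := by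
  rw [outerPrimitive]
  have : EqOn (outerIntegrand ℓ Q C α u) (fun _ => 0) (uIcc 0 x) := by
    intro t ht
    rw [uIcc_of_ge hx] at ht
    rw [outerIntegrand, if_neg (not_lt.2 ht.2)]
  rw [intervalIntegral.integral_congr this, intervalIntegral.integral_zero]

lemma continuous_outerPrimitive (hα : -2 < α) (hQc : ContinuousOn Q (Ioi 0))
    (hQ : ∀ x > 0, |Q x| ≤ C * x ^ α) {u : ℝ → ℝ} (hu : Continuous u) {b : ℝ}
    (hb : ∀ x, |u x| ≤ b) : Continuous (outerPrimitive ℓ Q C α u) :=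
  intervalIntegral.continuous_primitive (intervalIntegrable_outerIntegrand hα hQc hQ hu hb) 0

lemma tendsto_outerPrimitive (hα : -2 < α) (hQc : ContinuousOn Q (Ioi 0))
    (hQ : ∀ x > 0, |Q x| ≤ C * x ^ α) {u : ℝ → ℝ} (hu : Continuous u) {b : ℝ}
    (hb : ∀ x, |u x| ≤ b) : Tendsto (outerPrimitive ℓ Q C α u) (𝓝[>] 0) (𝓝 0) := by
  have h := (continuous_outerPrimitive (ℓ := ℓ) hα hQc hQ hu hb).tendsto 0
  rw [outerPrimitive_of_nonpos _ le_rfl] at h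
  exact h.mono_left nhdsWithin_le_nhds

lemma hasDerivAt_outerPrimitive (hα : -2 < α) (hQc : ContinuousOn Q (Ioi 0))
    (hQ : ∀ x > 0, |Q x| ≤ C * x ^ α) {u : ℝ → ℝ} (hu : Continuous u) {b : ℝ}
    (hb : ∀ x, |u x| ≤ b) {x : ℝ} (hx : 0 < x) :
    HasDerivAt (outerPrimitive ℓ Q C α u) (innerPrimitive ℓ Q C α u x / x ^ (2 * ℓ + 2)) x := by
  have hc := continuousOn_outerIntegrand (ℓ := ℓ) hα hQc hQ hu
  have h := intervalIntegral.integral_hasDerivAt_right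
    (intervalIntegrable_outerIntegrand (ℓ := ℓ) hα hQc hQ hu hb 0 x)
    (hc.stronglyMeasurableAtFilter isOpen_Ioi x hx) (hc.continuousAt (Ioi_mem_nhds hx))
  rw [outerIntegrand, if_pos hx] at h
  exact h

lemma abs_outerPrimitive_sub_le (hα : -2 < α) (hQc : ContinuousOn Q (Ioi 0))
    (hQ : ∀ x > 0, |Q x| ≤ C * x ^ α) (u v : BoundedContinuousFunction ℝ ℝ) (x : ℝ) :
    |outerPrimitive ℓ Q C α u x - outerPrimitive ℓ Q C α v x| ≤
      dist u v / 2 * growthWeight C α x := by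
  rcases le_or_gt x 0 with hx | hx
  · rw [outerPrimitive_of_nonpos _ hx, outerPrimitive_of_nonpos _ hx, sub_self, abs_zero]
    have := growthWeight_pos (C := C) (α := α) x
    positivity
  · have hd : ∀ y, |u y - v y| ≤ dist u v := fun y =>
      BoundedContinuousFunction.dist_coe_le_dist (f := u) (g := v) y
    have hu : ∀ y, |u y| ≤ ‖u‖ := fun y => u.norm_coe_le_norm y
    have hv : ∀ y, |v y| ≤ ‖v‖ := fun y => v.norm_coe_le_norm y
    rw [abs_sub_comm]
    refine (abs_le_half_growthWeight (ℓ := ℓ) (C := C) (X := x) (b := dist u v)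
      (D := fun y => outerPrimitive ℓ Q C α v y - outerPrimitive ℓ Q C α u y)
      (E := fun y => innerPrimitive ℓ Q C α u y - innerPrimitive ℓ Q C α v y) hα ?_ ?_ ?_
      ⟨hx, le_rfl⟩).trans ?_
    · intro y hy
      refine ((hasDerivAt_outerPrimitive hα hQc hQ v.continuous hv hy.1).sub
        (hasDerivAt_outerPrimitive hα hQc hQ u.continuous hu hy.1)).congr_deriv ?_
      ring
    · simpa using (tendsto_outerPrimitive hα hQc hQ v.continuous hv).sub
        (tendsto_outerPrimitive hα hQc hQ u.continuous hu)
    · exact fun y hy => abs_innerPrimitive_sub_le hα hQc hQ u.continuous v.continuous hd hy.1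
    · exact mul_le_mul_of_nonneg_left (by linarith) (by positivity)

lemma outerPrimitive_zero (x : ℝ) :
    outerPrimitive ℓ Q C α (0 : BoundedContinuousFunction ℝ ℝ) x = 0 := by
  have : outerIntegrand ℓ Q C α (0 : BoundedContinuousFunction ℝ ℝ) = fun _ => 0 := by
    funext t
    have h := innerPrimitive_zero (ℓ := ℓ) (Q := Q) (α := α) (C := C) t
    rw [outerIntegrand, show ⇑(0 : BoundedContinuousFunction ℝ ℝ) = fun _ => 0 from rfl, h]
    simp
  rw [outerPrimitive, this, intervalIntegral.integral_zero]

/-- Existence of the regular system: in the norm weighted by the growth weight, Picard's operator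
is a contraction on the whole half-line. -/
theorem exists_isRegularSystem (ℓ : ℕ) (hα : -2 < α) (hQc : ContinuousOn Q (Ioi 0))
    (hQ : ∀ x > 0, |Q x| ≤ C * x ^ α) : ∃ g h, IsRegularSystem ℓ Q g h := by
  have hC : 0 ≤ C := by simpa using (abs_nonneg _).trans (hQ 1 one_pos)
  have hu : ∀ (u : BoundedContinuousFunction ℝ ℝ) y, |u y| ≤ ‖u‖ := fun u y => u.norm_coe_le_norm y
  let T : BoundedContinuousFunction ℝ ℝ → BoundedContinuousFunction ℝ ℝ := fun u =>
    BoundedContinuousFunction.ofNormedAddCommGroup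
      (fun x => (1 - outerPrimitive ℓ Q C α u x) / growthWeight C α x)
      ((continuous_const.sub (continuous_outerPrimitive hα hQc hQ u.continuous (hu u))).div
        (continuous_growthWeight hα) fun x => (growthWeight_pos x).ne')
      (1 + dist u 0 / 2) (by
        intro x
        have hW := growthWeight_pos (C := C) (α := α) x
        have hW1 := one_le_growthWeight hα hC x
        have h1 := abs_outerPrimitive_sub_le (ℓ := ℓ) hα hQc hQ u 0 x
        rw [outerPrimitive_zero, sub_zero] at h1
        rw [Real.norm_eq_abs, abs_div, abs_of_pos hW, div_le_iff₀ hW]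
        refine (abs_sub _ _).trans ?_
        rw [abs_one]
        linarith)
  have hT : ∀ u x, T u x = (1 - outerPrimitive ℓ Q C α u x) / growthWeight C α x := fun _ _ => rfl
  have hcontr : ContractingWith (1 / 2) T := by
    refine ⟨by norm_num, LipschitzWith.of_dist_le_mul fun u v => ?_⟩
    refine (BoundedContinuousFunction.dist_le (by positivity)).2 fun x => ?_
    have hW := growthWeight_pos (C := C) (α := α) x
    rw [hT, hT, Real.dist_eq, ← sub_div, abs_div, abs_of_pos hW, div_le_iff₀ hW,
      show (1 - outerPrimitive ℓ Q C α u x) - (1 - outerPrimitive ℓ Q C α v x) =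
        -(outerPrimitive ℓ Q C α u x - outerPrimitive ℓ Q C α v x) by ring, abs_neg]
    refine (abs_outerPrimitive_sub_le hα hQc hQ u v x).trans (le_of_eq ?_)
    push_cast
    ring
  set u := ContractingWith.fixedPoint T hcontr with hu'
  have hfix : T u = u := hcontr.fixedPoint_isFixedPt
  have hfx : ∀ x, growthWeight C α x * u x = 1 - outerPrimitive ℓ Q C α u x := by
    intro x
    have h1 : T u x = u x := by rw [hfix]
    rw [hT, div_eq_iff (growthWeight_pos x).ne'] at h1
    linarith
  refine ⟨fun x => 1 - outerPrimitive ℓ Q C α u x, innerPrimitive ℓ Q C α u, ?_, ?_, ?_, ?_⟩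
  · intro x hx
    exact (hasDerivAt_outerPrimitive hα hQc hQ u.continuous (hu u) hx).const_sub 1
  · intro x hx
    refine (hasDerivAt_innerPrimitive hα hQc hQ u.continuous x).congr_deriv ?_
    rw [innerIntegrand, if_pos hx, hfx]
  · simpa using (tendsto_outerPrimitive (ℓ := ℓ) hα hQc hQ u.continuous (hu u)).const_sub 1
  · exact tendsto_innerPrimitive hα hQc hQ u.continuous

end Existence

/-- Existence and uniqueness of the regular solution. -/
theorem IsAdmissiblePotential.exists_isRegularSolution {Φ : ℝ → ℝ} {α β : ℝ}
    (hΦ : IsAdmissiblePotential Φ α β) (ℓ : ℕ) (lam : ℝ) :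
    ∃ w : ℝ → ℝ, IsRegularSolution Φ ℓ lam w ∧
      ∀ v : ℝ → ℝ, IsRegularSolution Φ ℓ lam v → EqOn v w (Ioi 0) := by
  obtain ⟨C, hC, hb⟩ := hΦ.exists_le_rpow
  have hα := hΦ.neg_two_lt
  have hQ : ∀ x > 0, |lam ^ 2 * Φ x| ≤ (lam ^ 2 * C) * x ^ α := by
    intro x hx
    rw [abs_of_nonneg (mul_nonneg (sq_nonneg _) (hΦ.pos x hx).le), mul_assoc]
    exact mul_le_mul_of_nonneg_left (hb x hx) (sq_nonneg _)
  have hC' : 0 ≤ lam ^ 2 * C := by positivity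
  obtain ⟨g, h, s⟩ := exists_isRegularSystem ℓ hα (continuousOn_const.mul hΦ.continuousOn) hQ
  refine ⟨_, s.isRegularSolution hα hC' hQ, fun v hv x hx => ?_⟩
  have h1 := IsRegularSystem.eqOn hα hC' hv.isRegularSystem s hQ hx
  have hx' : x ≠ 0 := ne_of_gt hx
  simp only at h1
  rw [div_eq_iff (pow_ne_zero _ hx')] at h1
  rw [h1, mul_comm]

/-! ### The phase integral -/

section Phase

open MeasureTheory

variable {Φ : ℝ → ℝ} {α β C lam : ℝ} {ℓ : ℕ}

lemma langerIntegrand_nonneg (y : ℝ) : 0 ≤ langerIntegrand Φ ℓ lam y := Real.sqrt_nonneg _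

lemma langerIntegrand_le_sqrt {y : ℝ} (hy : 0 ≤ Φ y) : langerIntegrand Φ ℓ lam y ≤ √(Φ y) := by
  refine Real.sqrt_le_sqrt (max_le ?_ hy)
  have : 0 ≤ ((ℓ : ℝ) + 1 / 2) ^ 2 / (lam ^ 2 * y ^ 2) := by positivity
  linarith

lemma sqrt_sub_langerIntegrand_le {y : ℝ} (hy : 0 < Φ y) :
    √(Φ y) - langerIntegrand Φ ℓ lam y ≤
      ((ℓ : ℝ) + 1 / 2) ^ 2 / (lam ^ 2 * y ^ 2) * (√(Φ y))⁻¹ := by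
  have hs := Real.sqrt_pos.2 hy
  have h2 := Real.sq_sqrt hy.le
  have h0 := langerIntegrand_nonneg (Φ := Φ) (ℓ := ℓ) (lam := lam) y
  have h1 : langerIntegrand Φ ℓ lam y ^ 2 = max (Φ y - ((ℓ : ℝ) + 1 / 2) ^ 2 / (lam ^ 2 * y ^ 2)) 0 :=
    Real.sq_sqrt (le_max_right _ _)
  have h3 := le_max_left (Φ y - ((ℓ : ℝ) + 1 / 2) ^ 2 / (lam ^ 2 * y ^ 2)) 0
  have h4 := langerIntegrand_le_sqrt (ℓ := ℓ) (lam := lam) hy.le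
  rw [← div_eq_mul_inv, le_div_iff₀ hs]
  nlinarith

lemma continuousOn_langerIntegrand (hlam : 0 < lam) (hΦ : ContinuousOn Φ (Ioi 0)) :
    ContinuousOn (langerIntegrand Φ ℓ lam) (Ioi 0) := by
  have h1 : ContinuousOn (fun y : ℝ => ((ℓ : ℝ) + 1 / 2) ^ 2 / (lam ^ 2 * y ^ 2)) (Ioi 0) := by
    refine continuousOn_const.div (by fun_prop) fun y hy => ?_
    have hy' : (0 : ℝ) < y := hy
    positivity
  exact ((hΦ.sub h1).sup continuousOn_const).sqrt

lemma intervalIntegrable_of_le_rpow {F : ℝ → ℝ} (hα : -2 < α) (hF : ContinuousOn F (Ioi 0))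
    (h : ∀ y > 0, |F y| ≤ C * y ^ (α / 2)) {x : ℝ} (hx : 0 ≤ x) :
    IntervalIntegrable F volume 0 x := by
  have hmaj : IntervalIntegrable (fun t : ℝ => C * t ^ (α / 2)) volume 0 x :=
    (intervalIntegral.intervalIntegrable_rpow' (by linarith)).const_mul _
  refine hmaj.mono_fun' ?_ ?_
  · rw [uIoc_of_le hx]
    exact (hF.mono fun t ht => ht.1).aestronglyMeasurable measurableSet_Ioc
  · rw [uIoc_of_le hx]
    exact (ae_restrict_iff' measurableSet_Ioc).2 (Eventually.of_forall fun t ht => h t ht.1)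

lemma sqrt_le_rpow {y : ℝ} (hy : 0 < y) (hC : 0 ≤ C) (h : Φ y ≤ C * y ^ α) :
    √(Φ y) ≤ √C * y ^ (α / 2) := by
  refine (Real.sqrt_le_sqrt h).trans (le_of_eq ?_)
  rw [Real.sqrt_mul hC, Real.sqrt_eq_rpow (y ^ α), ← Real.rpow_mul hy.le]
  ring_nf

lemma intervalIntegrable_langerIntegrand (hα : -2 < α) (hlam : 0 < lam) (hC : 0 ≤ C)
    (hΦ : ContinuousOn Φ (Ioi 0)) (h0 : ∀ y > 0, 0 ≤ Φ y) (h : ∀ y > 0, Φ y ≤ C * y ^ α) {x : ℝ}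
    (hx : 0 ≤ x) : IntervalIntegrable (langerIntegrand Φ ℓ lam) volume 0 x := by
  refine intervalIntegrable_of_le_rpow (C := √C) hα (continuousOn_langerIntegrand hlam hΦ)
    (fun y hy => ?_) hx
  rw [abs_of_nonneg (langerIntegrand_nonneg y)]
  exact (langerIntegrand_le_sqrt (h0 y hy)).trans (sqrt_le_rpow hy hC (h y hy))

lemma intervalIntegrable_sqrt (hα : -2 < α) (hC : 0 ≤ C) (hΦ : ContinuousOn Φ (Ioi 0))
    (h : ∀ y > 0, Φ y ≤ C * y ^ α) {x : ℝ} (hx : 0 ≤ x) :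
    IntervalIntegrable (fun y => √(Φ y)) volume 0 x := by
  refine intervalIntegrable_of_le_rpow (C := √C) hα hΦ.sqrt (fun y hy => ?_) hx
  rw [abs_of_nonneg (Real.sqrt_nonneg _)]
  exact sqrt_le_rpow hy hC (h y hy)

/-- The phase integral `∫ √(1 - μ² / z²) dz` from the turning point `μ` to `z`; it vanishes for
`0 ≤ z ≤ μ` because there the real square root is `0`. -/
noncomputable def besselPhase (μ z : ℝ) : ℝ :=
  √(z ^ 2 - μ ^ 2) - μ * Real.arctan (√(z ^ 2 - μ ^ 2) / μ)

lemma continuous_besselPhase (μ : ℝ) : Continuous (besselPhase μ) := by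
  unfold besselPhase
  have h1 : Continuous fun z : ℝ => √(z ^ 2 - μ ^ 2) := by fun_prop
  exact h1.sub (continuous_const.mul (Real.continuous_arctan.comp (h1.div_const _)))

lemma besselPhase_of_le {μ z : ℝ} (hz : 0 ≤ z) (h : z ≤ μ) : besselPhase μ z = 0 := by
  rw [besselPhase, Real.sqrt_eq_zero_of_nonpos (by nlinarith)]
  simp

lemma hasDerivAt_besselPhase {μ z : ℝ} (hμ : 0 < μ) (hz : 0 < z) (hne : z ≠ μ) :
    HasDerivAt (besselPhase μ) (√(max (1 - μ ^ 2 / z ^ 2) 0)) z := by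
  rcases lt_or_gt_of_ne hne with h | h
  · have h1 : max (1 - μ ^ 2 / z ^ 2) 0 = 0 := by
      refine max_eq_right ?_
      rw [sub_nonpos, one_le_div (by positivity)]
      nlinarith
    rw [h1, Real.sqrt_zero]
    refine (hasDerivAt_const z (0 : ℝ)).congr_of_eventuallyEq ?_
    filter_upwards [Ioo_mem_nhds hz h] with y hy
    exact besselPhase_of_le hy.1.le hy.2.le
  · have hp : 0 < z ^ 2 - μ ^ 2 := by nlinarith
    set R := √(z ^ 2 - μ ^ 2) with hR
    have hR0 : 0 < R := Real.sqrt_pos.2 hp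
    have hR2 : R ^ 2 = z ^ 2 - μ ^ 2 := Real.sq_sqrt hp.le
    have h1 : √(max (1 - μ ^ 2 / z ^ 2) 0) = R / z := by
      rw [max_eq_left, show 1 - μ ^ 2 / z ^ 2 = (z ^ 2 - μ ^ 2) / z ^ 2 by field_simp,
        Real.sqrt_div hp.le, Real.sqrt_sq hz.le]
      rw [sub_nonneg, div_le_one (by positivity)]
      nlinarith
    have hd : HasDerivAt (fun z : ℝ => √(z ^ 2 - μ ^ 2)) (z / R) z := by
      have := ((hasDerivAt_pow 2 z).sub_const (μ ^ 2)).sqrt hp.ne'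
      refine this.congr_deriv ?_
      rw [← hR]
      field_simp
      norm_num
    have h2 := hd.sub (((hd.div_const μ).arctan).const_mul μ)
    rw [h1]
    refine h2.congr_deriv ?_
    rw [← hR]
    have h3 : 1 + (R / μ) ^ 2 = z ^ 2 / μ ^ 2 := by
      rw [div_pow, hR2]; field_simp; ring
    rw [h3]
    field_simp
    linarith

lemma tendsto_besselPhase_sub {μ : ℝ} (hμ : 0 < μ) :
    Tendsto (fun z => besselPhase μ z - z) atTop (𝓝 (-(μ * Real.pi / 2))) := by
  have hle : ∀ z ≥ μ, z - μ ≤ √(z ^ 2 - μ ^ 2) := fun z hz => by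
    refine Real.le_sqrt_of_sq_le ?_
    nlinarith
  have h1 : Tendsto (fun z : ℝ => √(z ^ 2 - μ ^ 2)) atTop atTop := by
    refine tendsto_atTop_mono' _ ?_ (tendsto_atTop_add_const_right _ (-μ) tendsto_id)
    filter_upwards [eventually_ge_atTop μ] with z hz
    exact hle z hz
  have h2 : Tendsto (fun z : ℝ => √(z ^ 2 - μ ^ 2) - z) atTop (𝓝 0) := by
    have h3 : Tendsto (fun z : ℝ => μ ^ 2 * z⁻¹) atTop (𝓝 0) := by
      simpa using (tendsto_inv_atTop_zero (𝕜 := ℝ)).const_mul (μ ^ 2)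
    refine squeeze_zero_norm' ?_ h3
    filter_upwards [eventually_ge_atTop μ] with z hz
    have hz0 : 0 < z := hμ.trans_le hz
    have hsq : √(z ^ 2 - μ ^ 2) ^ 2 = z ^ 2 - μ ^ 2 := Real.sq_sqrt (by nlinarith)
    have h0 := Real.sqrt_nonneg (z ^ 2 - μ ^ 2)
    rw [Real.norm_eq_abs, abs_sub_comm, abs_of_nonneg (by nlinarith), ← div_eq_mul_inv,
      le_div_iff₀ hz0]
    nlinarith
  have h4 : Tendsto (fun z : ℝ => μ * Real.arctan (√(z ^ 2 - μ ^ 2) / μ)) atTop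
      (𝓝 (μ * (Real.pi / 2))) := by
    refine Tendsto.const_mul _ ?_
    have := Real.tendsto_arctan_atTop.mono_right (nhdsWithin_le_nhds)
    exact this.comp (h1.atTop_div_const hμ)
  have h5 := h2.sub h4
  rw [zero_sub, ← mul_div_assoc] at h5
  refine h5.congr fun z => ?_
  rw [besselPhase]; ring

/-- For the pure power `C₀ y^α` the phase integral is explicit. -/
lemma integral_langerIntegrand_rpow {C₀ x : ℝ} (hα : -2 < α) (hC₀ : 0 < C₀) (hlam : 0 < lam)
    (hx : 0 < x) :
    lam * ∫ y in (0 : ℝ)..x, langerIntegrand (fun y => C₀ * y ^ α) ℓ lam y =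
      besselPhase (((ℓ : ℝ) + 1 / 2) / (1 + α / 2)) (√C₀ / (1 + α / 2) * (lam * x ^ (1 + α / 2))) := by
  set κ := 1 + α / 2 with hκ'
  have hκ : 0 < κ := by rw [hκ']; linarith
  set ν : ℝ := (ℓ : ℝ) + 1 / 2 with hν'
  have hν : 0 < ν := by positivity
  set μ := ν / κ with hμ'
  have hμ : 0 < μ := by positivity
  set c := √C₀ / κ with hc'
  have hsC := Real.sqrt_pos.2 hC₀
  have hsC2 := Real.sq_sqrt hC₀.le
  have hc : 0 < c := by positivity
  have hcont : ContinuousOn (fun y : ℝ => C₀ * y ^ α) (Ioi 0) := fun y hy =>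
    (continuousAt_const.mul (Real.continuousAt_rpow_const _ _
      (Or.inl (ne_of_gt hy)))).continuousWithinAt
  have hint := (intervalIntegrable_langerIntegrand (ℓ := ℓ) hα hlam hC₀.le hcont
    (fun y hy => mul_nonneg hC₀.le (Real.rpow_nonneg (le_of_lt hy) _)) (fun _ _ => le_rfl)
    hx.le).const_mul lam
  have h := integral_eq_of_hasDerivAt_off_countable_of_le
    (fun y : ℝ => besselPhase μ (c * (lam * y ^ κ)))
    (fun y => lam * langerIntegrand (fun y => C₀ * y ^ α) ℓ lam y) hx.le
    (s := {y | 0 < y ∧ c * (lam * y ^ κ) = μ}) ?_ ?_ ?_ hint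
  · rw [intervalIntegral.integral_const_mul] at h
    rw [h, Real.zero_rpow hκ.ne', mul_zero, mul_zero, besselPhase_of_le le_rfl hμ.le, sub_zero]
  · -- the turning point is unique
    refine Set.Subsingleton.countable fun y hy z hz => ?_
    have h1 : y ^ κ = z ^ κ := by
      have := hy.2.trans hz.2.symm
      exact mul_left_cancel₀ hlam.ne' (mul_left_cancel₀ hc.ne' this)
    exact (Real.rpow_left_inj hy.1.le hz.1.le hκ.ne').1 h1
  · have : Continuous fun y : ℝ => y ^ κ := continuous_id.rpow_const fun _ => Or.inr hκ.le
    exact ((continuous_besselPhase μ).comp (by fun_prop)).continuousOn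
  · rintro y ⟨hy, hys⟩
    have hy0 : 0 < y := hy.1
    have hz : 0 < c * (lam * y ^ κ) := by positivity
    have hne : c * (lam * y ^ κ) ≠ μ := fun h => hys ⟨hy0, h⟩
    have hd := (hasDerivAt_besselPhase hμ hz hne).comp y
      (((Real.hasDerivAt_rpow_const (x := y) (p := κ) (Or.inl hy0.ne')).const_mul lam).const_mul c)
    refine hd.congr_deriv ?_
    have hα' : y ^ α = (y ^ (κ - 1)) ^ 2 := by
      rw [← Real.rpow_natCast, ← Real.rpow_mul hy0.le]; congr 1; rw [hκ']; push_cast; ring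
    have hyκ : y ^ κ = y ^ (κ - 1) * y := by
      rw [← Real.rpow_add_one hy0.ne']; congr 1; ring
    have ht : 0 < y ^ (κ - 1) := Real.rpow_pos_of_pos hy0 _
    have e : C₀ * y ^ α - ν ^ 2 / (lam ^ 2 * y ^ 2) =
        (√C₀ * y ^ (κ - 1)) ^ 2 * (1 - μ ^ 2 / (c * (lam * y ^ κ)) ^ 2) := by
      rw [hα', hyκ, hμ', hc', mul_pow, hsC2]
      have : √C₀ ≠ 0 := hsC.ne'
      field_simp
      rw [hsC2]
      ring
    have e2 : max (C₀ * y ^ α - ν ^ 2 / (lam ^ 2 * y ^ 2)) 0 =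
        (√C₀ * y ^ (κ - 1)) ^ 2 * max (1 - μ ^ 2 / (c * (lam * y ^ κ)) ^ 2) 0 := by
      rw [e, mul_max_of_nonneg _ _ (sq_nonneg _), mul_zero]
    rw [langerIntegrand, ← hν', e2, Real.sqrt_mul (sq_nonneg _), Real.sqrt_sq (by positivity), hc']
    field_simp

lemma abs_sqrt_max_sub_le (a b : ℝ) : |√(max a 0) - √(max b 0)| ≤ √|a - b| := by
  wlog h : b ≤ a generalizing a b
  · rw [abs_sub_comm, abs_sub_comm a]
    exact this b a (le_of_not_ge h)
  have hmono : √(max b 0) ≤ √(max a 0) := Real.sqrt_le_sqrt (max_le_max_right _ h)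
  rw [abs_of_nonneg (sub_nonneg.2 hmono), sub_le_iff_le_add]
  have h1 : max a 0 ≤ |a - b| + max b 0 := by
    rw [abs_of_nonneg (sub_nonneg.2 h)]
    refine max_le ?_ (add_nonneg (sub_nonneg.2 h) (le_max_right _ _))
    linarith [le_max_left b 0]
  refine (Real.sqrt_le_sqrt h1).trans ?_
  refine Real.sqrt_le_iff.2 ⟨by positivity, ?_⟩
  have h2 := Real.sq_sqrt (abs_nonneg (a - b))
  have h3 := Real.sq_sqrt (le_max_right b 0)
  have h4 := mul_nonneg (Real.sqrt_nonneg |a - b|) (Real.sqrt_nonneg (max b 0))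
  nlinarith

/-- The matching point: the `x` with `lam * x ^ (1 + α/2) = S`. -/
noncomputable def matchingPoint (α S lam : ℝ) : ℝ := (S / lam) ^ (1 + α / 2)⁻¹

lemma matchingPoint_pos {S : ℝ} (hS : 0 < S) (hlam : 0 < lam) : 0 < matchingPoint α S lam :=
  Real.rpow_pos_of_pos (div_pos hS hlam) _

lemma matchingPoint_rpow {S : ℝ} (hα : -2 < α) (hS : 0 < S) (hlam : 0 < lam) :
    lam * matchingPoint α S lam ^ (1 + α / 2) = S := by
  rw [matchingPoint, Real.rpow_inv_rpow (div_pos hS hlam).le (by linarith)]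
  field_simp

lemma tendsto_matchingPoint {S : ℝ} (hα : -2 < α) (hS : 0 < S) :
    Tendsto (matchingPoint α S) atTop (𝓝[>] 0) := by
  refine tendsto_nhdsWithin_iff.2 ⟨?_, ?_⟩
  · have hp : 0 < (1 + α / 2)⁻¹ := inv_pos.2 (by linarith)
    have h1 := (Real.continuousAt_rpow_const 0 _ (Or.inr hp.le)).tendsto
    rw [Real.zero_rpow hp.ne'] at h1
    exact h1.comp (tendsto_const_nhds.div_atTop tendsto_id)
  · filter_upwards [eventually_gt_atTop 0] with lam hlam
    exact matchingPoint_pos hS hlam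

lemma eventually_abs_sub_le {C₀ S ε : ℝ} (hα : -2 < α) (hS : 0 < S) (hε : 0 < ε)
    (hC : Tendsto (fun r => Φ r / r ^ α) (𝓝[>] 0) (𝓝 C₀)) :
    ∀ᶠ lam in atTop, ∀ y ∈ Ioc 0 (matchingPoint α S lam), |Φ y - C₀ * y ^ α| ≤ ε * y ^ α := by
  have h1 : ∀ᶠ r in 𝓝[>] (0 : ℝ), |Φ r - C₀ * r ^ α| ≤ ε * r ^ α := by
    have h2 := hC.eventually (Metric.closedBall_mem_nhds C₀ hε)
    filter_upwards [h2, self_mem_nhdsWithin] with r hr hr0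
    have hp : 0 < r ^ α := Real.rpow_pos_of_pos hr0 _
    rw [Real.dist_eq] at hr
    rw [show Φ r - C₀ * r ^ α = (Φ r / r ^ α - C₀) * r ^ α by field_simp, abs_mul, abs_of_pos hp]
    exact mul_le_mul_of_nonneg_right hr hp.le
  obtain ⟨d, hd, hd'⟩ := mem_nhdsGT_iff_exists_Ioo_subset.1 h1
  have hd0 : (0 : ℝ) < d := hd
  have h3 := (tendsto_matchingPoint hα hS).eventually (Ioo_mem_nhdsGT hd0)
  filter_upwards [h3] with lam hlam y hy
  exact hd' ⟨hy.1, hy.2.trans_lt hlam.2⟩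

/-- The phase accumulated up to the matching point depends in the limit only on the leading
coefficient `C₀`. -/
lemma tendsto_phase_matchingPoint {C₀ S : ℝ} (hα : -2 < α) (hS : 0 < S) (hC₀ : 0 < C₀) (hC' : 0 ≤ C)
    (hΦ : ContinuousOn Φ (Ioi 0)) (h0 : ∀ y > 0, 0 ≤ Φ y) (h : ∀ y > 0, Φ y ≤ C * y ^ α)
    (hC : Tendsto (fun r => Φ r / r ^ α) (𝓝[>] 0) (𝓝 C₀)) :
    Tendsto (fun lam => lam * ∫ y in (0 : ℝ)..(matchingPoint α S lam), langerIntegrand Φ ℓ lam y)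
      atTop (𝓝 (besselPhase (((ℓ : ℝ) + 1 / 2) / (1 + α / 2)) (√C₀ / (1 + α / 2) * S))) := by
  have hκ : 0 < 1 + α / 2 := by linarith
  rw [Metric.tendsto_nhds]
  intro δ hδ
  set ε := (δ / 2 * (1 + α / 2) / S) ^ 2 with hε'
  have hε : 0 < ε := by positivity
  have hsε : √ε * (S / (1 + α / 2)) = δ / 2 := by
    rw [hε', Real.sqrt_sq (by positivity), div_mul_div_comm, mul_assoc, mul_comm _ S,
      mul_div_assoc, div_self (by positivity), mul_one]
  filter_upwards [eventually_abs_sub_le hα hS hε hC, eventually_gt_atTop 0] with lam hl hlam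
  set x := matchingPoint α S lam with hx'
  have hx : 0 < x := matchingPoint_pos hS hlam
  have hxS : lam * x ^ (1 + α / 2) = S := matchingPoint_rpow hα hS hlam
  have hcont : ContinuousOn (fun y : ℝ => C₀ * y ^ α) (Ioi 0) := fun y hy =>
    (continuousAt_const.mul (Real.continuousAt_rpow_const _ _
      (Or.inl (ne_of_gt hy)))).continuousWithinAt
  have i1 := intervalIntegrable_langerIntegrand (ℓ := ℓ) hα hlam hC₀.le hcont
    (fun y hy => mul_nonneg hC₀.le (Real.rpow_nonneg (le_of_lt hy) _)) (fun _ _ => le_rfl) hx.le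
  have i2 := intervalIntegrable_langerIntegrand (ℓ := ℓ) hα hlam hC' hΦ h0 h hx.le
  have h1 := integral_langerIntegrand_rpow (ℓ := ℓ) hα hC₀ hlam hx
  rw [hxS] at h1
  rw [← h1, Real.dist_eq, ← mul_sub, ← intervalIntegral.integral_sub i2 i1, abs_mul,
    abs_of_pos hlam]
  have h2 : |∫ y in (0 : ℝ)..x, langerIntegrand Φ ℓ lam y -
      langerIntegrand (fun y => C₀ * y ^ α) ℓ lam y| ≤ ∫ y in (0 : ℝ)..x, √ε * y ^ (α / 2) := by
    rw [← Real.norm_eq_abs]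
    refine intervalIntegral.norm_integral_le_of_norm_le hx.le
      (Eventually.of_forall fun y hy => ?_)
      ((intervalIntegral.intervalIntegrable_rpow' (by linarith)).const_mul _)
    rw [Real.norm_eq_abs]
    refine (abs_sqrt_max_sub_le _ _).trans ?_
    rw [sub_sub_sub_cancel_right]
    exact sqrt_le_rpow (Φ := fun y => |Φ y - C₀ * y ^ α|) hy.1 hε.le (hl y hy)
  rw [intervalIntegral.integral_const_mul, integral_rpow (Or.inl (by linarith)),
    show α / 2 + 1 = 1 + α / 2 by ring, Real.zero_rpow hκ.ne', sub_zero] at h2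
  calc lam * _ ≤ lam * (√ε * (x ^ (1 + α / 2) / (1 + α / 2))) :=
        mul_le_mul_of_nonneg_left h2 hlam.le
    _ = √ε * (lam * x ^ (1 + α / 2) / (1 + α / 2)) := by ring
    _ = δ / 2 := by rw [hxS, hsε]
    _ < δ := by linarith

/-- A primitive of `x ^ (-α/2-2) + x ^ (-β/2-2)`, the majorant of `1 / (x² √Φ)` that controls all
errors beyond the matching point. -/
noncomputable def errorPrimitive (α β x : ℝ) : ℝ :=
  -(x ^ (-(1 + α / 2)) / (1 + α / 2)) + x ^ (-(1 + β / 2)) / (-(1 + β / 2))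

lemma hasDerivAt_errorPrimitive (hα : -2 < α) (hβ : β < -2) {x : ℝ} (hx : 0 < x) :
    HasDerivAt (errorPrimitive α β) (x ^ (-α / 2 - 2) + x ^ (-β / 2 - 2)) x := by
  have h1 := (((Real.hasDerivAt_rpow_const (x := x) (p := -(1 + α / 2)) (Or.inl hx.ne')).div_const
    (1 + α / 2)).neg).add ((Real.hasDerivAt_rpow_const (x := x) (p := -(1 + β / 2))
      (Or.inl hx.ne')).div_const (-(1 + β / 2)))
  refine h1.congr_deriv ?_
  have ha : 1 + α / 2 ≠ 0 := by linarith
  have hb : -(1 + β / 2) ≠ 0 := by linarith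
  rw [show -(1 + α / 2) - 1 = -α / 2 - 2 by ring, show -(1 + β / 2) - 1 = -β / 2 - 2 by ring,
    mul_div_cancel_left₀ _ hb, neg_mul, neg_div, neg_neg, mul_div_cancel_left₀ _ ha]

lemma errorPrimitive_sub_le (hα : -2 < α) (hβ : β < -2) {a x : ℝ} (ha : 0 < a) (hx : 0 < x) :
    errorPrimitive α β x - errorPrimitive α β a ≤
      a ^ (-(1 + α / 2)) / (1 + α / 2) + x ^ (-(1 + β / 2)) / (-(1 + β / 2)) := by
  have h1 : 0 < 1 + α / 2 := by linarith
  have h2 : 0 < -(1 + β / 2) := by linarith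
  have h3 : 0 ≤ x ^ (-(1 + α / 2)) / (1 + α / 2) := by positivity
  have h4 : 0 ≤ a ^ (-(1 + β / 2)) / (-(1 + β / 2)) := by positivity
  unfold errorPrimitive
  linarith

lemma IsAdmissiblePotential.exists_inv_sq_mul_inv_sqrt_le (hΦ : IsAdmissiblePotential Φ α β) :
    ∃ C > 0, ∀ x > 0, (x ^ 2)⁻¹ * (√(Φ x))⁻¹ ≤ C * (x ^ (-α / 2 - 2) + x ^ (-β / 2 - 2)) := by
  obtain ⟨C, hC, h⟩ := hΦ.exists_inv_sqrt_le
  refine ⟨C, hC, fun x hx => ?_⟩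
  have h1 : ∀ p : ℝ, x ^ (p - 2) = (x ^ 2)⁻¹ * x ^ p := fun p => by
    rw [Real.rpow_sub hx, Real.rpow_two]; ring
  rw [h1, h1]
  have := mul_le_mul_of_nonneg_left (h x hx) (inv_nonneg.2 (sq_nonneg x))
  linarith

/-- Beyond the matching point the phase grows like the unmodified WKB phase. -/
lemma IsAdmissiblePotential.exists_phase_sub_le (hΦ : IsAdmissiblePotential Φ α β) (ℓ : ℕ) :
    ∃ K > 0, ∀ lam > 0, ∀ a > 0, ∀ x ≥ a,
      |(langerPhase Φ ℓ lam x - lam * ∫ y in (0 : ℝ)..x, √(Φ y)) -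
        (langerPhase Φ ℓ lam a - lam * ∫ y in (0 : ℝ)..a, √(Φ y))| ≤
      K / lam * (errorPrimitive α β x - errorPrimitive α β a) := by
  obtain ⟨C, hC, h⟩ := hΦ.exists_inv_sq_mul_inv_sqrt_le
  obtain ⟨C', hC', hb⟩ := hΦ.exists_le_rpow
  refine ⟨((ℓ : ℝ) + 1 / 2) ^ 2 * C, by positivity, fun lam hlam a ha x hx => ?_⟩
  have hα := hΦ.neg_two_lt
  have hβ := hΦ.lt_neg_two
  have hcl := continuousOn_langerIntegrand (ℓ := ℓ) hlam hΦ.continuousOn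
  have hcs : ContinuousOn (fun y => √(Φ y)) (Ioi 0) := hΦ.continuousOn.sqrt
  have hd : ∀ y ∈ Icc a x, HasDerivAt
      (fun x => langerPhase Φ ℓ lam x - lam * ∫ y in (0 : ℝ)..x, √(Φ y))
      (lam * langerIntegrand Φ ℓ lam y - lam * √(Φ y)) y := by
    intro y hy
    have hy0 : 0 < y := ha.trans_le hy.1
    have h1 := intervalIntegral.integral_hasDerivAt_right
      (intervalIntegrable_langerIntegrand (ℓ := ℓ) hα hlam hC'.le hΦ.continuousOn
        (fun y hy => (hΦ.pos y hy).le) hb hy0.le)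
      (hcl.stronglyMeasurableAtFilter isOpen_Ioi y hy0) (hcl.continuousAt (Ioi_mem_nhds hy0))
    have h2 := intervalIntegral.integral_hasDerivAt_right
      (intervalIntegrable_sqrt hα hC'.le hΦ.continuousOn hb hy0.le)
      (hcs.stronglyMeasurableAtFilter isOpen_Ioi y hy0) (hcs.continuousAt (Ioi_mem_nhds hy0))
    exact ((h1.const_mul lam).sub_const _).sub (h2.const_mul lam)
  have key := norm_sub_le_of_norm_deriv_le hd
    (B := fun y => ((ℓ : ℝ) + 1 / 2) ^ 2 * C / lam * errorPrimitive α β y)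
    (fun y hy => (hasDerivAt_errorPrimitive hα hβ (ha.trans_le hy.1)).const_mul _) ?_
    (⟨hx, le_rfl⟩ : x ∈ Icc a x)
  · rw [Real.norm_eq_abs] at key
    linarith
  · intro y hy
    have hy0 : 0 < y := ha.trans_le hy.1
    have hp := hΦ.pos y hy0
    rw [← mul_sub, norm_mul, Real.norm_of_nonneg hlam.le, Real.norm_eq_abs, abs_sub_comm,
      abs_of_nonneg (sub_nonneg.2 (langerIntegrand_le_sqrt hp.le))]
    calc lam * (√(Φ y) - langerIntegrand Φ ℓ lam y)
        ≤ lam * (((ℓ : ℝ) + 1 / 2) ^ 2 / (lam ^ 2 * y ^ 2) * (√(Φ y))⁻¹) :=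
          mul_le_mul_of_nonneg_left (sqrt_sub_langerIntegrand_le hp) hlam.le
      _ = ((ℓ : ℝ) + 1 / 2) ^ 2 / lam * ((y ^ 2)⁻¹ * (√(Φ y))⁻¹) := by field_simp
      _ ≤ ((ℓ : ℝ) + 1 / 2) ^ 2 / lam * (C * (y ^ (-α / 2 - 2) + y ^ (-β / 2 - 2))) :=
          mul_le_mul_of_nonneg_left (h y hy0) (by positivity)
      _ = _ := by ring

end Phase

/-! ### The Liouville–Green transformation -/

/-- A Grönwall-type inequality for linear equations whose coefficient has small total mass. -/
lemma norm_sub_le_of_norm_deriv_le_mul {E : Type*} [NormedAddCommGroup E] [NormedSpace ℝ E]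
    {F F' : ℝ → E} {B B' : ℝ → ℝ} {a b : ℝ} (hab : a ≤ b)
    (hF : ∀ x ∈ Icc a b, HasDerivAt F (F' x) x) (hB : ∀ x ∈ Icc a b, HasDerivAt B (B' x) x)
    (hB' : ∀ x ∈ Icc a b, 0 ≤ B' x) (h : ∀ x ∈ Icc a b, ‖F' x‖ ≤ B' x * ‖F x‖)
    (hsmall : B b - B a ≤ 1 / 2) : ‖F b - F a‖ ≤ 2 * (B b - B a) * ‖F a‖ := by
  have hc : ContinuousOn (fun x => ‖F x‖) (Icc a b) := fun x hx =>
    (hF x hx).continuousAt.norm.continuousWithinAt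
  obtain ⟨y, hy, hmax⟩ := isCompact_Icc.exists_isMaxOn (nonempty_Icc.2 hab) hc
  have hM : ∀ x ∈ Icc a b, ‖F x‖ ≤ ‖F y‖ := fun x hx => hmax hx
  have hmono : MonotoneOn B (Icc a b) := by
    refine monotoneOn_of_deriv_nonneg (convex_Icc a b)
      (fun x hx => (hB x hx).continuousAt.continuousWithinAt)
      (fun x hx => (hB x (interior_subset hx)).differentiableAt.differentiableWithinAt)
      fun x hx => ?_
    rw [(hB x (interior_subset hx)).deriv]
    exact hB' x (interior_subset hx)
  have key : ∀ x ∈ Icc a b, ‖F x - F a‖ ≤ (B b - B a) * ‖F y‖ := by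
    intro x hx
    have h1 := norm_sub_le_of_norm_deriv_le hF (B := fun t => B t * ‖F y‖)
      (B' := fun t => B' t * ‖F y‖) (fun t ht => (hB t ht).mul_const _)
      (fun t ht => (h t ht).trans (mul_le_mul_of_nonneg_left (hM t ht) (hB' t ht))) hx
    refine h1.trans ?_
    rw [← sub_mul]
    have := hmono hx ⟨hab, le_rfl⟩ hx.2
    exact mul_le_mul_of_nonneg_right (by linarith) (norm_nonneg _)
  have hη : 0 ≤ B b - B a := sub_nonneg.2 (hmono ⟨le_rfl, hab⟩ ⟨hab, le_rfl⟩ hab)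
  have h2 : ‖F y‖ ≤ 2 * ‖F a‖ := by
    have h3 := key y hy
    have h4 := norm_le_norm_add_norm_sub' (F y) (F a)
    have h5 := mul_le_mul_of_nonneg_right hsmall (norm_nonneg (F y))
    linarith
  calc ‖F b - F a‖ ≤ (B b - B a) * ‖F y‖ := key b ⟨hab, le_rfl⟩
    _ ≤ (B b - B a) * (2 * ‖F a‖) := mul_le_mul_of_nonneg_left h2 hη
    _ = _ := by ring

/-- The Liouville–Green amplitude `ζ = V - i V'`, where `V = lam Φ^(1/4) w` and the prime is the
derivative with respect to the phase variable `lam ∫ √Φ`. -/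
noncomputable def wkbAmplitude (Φ w : ℝ → ℝ) (lam x : ℝ) : ℂ :=
  ((lam * (Φ x ^ (1 / 4 : ℝ) * w x) : ℝ) : ℂ) -
    ((deriv w x / Φ x ^ (1 / 4 : ℝ) + deriv Φ x / (4 * (Φ x ^ (1 / 4 : ℝ)) ^ 5) * w x : ℝ) : ℂ) *
      Complex.I

/-- The unmodified WKB phase `lam ∫₀ˣ √Φ`. -/
noncomputable def wkbPhase (Φ : ℝ → ℝ) (lam x : ℝ) : ℝ := lam * ∫ y in (0 : ℝ)..x, √(Φ y)

namespace IsAdmissiblePotential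

variable {Φ : ℝ → ℝ} {α β : ℝ}

lemma hasDerivAt_wkbPhase (hΦ : IsAdmissiblePotential Φ α β) (lam : ℝ) {x : ℝ} (hx : 0 < x) :
    HasDerivAt (wkbPhase Φ lam) (lam * √(Φ x)) x := by
  obtain ⟨C, hC, hb⟩ := hΦ.exists_le_rpow
  have hcs : ContinuousOn (fun y => √(Φ y)) (Ioi 0) := hΦ.continuousOn.sqrt
  exact (intervalIntegral.integral_hasDerivAt_right
    (intervalIntegrable_sqrt hΦ.neg_two_lt hC.le hΦ.continuousOn hb hx.le)
    (hcs.stronglyMeasurableAtFilter isOpen_Ioi x hx)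
    (hcs.continuousAt (Ioi_mem_nhds hx))).const_mul lam

lemma hasDerivAt_wkbAmplitude (hΦ : IsAdmissiblePotential Φ α β) {ℓ : ℕ} {lam : ℝ} (hlam : 0 < lam)
    {w : ℝ → ℝ} (hw : IsRegularSolution Φ ℓ lam w) {x : ℝ} (hx : 0 < x) :
    HasDerivAt (wkbAmplitude Φ w lam)
      (((lam * √(Φ x) : ℝ) : ℂ) * Complex.I * wkbAmplitude Φ w lam x -
        (((ℓ * (ℓ + 1) / (x ^ 2 * (Φ x ^ (1 / 4 : ℝ)) ^ 2) +
          deriv (deriv Φ) x / (4 * (Φ x ^ (1 / 4 : ℝ)) ^ 6) -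
          5 * deriv Φ x ^ 2 / (16 * (Φ x ^ (1 / 4 : ℝ)) ^ 10)) * (Φ x ^ (1 / 4 : ℝ) * w x) : ℝ) : ℂ) *
          Complex.I) x := by
  have hp := hΦ.pos x hx
  set f : ℝ → ℝ := fun x => Φ x ^ (1 / 4 : ℝ) with hf
  have hfx : 0 < f x := Real.rpow_pos_of_pos hp _
  have hf4 : Φ x = f x ^ 4 := by
    simp only [hf]
    rw [← Real.rpow_natCast, ← Real.rpow_mul hp.le]; norm_num
  have hs : √(Φ x) = f x ^ 2 := by
    rw [hf4, show f x ^ 4 = (f x ^ 2) ^ 2 by ring, Real.sqrt_sq (by positivity)]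
  have hdf : HasDerivAt f (deriv Φ x / (4 * f x ^ 3)) x := by
    refine ((hΦ.hasDerivAt hx).rpow_const (p := 1 / 4) (Or.inl hp.ne')).congr_deriv ?_
    have h1 : Φ x ^ (1 / 4 - 1 : ℝ) = f x / Φ x := by
      rw [Real.rpow_sub hp, Real.rpow_one]
    rw [h1, hf4]
    field_simp
  have hdw := (hw.differentiableAt x hx).hasDerivAt
  have hV : HasDerivAt (fun x => lam * (f x * w x))
      (lam * f x ^ 2 * (deriv w x / f x + deriv Φ x / (4 * f x ^ 5) * w x)) x := by
    refine ((hdf.mul hdw).const_mul lam).congr_deriv ?_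
    field_simp
    ring
  have hY : HasDerivAt (fun x => deriv w x / f x + deriv Φ x / (4 * f x ^ 5) * w x)
      (-(lam * f x ^ 2) * (lam * (f x * w x)) + (ℓ * (ℓ + 1) / (x ^ 2 * f x ^ 2) +
        deriv (deriv Φ) x / (4 * f x ^ 6) - 5 * deriv Φ x ^ 2 / (16 * f x ^ 10)) *
        (f x * w x)) x := by
    have h1 := ((hw.hasDerivAt_deriv x hx).div hdf hfx.ne').add
      (((hΦ.hasDerivAt_deriv hx).div ((hdf.pow 5).const_mul 4)
        (mul_pos four_pos (pow_pos hfx 5)).ne').mul hdw)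
    refine h1.congr_deriv ?_
    simp only [Pi.pow_apply, Pi.div_apply]
    rw [hf4]
    field_simp
    push_cast
    ring
  have h := hV.ofReal_comp.sub (hY.ofReal_comp.mul_const Complex.I)
  refine h.congr_deriv ?_
  change _ = ((lam * √(Φ x) : ℝ) : ℂ) * Complex.I * (((lam * (f x * w x) : ℝ) : ℂ) -
    ((deriv w x / f x + deriv Φ x / (4 * f x ^ 5) * w x : ℝ) : ℂ) * Complex.I) - _
  rw [hs]
  generalize deriv w x / f x + deriv Φ x / (4 * f x ^ 5) * w x = Y
  change _ = _ - (((ℓ * (ℓ + 1) / (x ^ 2 * f x ^ 2) +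
        deriv (deriv Φ) x / (4 * f x ^ 6) - 5 * deriv Φ x ^ 2 / (16 * f x ^ 10)) *
        (f x * w x) : ℝ) : ℂ) * Complex.I
  generalize (ℓ * (ℓ + 1) / (x ^ 2 * f x ^ 2) +
        deriv (deriv Φ) x / (4 * f x ^ 6) - 5 * deriv Φ x ^ 2 / (16 * f x ^ 10)) *
        (f x * w x) = R
  push_cast
  linear_combination (lam * f x ^ 2 * Y : ℂ) * Complex.I_sq

/-- Relative size of the perturbation left over by the Liouville–Green transformation. -/
lemma exists_perturbation_le (hΦ : IsAdmissiblePotential Φ α β) (ℓ : ℕ) :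
    ∃ K > 0, ∀ x > 0, |ℓ * (ℓ + 1) / (x ^ 2 * (Φ x ^ (1 / 4 : ℝ)) ^ 2) +
          deriv (deriv Φ) x / (4 * (Φ x ^ (1 / 4 : ℝ)) ^ 6) -
          5 * deriv Φ x ^ 2 / (16 * (Φ x ^ (1 / 4 : ℝ)) ^ 10)| ≤
      K * (x ^ (-α / 2 - 2) + x ^ (-β / 2 - 2)) := by
  obtain ⟨C, hC, hb⟩ := hΦ.exists_inv_sq_mul_inv_sqrt_le
  obtain ⟨K1, hK1, h1⟩ := hΦ.exists_deriv_le
  obtain ⟨K2, hK2, h2⟩ := hΦ.exists_deriv_deriv_le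
  refine ⟨(ℓ * (ℓ + 1) + K2 / 4 + 5 * K1 ^ 2 / 16) * C, by positivity, fun x hx => ?_⟩
  have hp := hΦ.pos x hx
  set f := Φ x ^ (1 / 4 : ℝ) with hf
  have hfx : 0 < f := Real.rpow_pos_of_pos hp _
  have hf4 : Φ x = f ^ 4 := by
    rw [hf, ← Real.rpow_natCast, ← Real.rpow_mul hp.le]; norm_num
  have hs : √(Φ x) = f ^ 2 := by
    rw [hf4, show f ^ 4 = (f ^ 2) ^ 2 by ring, Real.sqrt_sq (by positivity)]
  have hb' := hb x hx
  have h1' := h1 x hx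
  have h2' := h2 x hx
  rw [hs] at hb'
  rw [hf4] at h1' h2'
  have e1 : |deriv (deriv Φ) x / (4 * f ^ 6)| ≤ K2 / 4 * ((x ^ 2)⁻¹ * (f ^ 2)⁻¹) := by
    rw [abs_div, abs_of_pos (show 0 < 4 * f ^ 6 by positivity), div_le_iff₀ (by positivity)]
    have : |deriv (deriv Φ) x| ≤ K2 * f ^ 4 / x ^ 2 := by
      rw [le_div_iff₀ (by positivity)]; linarith
    refine this.trans (le_of_eq ?_)
    field_simp
  have e2 : |5 * deriv Φ x ^ 2 / (16 * f ^ 10)| ≤ 5 * K1 ^ 2 / 16 * ((x ^ 2)⁻¹ * (f ^ 2)⁻¹) := by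
    rw [abs_of_nonneg (by positivity), div_le_iff₀ (by positivity)]
    have : |deriv Φ x| ≤ K1 * f ^ 4 / x := by
      rw [le_div_iff₀ hx]; linarith
    have h3 := pow_le_pow_left₀ (abs_nonneg _) this 2
    rw [sq_abs] at h3
    refine (mul_le_mul_of_nonneg_left h3 (by norm_num : (0 : ℝ) ≤ 5)).trans (le_of_eq ?_)
    field_simp
  have e3 : |(ℓ : ℝ) * (ℓ + 1) / (x ^ 2 * f ^ 2)| = ℓ * (ℓ + 1) * ((x ^ 2)⁻¹ * (f ^ 2)⁻¹) := by
    rw [abs_of_nonneg (by positivity)]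
    field_simp
  have hK : 0 ≤ (ℓ : ℝ) * (ℓ + 1) + K2 / 4 + 5 * K1 ^ 2 / 16 := by positivity
  calc _ ≤ |(ℓ : ℝ) * (ℓ + 1) / (x ^ 2 * f ^ 2)| + |deriv (deriv Φ) x / (4 * f ^ 6)| +
        |5 * deriv Φ x ^ 2 / (16 * f ^ 10)| :=
        (abs_sub _ _).trans (add_le_add_left (abs_add_le _ _) _)
    _ ≤ (ℓ * (ℓ + 1) + K2 / 4 + 5 * K1 ^ 2 / 16) * ((x ^ 2)⁻¹ * (f ^ 2)⁻¹) := by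
        rw [e3]; linarith
    _ ≤ (ℓ * (ℓ + 1) + K2 / 4 + 5 * K1 ^ 2 / 16) * (C * (x ^ (-α / 2 - 2) + x ^ (-β / 2 - 2))) :=
        mul_le_mul_of_nonneg_left hb' hK
    _ = _ := by ring

/-- Away from the origin the WKB amplitude rotates with the WKB phase, up to a small relative
error. -/
theorem exists_wkbAmplitude_le (hΦ : IsAdmissiblePotential Φ α β) (ℓ : ℕ) :
    ∃ K > 0, ∀ lam > 0, ∀ w, IsRegularSolution Φ ℓ lam w → ∀ a > 0, ∀ x ≥ a,
      K / lam * (errorPrimitive α β x - errorPrimitive α β a) ≤ 1 / 2 →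
      ‖Complex.exp (((-wkbPhase Φ lam x : ℝ) : ℂ) * Complex.I) * wkbAmplitude Φ w lam x -
        Complex.exp (((-wkbPhase Φ lam a : ℝ) : ℂ) * Complex.I) * wkbAmplitude Φ w lam a‖ ≤
      2 * (K / lam * (errorPrimitive α β x - errorPrimitive α β a)) *
        ‖wkbAmplitude Φ w lam a‖ := by
  obtain ⟨K, hK, hb⟩ := hΦ.exists_perturbation_le ℓ
  refine ⟨K, hK, fun lam hlam w hw a ha x hx hsmall => ?_⟩
  have hpos : ∀ y ∈ Icc a x, 0 < y := fun y hy => ha.trans_le hy.1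
  have hnorm : ∀ y, ‖Complex.exp (((-wkbPhase Φ lam y : ℝ) : ℂ) * Complex.I)‖ = 1 := fun y =>
    Complex.norm_exp_ofReal_mul_I _
  have hF : ∀ y ∈ Icc a x, HasDerivAt
      (fun y => Complex.exp (((-wkbPhase Φ lam y : ℝ) : ℂ) * Complex.I) * wkbAmplitude Φ w lam y)
      (Complex.exp (((-wkbPhase Φ lam y : ℝ) : ℂ) * Complex.I) *
        (-((((ℓ * (ℓ + 1) / (y ^ 2 * (Φ y ^ (1 / 4 : ℝ)) ^ 2) +
          deriv (deriv Φ) y / (4 * (Φ y ^ (1 / 4 : ℝ)) ^ 6) -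
          5 * deriv Φ y ^ 2 / (16 * (Φ y ^ (1 / 4 : ℝ)) ^ 10)) * (Φ y ^ (1 / 4 : ℝ) * w y) : ℝ) : ℂ) *
          Complex.I))) y := by
    intro y hy
    have h1 := (((hΦ.hasDerivAt_wkbPhase lam (hpos y hy)).neg.ofReal_comp).mul_const
      Complex.I).cexp
    refine (h1.mul (hΦ.hasDerivAt_wkbAmplitude hlam hw (hpos y hy))).congr_deriv ?_
    simp only [Pi.neg_apply]
    push_cast
    ring
  have key := norm_sub_le_of_norm_deriv_le_mul hx hF
    (B := fun y => K / lam * errorPrimitive α β y)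
    (fun y hy => (hasDerivAt_errorPrimitive hΦ.neg_two_lt hΦ.lt_neg_two (hpos y hy)).const_mul _)
    ?_ ?_ (by rw [← mul_sub]; exact hsmall)
  · rw [norm_mul (Complex.exp _) (wkbAmplitude Φ w lam a), hnorm, one_mul, ← mul_sub] at key
    exact key
  · intro y hy
    have := hpos y hy
    positivity
  · intro y hy
    rw [norm_mul, norm_mul, hnorm, one_mul, one_mul, norm_neg, norm_mul, Complex.norm_I, mul_one,
      Complex.norm_real, Real.norm_eq_abs, abs_mul]
    have h1 : lam * |Φ y ^ (1 / 4 : ℝ) * w y| ≤ ‖wkbAmplitude Φ w lam y‖ := by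
      have h2 := Complex.abs_re_le_norm (wkbAmplitude Φ w lam y)
      have h3 : (wkbAmplitude Φ w lam y).re = lam * (Φ y ^ (1 / 4 : ℝ) * w y) := by
        rw [wkbAmplitude, Complex.sub_re, Complex.ofReal_re, Complex.re_ofReal_mul, Complex.I_re,
          mul_zero, sub_zero]
      rwa [h3, abs_mul, abs_of_pos hlam] at h2
    have hy0 := hpos y hy
    calc _ ≤ (K * (y ^ (-α / 2 - 2) + y ^ (-β / 2 - 2))) * |Φ y ^ (1 / 4 : ℝ) * w y| :=
          mul_le_mul_of_nonneg_right (hb y hy0) (abs_nonneg _)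
      _ = K / lam * (y ^ (-α / 2 - 2) + y ^ (-β / 2 - 2)) * (lam * |Φ y ^ (1 / 4 : ℝ) * w y|) := by
          field_simp
      _ ≤ _ := by gcongr

end IsAdmissiblePotential

/-! ### The limiting Bessel equation at the origin -/

/-- The order of the Bessel function that solves the limiting equation at the origin. -/
noncomputable def besselOrder (α : ℝ) (ℓ : ℕ) : ℝ := ((ℓ : ℝ) + 1 / 2) / (1 + α / 2)

/-- The limiting solution at the origin is a Bessel function of
`besselScale α C₀ * (lam * x ^ (1 + α/2))`. -/
noncomputable def besselScale (α C₀ : ℝ) : ℝ := √C₀ / (1 + α / 2)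

section BesselSystem

variable {α C₀ lam : ℝ} {ℓ : ℕ}

lemma besselOrder_pos (hα : -2 < α) : 0 < besselOrder α ℓ :=
  div_pos (by positivity) (by linarith)

lemma mul_besselOrder (hα : -2 < α) : (1 + α / 2) * besselOrder α ℓ = ℓ + 1 / 2 :=
  mul_div_cancel₀ _ (by linarith)

lemma besselScale_pos (hα : -2 < α) (hC₀ : 0 < C₀) : 0 < besselScale α C₀ :=
  div_pos (Real.sqrt_pos.2 hC₀) (by linarith)

lemma mul_besselScale (hα : -2 < α) : (1 + α / 2) * besselScale α C₀ = √C₀ :=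
  mul_div_cancel₀ _ (by linarith)

/-- The regular system for the pure power potential is solved by Bessel functions. -/
theorem isRegularSystem_poissonIntegral (hα : -2 < α) (hC₀ : 0 < C₀) (hlam : 0 < lam) :
    IsRegularSystem ℓ (fun x => lam ^ 2 * (C₀ * x ^ α))
      (fun x => poissonIntegral (besselOrder α ℓ) (besselScale α C₀ * (lam * x ^ (1 + α / 2))) /
        poissonIntegral (besselOrder α ℓ) 0)
      (fun x => x ^ (2 * ℓ + 1) * ((1 + α / 2) * ((besselScale α C₀ * (lam * x ^ (1 + α / 2))) ^ 2 *
        poissonIntegral (besselOrder α ℓ + 1) (besselScale α C₀ * (lam * x ^ (1 + α / 2))))) /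
        ((2 * besselOrder α ℓ + 1) * poissonIntegral (besselOrder α ℓ) 0)) := by
  have hμ := besselOrder_pos (ℓ := ℓ) hα
  have hκμ := mul_besselOrder (ℓ := ℓ) hα
  have hκc := mul_besselScale (C₀ := C₀) hα
  have hsC := Real.sq_sqrt hC₀.le
  have hP0 := poissonIntegral_zero_pos hμ.le
  set μ := besselOrder α ℓ
  set c := besselScale α C₀
  set κ := 1 + α / 2 with hκ'
  have hκ : 0 < κ := by rw [hκ']; linarith
  have hdZ : ∀ x > 0, HasDerivAt (fun x : ℝ => c * (lam * x ^ κ)) (c * (lam * x ^ κ) * κ / x) x := by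
    intro x hx
    refine (((Real.hasDerivAt_rpow_const (x := x) (p := κ) (Or.inl (ne_of_gt hx))).const_mul
      lam).const_mul c).congr_deriv ?_
    rw [Real.rpow_sub_one (ne_of_gt hx)]
    ring
  have hZ0 : Tendsto (fun x : ℝ => c * (lam * x ^ κ)) (𝓝[>] 0) (𝓝 0) := by
    simpa using ((tendsto_rpow_nhdsGT_zero hκ).const_mul lam).const_mul c
  refine ⟨fun x hx => ?_, fun x hx => ?_, ?_, ?_⟩
  · refine (((hasDerivAt_poissonIntegral hμ.le _).comp x (hdZ x hx)).div_const _).congr_deriv ?_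
    have hx' : x ≠ 0 := ne_of_gt hx
    field_simp
    ring
  · have hx' : x ≠ 0 := ne_of_gt hx
    set Z := c * (lam * x ^ κ) with hZ
    have hr := poissonIntegral_recurrence hμ.le Z
    have hxα : C₀ * x ^ α * x ^ 2 = (κ * c) ^ 2 * (x ^ κ) ^ 2 := by
      rw [hκc, hsC, ← Real.rpow_natCast (x ^ κ), ← Real.rpow_mul hx.le, mul_assoc,
        ← Real.rpow_natCast x, ← Real.rpow_add hx]
      congr 2
      rw [hκ']; push_cast; ring
    have h1 := ((hasDerivAt_pow (2 * ℓ + 1) x).mul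
      ((((hdZ x hx).pow 2).mul ((hasDerivAt_poissonIntegral (m := μ + 1) (by linarith) Z).comp x
        (hdZ x hx))).const_mul κ)).div_const ((2 * μ + 1) * poissonIntegral μ 0)
    refine h1.congr_deriv ?_
    simp only [Pi.mul_apply, Pi.pow_apply, Function.comp]
    rw [← hZ]
    have e1 : μ + 1 + 1 = μ + 2 := by ring
    have e2 : 2 * (μ + 1) + 1 = 2 * μ + 3 := by ring
    have hm1 : 2 * μ + 1 ≠ 0 := by linarith
    have hm3 : 2 * μ + 3 ≠ 0 := by linarith
    rw [e1, e2, Nat.add_sub_cancel]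
    rw [div_mul_eq_mul_div, div_eq_iff hm3] at hr
    have hP2 : Z ^ 2 * poissonIntegral (μ + 2) Z = ((2 * μ + 2) * poissonIntegral (μ + 1) Z -
      (2 * μ + 1) * poissonIntegral μ Z) * (2 * μ + 3) := hr
    have hZ2 : lam ^ 2 * (C₀ * x ^ α) * x ^ 2 = κ ^ 2 * Z ^ 2 := by
      rw [hZ, mul_assoc, hxα]; ring
    have hq : lam ^ 2 * (C₀ * x ^ α) = κ ^ 2 * Z ^ 2 / x ^ 2 := by
      rw [eq_div_iff (pow_ne_zero _ hx')]; exact hZ2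
    rw [hq]
    have hl : (ℓ : ℝ) = κ * μ - 1 / 2 := by linarith
    have hs : ((2 * ℓ + 1 : ℕ) : ℝ) = 2 * (κ * μ) := by push_cast; rw [hl]; ring
    rw [hs]
    clear_value Z
    field_simp
    push_cast
    linear_combination (-Z ^ 2 * x ^ (2 * ℓ + 2)) * hP2
  · have h1 := (((continuous_poissonIntegral hμ.le).tendsto 0).comp hZ0).div_const
      (poissonIntegral μ 0)
    rwa [div_self hP0.ne'] at h1
  · have h1 : Tendsto (fun x : ℝ => x ^ (2 * ℓ + 1)) (𝓝[>] 0) (𝓝 0) := by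
      have := (continuous_pow (M := ℝ) (2 * ℓ + 1)).tendsto 0
      rw [zero_pow (by omega)] at this
      exact this.mono_left nhdsWithin_le_nhds
    have h2 := ((continuous_poissonIntegral (m := μ + 1) (by linarith)).tendsto 0).comp hZ0
    have h3 := (h1.mul (((hZ0.pow 2).mul h2).const_mul κ)).div_const
      ((2 * μ + 1) * poissonIntegral μ 0)
    rw [zero_mul, zero_div] at h3
    exact h3

end BesselSystem

section Matching

variable {Φ : ℝ → ℝ} {α β C₀ : ℝ} {ℓ : ℕ} {w : ℝ → ℝ → ℝ}

lemma growthWeight_matchingPoint (hα : -2 < α) {S C lam : ℝ} (hS : 0 < S) (hlam : 0 < lam) :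
    growthWeight (lam ^ 2 * C) α (matchingPoint α S lam) =
      Real.exp (2 * (C * S ^ 2 / (α + 2))) ∧
    lam ^ 2 * matchingPoint α S lam ^ (α + 2) = S ^ 2 := by
  have hx := matchingPoint_pos (α := α) hS hlam
  have h := matchingPoint_rpow hα hS hlam
  have h2 : lam ^ 2 * matchingPoint α S lam ^ (α + 2) = S ^ 2 := by
    have h1 : matchingPoint α S lam ^ (α + 2) = (matchingPoint α S lam ^ (1 + α / 2)) ^ 2 := by
      rw [← Real.rpow_natCast (_ ^ _) 2, ← Real.rpow_mul hx.le]
      congr 1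
      push_cast; ring
    rw [h1, ← mul_pow, h]
  refine ⟨?_, h2⟩
  rw [growthWeight, max_eq_left hx.le, ← h2]
  ring_nf

/-- At the matching point the regular solution and its derivative are, after scaling, given by the
Bessel function in the limit `lam → ∞`. -/
theorem tendsto_regularSolution_matchingPoint (hΦ : IsAdmissiblePotential Φ α β) (hC₀ : 0 < C₀)
    (hC : Tendsto (fun r => Φ r / r ^ α) (𝓝[>] 0) (𝓝 C₀))
    (hw : ∀ lam > 0, IsRegularSolution Φ ℓ lam (w lam)) {S : ℝ} (hS : 0 < S) :
    Tendsto (fun lam => w lam (matchingPoint α S lam) / matchingPoint α S lam ^ (ℓ + 1)) atTop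
      (𝓝 (poissonIntegral (besselOrder α ℓ) (besselScale α C₀ * S) /
        poissonIntegral (besselOrder α ℓ) 0)) ∧
    Tendsto (fun lam => deriv (w lam) (matchingPoint α S lam) / matchingPoint α S lam ^ ℓ) atTop
      (𝓝 ((ℓ + 1) * (poissonIntegral (besselOrder α ℓ) (besselScale α C₀ * S) /
        poissonIntegral (besselOrder α ℓ) 0) -
        (1 + α / 2) * ((besselScale α C₀ * S) ^ 2 *
          poissonIntegral (besselOrder α ℓ + 1) (besselScale α C₀ * S)) /
        ((2 * besselOrder α ℓ + 1) * poissonIntegral (besselOrder α ℓ) 0))) := by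
  have hα := hΦ.neg_two_lt
  obtain ⟨C, hCpos, hb⟩ := hΦ.exists_le_rpow
  set g₀ := poissonIntegral (besselOrder α ℓ) (besselScale α C₀ * S) /
        poissonIntegral (besselOrder α ℓ) 0 with hg₀
  set e₀ := (1 + α / 2) * ((besselScale α C₀ * S) ^ 2 *
          poissonIntegral (besselOrder α ℓ + 1) (besselScale α C₀ * S)) /
        ((2 * besselOrder α ℓ + 1) * poissonIntegral (besselOrder α ℓ) 0) with he₀
  set M := C + C₀ with hM
  have hMpos : 0 < M := by positivity
  set W := Real.exp (2 * (M * S ^ 2 / (α + 2))) with hW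
  have hWpos : 0 < W := Real.exp_pos _
  have key : ∀ ε > 0, ∀ᶠ lam in atTop,
      |g₀ - w lam (matchingPoint α S lam) / matchingPoint α S lam ^ (ℓ + 1)| ≤ ε ∧
      |e₀ - ((ℓ + 1) * (w lam (matchingPoint α S lam) / matchingPoint α S lam ^ (ℓ + 1)) -
        deriv (w lam) (matchingPoint α S lam) / matchingPoint α S lam ^ ℓ)| ≤ ε := by
    intro ε hε
    set ε₀ := ε / (2 * W / M + 4 * S ^ 2 * W) with hε₀
    have hden : 0 < 2 * W / M + 4 * S ^ 2 * W := by positivity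
    have hε₀pos : 0 < ε₀ := by positivity
    have hsum : ε₀ * (2 * W / M) + ε₀ * (4 * S ^ 2 * W) = ε := by
      rw [← mul_add, hε₀, div_mul_cancel₀ _ hden.ne']
    have hp1 : 0 < ε₀ * (2 * W / M) := by positivity
    have hp2 : 0 < ε₀ * (4 * S ^ 2 * W) := by positivity
    filter_upwards [eventually_abs_sub_le hα hS hε₀pos hC, eventually_gt_atTop 0] with lam hl hlam
    set x := matchingPoint α S lam with hx'
    have hx : 0 < x := matchingPoint_pos hS hlam
    have hxS : lam * x ^ (1 + α / 2) = S := matchingPoint_rpow hα hS hlam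
    obtain ⟨hgw, hx2⟩ := growthWeight_matchingPoint (C := M) hα hS hlam
    rw [← hx', ← hW] at hgw
    rw [← hx'] at hx2
    have hs := (hw lam hlam).isRegularSystem
    have hs₀ := isRegularSystem_poissonIntegral (ℓ := ℓ) hα hC₀ hlam
    have hMl : 0 ≤ lam ^ 2 * M := by positivity
    have hQ : ∀ y ∈ Ioc 0 x, |lam ^ 2 * Φ y| ≤ lam ^ 2 * M * y ^ α := by
      intro y hy
      have hyα := Real.rpow_nonneg hy.1.le α
      rw [abs_of_nonneg (mul_nonneg (sq_nonneg _) (hΦ.pos y hy.1).le), mul_assoc]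
      refine mul_le_mul_of_nonneg_left ((hb y hy.1).trans ?_) (sq_nonneg _)
      exact mul_le_mul_of_nonneg_right (by linarith) hyα
    have hQ₀ : ∀ y ∈ Ioc 0 x, |lam ^ 2 * (C₀ * y ^ α)| ≤ lam ^ 2 * M * y ^ α := by
      intro y hy
      have hyα := Real.rpow_nonneg hy.1.le α
      rw [abs_of_nonneg (by positivity), mul_assoc]
      refine mul_le_mul_of_nonneg_left ?_ (sq_nonneg _)
      exact mul_le_mul_of_nonneg_right (by linarith) hyα
    have hdiff : ∀ y ∈ Ioc 0 x, |lam ^ 2 * (C₀ * y ^ α) - lam ^ 2 * Φ y| ≤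
        ε₀ / M * (lam ^ 2 * M * y ^ α) := by
      intro y hy
      rw [← mul_sub, abs_mul, abs_of_nonneg (sq_nonneg lam), abs_sub_comm,
        show ε₀ / M * (lam ^ 2 * M * y ^ α) = lam ^ 2 * (ε₀ * y ^ α) by field_simp]
      exact mul_le_mul_of_nonneg_left (hl y hy) (sq_nonneg _)
    have h := IsRegularSystem.comparison hα hMl (by positivity : 0 ≤ ε₀ / M) zero_le_two hs₀ hs hQ₀
      hdiff (fun y hy => (IsRegularSystem.abs_le_two_mul hα hMl hs hQ hy).1)
      (⟨hx, le_rfl⟩ : x ∈ Ioc 0 x)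
    rw [hgw, hxS] at h
    refine ⟨?_, ?_⟩
    · refine h.1.trans ?_
      rw [← hsum, show ε₀ / M * 2 * W = ε₀ * (2 * W / M) by ring]
      linarith
    · have h2 := h.2
      have hxk : 0 < x ^ (2 * ℓ + 1) := pow_pos hx _
      have e1 : e₀ - ((ℓ + 1) * (w lam x / x ^ (ℓ + 1)) - deriv (w lam) x / x ^ ℓ) =
          (x ^ (2 * ℓ + 1) * ((1 + α / 2) * ((besselScale α C₀ * S) ^ 2 *
            poissonIntegral (besselOrder α ℓ + 1) (besselScale α C₀ * S))) /
            ((2 * besselOrder α ℓ + 1) * poissonIntegral (besselOrder α ℓ) 0) -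
            ((ℓ + 1) * (x ^ ℓ * w lam x) - x ^ (ℓ + 1) * deriv (w lam) x)) / x ^ (2 * ℓ + 1) := by
        rw [he₀]
        have hx0 : x ≠ 0 := hx.ne'
        have h3 : x ^ (2 * ℓ + 1) = x ^ ℓ * x ^ ℓ * x := by ring
        rw [h3, pow_succ x ℓ]
        have h4 : x ^ ℓ ≠ 0 := pow_ne_zero _ hx0
        generalize (2 * besselOrder α ℓ + 1) * poissonIntegral (besselOrder α ℓ) 0 = den
        generalize x ^ ℓ = t at *
        generalize (1 + α / 2) * ((besselScale α C₀ * S) ^ 2 *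
            poissonIntegral (besselOrder α ℓ + 1) (besselScale α C₀ * S)) = num
        field_simp
      rw [e1, abs_div, abs_of_pos hxk, div_le_iff₀ hxk]
      refine h2.trans ?_
      have e3 : x ^ (((2 * ℓ + 2 : ℕ) : ℝ) + (α + 1)) = x ^ (2 * ℓ + 1) * x ^ (α + 2) := by
        rw [← Real.rpow_natCast x (2 * ℓ + 1), ← Real.rpow_add hx]
        congr 1; push_cast; ring
      rw [e3, show 2 * (ε₀ / M * 2) * (lam ^ 2 * M) * (W * (x ^ (2 * ℓ + 1) * x ^ (α + 2))) =
        4 * ε₀ * (lam ^ 2 * x ^ (α + 2)) * W * x ^ (2 * ℓ + 1) by field_simp; ring, hx2]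
      refine mul_le_mul_of_nonneg_right ?_ hxk.le
      linarith
  have hg : Tendsto (fun lam => w lam (matchingPoint α S lam) / matchingPoint α S lam ^ (ℓ + 1))
      atTop (𝓝 g₀) := by
    rw [Metric.tendsto_nhds]
    intro ε hε
    filter_upwards [key (ε / 2) (by positivity)] with lam hl
    rw [dist_comm, Real.dist_eq]
    linarith [hl.1]
  refine ⟨hg, ?_⟩
  have he : Tendsto (fun lam => ((ℓ : ℝ) + 1) *
      (w lam (matchingPoint α S lam) / matchingPoint α S lam ^ (ℓ + 1)) -
        deriv (w lam) (matchingPoint α S lam) / matchingPoint α S lam ^ ℓ) atTop (𝓝 e₀) := by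
    rw [Metric.tendsto_nhds]
    intro ε hε
    filter_upwards [key (ε / 2) (by positivity)] with lam hl
    rw [dist_comm, Real.dist_eq]
    linarith [hl.2]
  refine ((hg.const_mul ((ℓ : ℝ) + 1)).sub he).congr fun lam => ?_
  ring

end Matching

/-! ### The amplitude at the matching point -/

section Amplitude

variable {Φ : ℝ → ℝ} {α β C₀ : ℝ} {ℓ : ℕ} {w : ℝ → ℝ → ℝ}

lemma tendsto_rpow_sub_half_mul_poissonIntegral {m : ℝ} (hm : 0 < m) :
    Tendsto (fun z => z ^ (m - 1 / 2) * poissonIntegral m z) atTop (𝓝 0) := by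
  have hA := poissonAmplitude_pos hm.le
  have h1 := (tendsto_poissonIntegral hm).mul (tendsto_inv_atTop_zero (𝕜 := ℝ))
  have h2 : Tendsto (fun z : ℝ => poissonAmplitude m *
      Real.cos (z - (m * Real.pi / 2 + Real.pi / 4)) * z⁻¹) atTop (𝓝 0) := by
    refine squeeze_zero_norm (a := fun z : ℝ => poissonAmplitude m * ‖z⁻¹‖) (fun z => ?_) ?_
    · rw [norm_mul, norm_mul, Real.norm_of_nonneg hA.le]
      refine mul_le_mul_of_nonneg_right ?_ (norm_nonneg _)
      exact mul_le_of_le_one_right hA.le (Real.abs_cos_le_one _)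
    · simpa using (tendsto_inv_atTop_zero (𝕜 := ℝ)).norm.const_mul (poissonAmplitude m)
  have h3 := h1.add h2
  rw [zero_mul, zero_add] at h3
  refine h3.congr' ?_
  filter_upwards [eventually_gt_atTop 0] with z hz
  rw [show m + 1 / 2 = (m - 1 / 2) + 1 by ring, Real.rpow_add_one hz.ne']
  field_simp
  ring

lemma tendsto_rpow_mul_poissonIntegral_add_one {m : ℝ} (hm : 0 < m) :
    Tendsto (fun z => z ^ (m - 1 / 2) * (z ^ 2 * poissonIntegral (m + 1) z) -
      (2 * m + 1) * poissonAmplitude m * Real.sin (z - (m * Real.pi / 2 + Real.pi / 4)))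
      atTop (𝓝 0) := by
  refine (tendsto_poissonIntegral (m := m + 1) (by linarith)).congr' ?_
  filter_upwards [eventually_gt_atTop 0] with z hz
  rw [poissonAmplitude_add_one hm.le, show m + 1 + 1 / 2 = (m - 1 / 2) + 2 by ring,
    Real.rpow_add hz, Real.rpow_two, show z - ((m + 1) * Real.pi / 2 + Real.pi / 4) =
      (z - (m * Real.pi / 2 + Real.pi / 4)) - Real.pi / 2 by ring, Real.cos_sub_pi_div_two]
  ring

/-- The modulus of the limiting WKB amplitude, in units of `lam ^ (1/2 - μ)`, `μ` the Bessel
order. -/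
noncomputable def limitAmplitude (α C₀ : ℝ) (ℓ : ℕ) : ℝ :=
  C₀ ^ (1 / 4 : ℝ) / (besselScale α C₀ ^ (besselOrder α ℓ + 1 / 2) *
    poissonIntegral (besselOrder α ℓ) 0) * poissonAmplitude (besselOrder α ℓ)

lemma limitAmplitude_pos (hα : -2 < α) (hC₀ : 0 < C₀) : 0 < limitAmplitude α C₀ ℓ := by
  have hμ := besselOrder_pos (ℓ := ℓ) hα
  have hc := besselScale_pos hα hC₀
  have hP := poissonIntegral_zero_pos hμ.le
  have hA := poissonAmplitude_pos hμ.le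
  unfold limitAmplitude
  positivity

/-- The phase shift `μ π/2 + π/4` of the Bessel function of order `μ`. -/
noncomputable def besselShift (α : ℝ) (ℓ : ℕ) : ℝ := besselOrder α ℓ * Real.pi / 2 + Real.pi / 4

lemma tendsto_limit_re (hα : -2 < α) (hC₀ : 0 < C₀) :
    Tendsto (fun S => C₀ ^ (1 / 4 : ℝ) * (S ^ (besselOrder α ℓ + 1 / 2) *
      (poissonIntegral (besselOrder α ℓ) (besselScale α C₀ * S) /
        poissonIntegral (besselOrder α ℓ) 0)) -
      limitAmplitude α C₀ ℓ * Real.cos (besselScale α C₀ * S - besselShift α ℓ)) atTop (𝓝 0) := by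
  have hμ := besselOrder_pos (ℓ := ℓ) hα
  have hc := besselScale_pos hα hC₀
  have hP := poissonIntegral_zero_pos hμ.le
  have hz : Tendsto (fun S : ℝ => besselScale α C₀ * S) atTop atTop :=
    tendsto_id.const_mul_atTop hc
  have h := ((tendsto_poissonIntegral hμ).comp hz).const_mul
    (C₀ ^ (1 / 4 : ℝ) / (besselScale α C₀ ^ (besselOrder α ℓ + 1 / 2) *
    poissonIntegral (besselOrder α ℓ) 0))
  rw [mul_zero] at h
  refine h.congr' ?_
  filter_upwards [eventually_gt_atTop 0] with S hS
  simp only [Function.comp, limitAmplitude, besselShift]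
  rw [Real.mul_rpow hc.le hS.le]
  have : besselScale α C₀ ^ (besselOrder α ℓ + 1 / 2) ≠ 0 := (Real.rpow_pos_of_pos hc _).ne'
  field_simp

lemma tendsto_limit_im (hα : -2 < α) (hC₀ : 0 < C₀) :
    Tendsto (fun S => (C₀ ^ (1 / 4 : ℝ))⁻¹ * (S ^ (besselOrder α ℓ - 1 / 2) *
      ((ℓ + 1) * (poissonIntegral (besselOrder α ℓ) (besselScale α C₀ * S) /
        poissonIntegral (besselOrder α ℓ) 0) -
        (1 + α / 2) * ((besselScale α C₀ * S) ^ 2 *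
          poissonIntegral (besselOrder α ℓ + 1) (besselScale α C₀ * S)) /
        ((2 * besselOrder α ℓ + 1) * poissonIntegral (besselOrder α ℓ) 0))) +
      limitAmplitude α C₀ ℓ * Real.sin (besselScale α C₀ * S - besselShift α ℓ)) atTop (𝓝 0) := by
  have hμ := besselOrder_pos (ℓ := ℓ) hα
  have hc := besselScale_pos hα hC₀
  have hP := poissonIntegral_zero_pos hμ.le
  have hκc := mul_besselScale (C₀ := C₀) hα
  have hq : 0 < C₀ ^ (1 / 4 : ℝ) := Real.rpow_pos_of_pos hC₀ _
  have hq2 : √C₀ = (C₀ ^ (1 / 4 : ℝ)) ^ 2 := by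
    rw [Real.sqrt_eq_rpow, ← Real.rpow_natCast, ← Real.rpow_mul hC₀.le]; norm_num
  have hz : Tendsto (fun S : ℝ => besselScale α C₀ * S) atTop atTop :=
    tendsto_id.const_mul_atTop hc
  have h1 := ((tendsto_rpow_sub_half_mul_poissonIntegral hμ).comp hz).const_mul
    (((ℓ : ℝ) + 1) / (C₀ ^ (1 / 4 : ℝ) * besselScale α C₀ ^ (besselOrder α ℓ - 1 / 2) *
    poissonIntegral (besselOrder α ℓ) 0))
  have h2 := ((tendsto_rpow_mul_poissonIntegral_add_one hμ).comp hz).const_mul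
    ((1 + α / 2) / (C₀ ^ (1 / 4 : ℝ) * besselScale α C₀ ^ (besselOrder α ℓ - 1 / 2) *
    poissonIntegral (besselOrder α ℓ) 0 * (2 * besselOrder α ℓ + 1)))
  have h := h1.sub h2
  rw [mul_zero, mul_zero, sub_zero] at h
  refine h.congr' ?_
  filter_upwards [eventually_gt_atTop 0] with S hS
  simp only [Function.comp, limitAmplitude, besselShift]
  rw [Real.mul_rpow hc.le hS.le, show besselOrder α ℓ + 1 / 2 = (besselOrder α ℓ - 1 / 2) + 1 by ring,
    Real.rpow_add_one hc.ne']
  have hm1 : 2 * besselOrder α ℓ + 1 ≠ 0 := by linarith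
  have hcp : besselScale α C₀ ^ (besselOrder α ℓ - 1 / 2) ≠ 0 := (Real.rpow_pos_of_pos hc _).ne'
  rw [hq2] at hκc
  have hκ : 1 + α / 2 = (C₀ ^ (1 / 4 : ℝ)) ^ 2 / besselScale α C₀ := by
    rw [eq_div_iff hc.ne', hκc]
  rw [hκ]
  field_simp
  ring

lemma tendsto_limit_remainder (hα : -2 < α) (hC₀ : 0 < C₀) (K : ℝ) :
    Tendsto (fun S => K * ((C₀ ^ (1 / 4 : ℝ))⁻¹ * (S ^ (besselOrder α ℓ - 1 / 2) *
      |poissonIntegral (besselOrder α ℓ) (besselScale α C₀ * S) /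
        poissonIntegral (besselOrder α ℓ) 0|))) atTop (𝓝 0) := by
  have hμ := besselOrder_pos (ℓ := ℓ) hα
  have hc := besselScale_pos hα hC₀
  have hP := poissonIntegral_zero_pos hμ.le
  have hz : Tendsto (fun S : ℝ => besselScale α C₀ * S) atTop atTop :=
    tendsto_id.const_mul_atTop hc
  have h := ((tendsto_rpow_sub_half_mul_poissonIntegral hμ).comp hz).abs.const_mul
    (K * ((C₀ ^ (1 / 4 : ℝ))⁻¹ * (besselScale α C₀ ^ (besselOrder α ℓ - 1 / 2) *
      poissonIntegral (besselOrder α ℓ) 0)⁻¹))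
  rw [abs_zero, mul_zero] at h
  refine h.congr' ?_
  filter_upwards [eventually_gt_atTop 0] with S hS
  simp only [Function.comp]
  have hcp : 0 < besselScale α C₀ ^ (besselOrder α ℓ - 1 / 2) := Real.rpow_pos_of_pos hc _
  rw [Real.mul_rpow hc.le hS.le, abs_div, abs_mul, abs_mul, abs_of_pos hcp,
    abs_of_pos (Real.rpow_pos_of_pos hS _), abs_of_pos hP]
  field_simp

/-- At the matching point the WKB amplitude is close to that of the Bessel function, when first
`S` and then `lam` is large. -/
theorem eventually_wkbAmplitude_matchingPoint (hΦ : IsAdmissiblePotential Φ α β) (hC₀ : 0 < C₀)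
    (hC : Tendsto (fun r => Φ r / r ^ α) (𝓝[>] 0) (𝓝 C₀))
    (hw : ∀ lam > 0, IsRegularSolution Φ ℓ lam (w lam)) {δ : ℝ} (hδ : 0 < δ) :
    ∀ᶠ S in atTop, ∀ᶠ lam : ℝ in atTop,
      ‖((lam ^ (besselOrder α ℓ - 1 / 2) : ℝ) : ℂ) *
          wkbAmplitude Φ (w lam) lam (matchingPoint α S lam) -
        (limitAmplitude α C₀ ℓ : ℂ) *
          Complex.exp (((besselScale α C₀ * S - besselShift α ℓ : ℝ) : ℂ) * Complex.I)‖ ≤ δ := by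
  have hα := hΦ.neg_two_lt
  obtain ⟨K, hK, hK'⟩ := hΦ.exists_deriv_le
  have hδ6 : 0 < δ / 6 := by positivity
  have hκμ := mul_besselOrder (ℓ := ℓ) hα
  filter_upwards [(tendsto_limit_re (ℓ := ℓ) hα hC₀).eventually (Metric.closedBall_mem_nhds 0 hδ6),
    (tendsto_limit_im (ℓ := ℓ) hα hC₀).eventually (Metric.closedBall_mem_nhds 0 hδ6),
    (tendsto_limit_remainder (ℓ := ℓ) hα hC₀ (K / 4)).eventually (Metric.closedBall_mem_nhds 0 hδ6),
    eventually_gt_atTop 0] with S h1 h2 h3 hS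
  rw [Real.dist_eq, sub_zero] at h1 h2 h3
  obtain ⟨hg, hg'⟩ := tendsto_regularSolution_matchingPoint hΦ hC₀ hC hw hS
  have hr : Tendsto (fun lam => (Φ (matchingPoint α S lam) / matchingPoint α S lam ^ α) ^ (1 / 4 : ℝ))
      atTop (𝓝 (C₀ ^ (1 / 4 : ℝ))) :=
    (hC.comp (tendsto_matchingPoint hα hS)).rpow_const (Or.inl hC₀.ne')
  have hq : 0 < C₀ ^ (1 / 4 : ℝ) := Real.rpow_pos_of_pos hC₀ _
  have hX := hr.mul (hg.const_mul (S ^ (besselOrder α ℓ + 1 / 2)))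
  have hY := (hr.inv₀ hq.ne').mul (hg'.const_mul (S ^ (besselOrder α ℓ - 1 / 2)))
  have hR := ((hr.inv₀ hq.ne').mul (hg.abs.const_mul (S ^ (besselOrder α ℓ - 1 / 2)))).const_mul
    (K / 4)
  filter_upwards [hX.eventually (Metric.closedBall_mem_nhds _ hδ6),
    hY.eventually (Metric.closedBall_mem_nhds _ hδ6),
    hR.eventually (Metric.closedBall_mem_nhds _ hδ6), eventually_gt_atTop 0] with lam k1 k2 k3 hlam
  rw [Real.dist_eq] at k1 k2 k3
  set x := matchingPoint α S lam with hx'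
  have hx : 0 < x := matchingPoint_pos hS hlam
  have hxS : lam * x ^ (1 + α / 2) = S := matchingPoint_rpow hα hS hlam
  have hp := hΦ.pos x hx
  set μ := besselOrder α ℓ with hμ'
  set f := Φ x ^ (1 / 4 : ℝ) with hf
  have hfx : 0 < f := Real.rpow_pos_of_pos hp _
  have hf4 : Φ x = f ^ 4 := by
    rw [hf, ← Real.rpow_natCast, ← Real.rpow_mul hp.le]; norm_num
  have hfq : (Φ x / x ^ α) ^ (1 / 4 : ℝ) = f / x ^ (α / 4) := by
    rw [Real.div_rpow hp.le (Real.rpow_nonneg hx.le _), ← Real.rpow_mul hx.le,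
      mul_one_div, ← hf]
  have hSp : ∀ p : ℝ, S ^ p = lam ^ p * x ^ ((1 + α / 2) * p) := fun p => by
    rw [← hxS, Real.mul_rpow hlam.le (Real.rpow_nonneg hx.le _), ← Real.rpow_mul hx.le]
  have hS1 : S ^ (μ + 1 / 2) = lam ^ (μ - 1 / 2) * lam * (x ^ (ℓ + 1) * x ^ (α / 4)) := by
    rw [hSp, ← Real.rpow_add_one hlam.ne', ← Real.rpow_natCast x, ← Real.rpow_add hx]
    congr 2
    · ring
    · push_cast; rw [mul_add, hκμ]; ring
  have hS2 : S ^ (μ - 1 / 2) = lam ^ (μ - 1 / 2) * (x ^ ℓ / x ^ (α / 4)) := by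
    rw [hSp, ← Real.rpow_natCast x, ← Real.rpow_sub hx]
    congr 2
    rw [mul_sub, hκμ]; ring
  have hxp : 0 < x ^ (α / 4) := Real.rpow_pos_of_pos hx _
  set l := lam ^ (μ - 1 / 2) with hl
  have hlpos : 0 < l := Real.rpow_pos_of_pos hlam _
  rw [hfq] at k1 k2 k3
  have e1 : f / x ^ (α / 4) * (S ^ (μ + 1 / 2) * (w lam x / x ^ (ℓ + 1))) =
      l * (lam * (f * w lam x)) := by
    rw [hS1]; field_simp
  have e2 : (f / x ^ (α / 4))⁻¹ * (S ^ (μ - 1 / 2) * (deriv (w lam) x / x ^ ℓ)) =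
      l * (deriv (w lam) x / f) := by
    rw [hS2]; field_simp
  have e3 : |l * (deriv Φ x / (4 * f ^ 5) * w lam x)| ≤
      K / 4 * ((f / x ^ (α / 4))⁻¹ * (S ^ (μ - 1 / 2) * |w lam x / x ^ (ℓ + 1)|)) := by
    have hd : |deriv Φ x| ≤ K * f ^ 4 / x := by
      rw [le_div_iff₀ hx, ← hf4]; linarith [hK' x hx]
    have h5 : (0 : ℝ) < 4 * f ^ 5 := by positivity
    rw [hS2, abs_mul, abs_mul, abs_div, abs_div, abs_of_pos hlpos, abs_of_pos h5,
      abs_of_pos (pow_pos hx (ℓ + 1))]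
    calc l * (|deriv Φ x| / (4 * f ^ 5) * |w lam x|)
        ≤ l * ((K * f ^ 4 / x) / (4 * f ^ 5) * |w lam x|) := by gcongr
      _ = _ := by field_simp; ring
  rw [e1] at k1
  rw [e2] at k2
  have esplit : ((l : ℝ) : ℂ) * wkbAmplitude Φ (w lam) lam x - (limitAmplitude α C₀ ℓ : ℂ) *
      Complex.exp (((besselScale α C₀ * S - besselShift α ℓ : ℝ) : ℂ) * Complex.I) =
      ((l * (lam * (f * w lam x)) - limitAmplitude α C₀ ℓ *
        Real.cos (besselScale α C₀ * S - besselShift α ℓ) : ℝ) : ℂ) -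
      ((l * (deriv (w lam) x / f) + limitAmplitude α C₀ ℓ *
        Real.sin (besselScale α C₀ * S - besselShift α ℓ) +
        l * (deriv Φ x / (4 * f ^ 5) * w lam x) : ℝ) : ℂ) * Complex.I := by
    rw [Complex.exp_mul_I, ← Complex.ofReal_cos, ← Complex.ofReal_sin, wkbAmplitude, ← hf]
    push_cast
    ring
  rw [esplit]
  refine (norm_sub_le _ _).trans ?_
  rw [norm_mul, Complex.norm_I, mul_one, Complex.norm_real, Complex.norm_real, Real.norm_eq_abs,
    Real.norm_eq_abs]
  rw [abs_le] at h1 h2 h3 k1 k2 k3 e3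
  have b1 : |l * (lam * (f * w lam x)) - limitAmplitude α C₀ ℓ *
        Real.cos (besselScale α C₀ * S - besselShift α ℓ)| ≤ 2 * (δ / 6) := by
    rw [abs_le]; constructor <;> linarith [h1.1, h1.2, k1.1, k1.2]
  have b2 : |l * (deriv (w lam) x / f) + limitAmplitude α C₀ ℓ *
        Real.sin (besselScale α C₀ * S - besselShift α ℓ) +
        l * (deriv Φ x / (4 * f ^ 5) * w lam x)| ≤ 4 * (δ / 6) := by
    rw [abs_le]
    constructor <;> linarith [h2.1, h2.2, k2.1, k2.2, h3.1, h3.2, k3.1, k3.2, e3.1, e3.2]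
  linarith

end Amplitude

/-! ### Uniform asymptotics on the window -/

section Window

variable {α β : ℝ}

lemma eventually_matchingPoint_le {xm : ℝ → ℝ} {S : ℝ} (hα : -2 < α) (hS : 0 < S)
    (h : Tendsto (fun lam => lam ^ (2 / (2 + α)) * xm lam) atTop atTop) :
    ∀ᶠ lam in atTop, matchingPoint α S lam ≤ xm lam := by
  filter_upwards [h.eventually_ge_atTop (S ^ (1 + α / 2)⁻¹), eventually_gt_atTop 0] with lam hl hlam
  have e : 2 / (2 + α) = (1 + α / 2)⁻¹ := by
    rw [inv_eq_one_div, div_eq_div_iff (by linarith) (by linarith)]; ring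
  rw [← e] at hl
  rw [matchingPoint, Real.div_rpow hS.le hlam.le, ← e, div_le_iff₀ (Real.rpow_pos_of_pos hlam _)]
  linarith

lemma eventually_rpow_div_le {xp : ℝ → ℝ} {σ : ℝ} (hβ : β < -2) (hσ : 0 < σ)
    (h : Tendsto (fun lam => lam ^ (2 / (2 + β)) * xp lam) atTop (𝓝 0)) :
    ∀ᶠ lam in atTop, ∀ x > 0, x < xp lam → x ^ (-(1 + β / 2)) / lam ≤ σ := by
  have hκ : 0 < -(1 + β / 2) := by linarith
  have hρ : 0 < σ ^ (-(1 + β / 2))⁻¹ := Real.rpow_pos_of_pos hσ _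
  filter_upwards [h.eventually_le_const hρ, eventually_gt_atTop 0] with lam hl hlam x hx hxp
  have hlp : 0 < lam ^ (2 / (2 + β)) := Real.rpow_pos_of_pos hlam _
  have h1 : lam ^ (2 / (2 + β)) * x ≤ σ ^ (-(1 + β / 2))⁻¹ :=
    (mul_le_mul_of_nonneg_left hxp.le hlp.le).trans hl
  have h2 := Real.rpow_le_rpow (by positivity) h1 hκ.le
  rw [Real.rpow_inv_rpow hσ.le hκ.ne', Real.mul_rpow hlp.le hx.le, ← Real.rpow_mul hlam.le,
    show 2 / (2 + β) * -(1 + β / 2) = -1 by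
      have : 2 + β ≠ 0 := by linarith
      field_simp, Real.rpow_neg_one] at h2
  rw [div_eq_inv_mul]
  exact h2

end Window

lemma norm_exp_sub_exp_le (a b : ℝ) :
    ‖Complex.exp ((a : ℂ) * Complex.I) - Complex.exp ((b : ℂ) * Complex.I)‖ ≤ |a - b| := by
  have h : Complex.exp ((a : ℂ) * Complex.I) - Complex.exp ((b : ℂ) * Complex.I) =
      Complex.exp ((b : ℂ) * Complex.I) * (Complex.exp (Complex.I * ((a - b : ℝ) : ℂ)) - 1) := by
    rw [mul_sub, ← Complex.exp_add, mul_one]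
    congr 2
    push_cast; ring
  rw [h, norm_mul, Complex.norm_exp_ofReal_mul_I, one_mul, ← Real.norm_eq_abs]
  exact Real.norm_exp_I_mul_ofReal_sub_one_le

/-- Transport of an asymptotic relation along the rotation `exp (i τ)`. -/
lemma norm_sub_mul_exp_le {A : ℝ} (hA : 0 ≤ A) (Zx Za : ℂ) (τx τa px pa θ : ℝ) {δ₁ δ₂ δ₃ δ₄ : ℝ}
    (h₁ : ‖Complex.exp (((-τx : ℝ) : ℂ) * Complex.I) * Zx -
      Complex.exp (((-τa : ℝ) : ℂ) * Complex.I) * Za‖ ≤ δ₁)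
    (h₂ : ‖Za - (A : ℂ) * Complex.exp ((θ : ℂ) * Complex.I)‖ ≤ δ₂)
    (h₃ : |pa - θ| ≤ δ₃) (h₄ : |(px - τx) - (pa - τa)| ≤ δ₄) :
    ‖Zx - (A : ℂ) * Complex.exp ((px : ℂ) * Complex.I)‖ ≤ δ₁ + δ₂ + A * (δ₃ + δ₄) := by
  have hn : ∀ t : ℝ, ‖Complex.exp ((t : ℂ) * Complex.I)‖ = 1 := Complex.norm_exp_ofReal_mul_I
  have hadd : ∀ s t : ℝ, Complex.exp ((s : ℂ) * Complex.I) * Complex.exp ((t : ℂ) * Complex.I) =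
      Complex.exp (((s + t : ℝ) : ℂ) * Complex.I) := fun s t => by
    rw [← Complex.exp_add]; congr 1; push_cast; ring
  have e : Complex.exp (((-τx : ℝ) : ℂ) * Complex.I) *
      (Zx - (A : ℂ) * Complex.exp ((px : ℂ) * Complex.I)) =
      (Complex.exp (((-τx : ℝ) : ℂ) * Complex.I) * Zx -
        Complex.exp (((-τa : ℝ) : ℂ) * Complex.I) * Za) +
      Complex.exp (((-τa : ℝ) : ℂ) * Complex.I) *
        (Za - (A : ℂ) * Complex.exp ((θ : ℂ) * Complex.I)) +
      (A : ℂ) * (Complex.exp (((-τa + θ : ℝ) : ℂ) * Complex.I) -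
        Complex.exp (((-τx + px : ℝ) : ℂ) * Complex.I)) := by
    rw [← hadd, ← hadd]; ring
  have h5 : |(-τa + θ) - (-τx + px)| ≤ δ₃ + δ₄ := by
    rw [abs_le] at *
    constructor <;> linarith [h₃.1, h₃.2, h₄.1, h₄.2]
  calc ‖Zx - (A : ℂ) * Complex.exp ((px : ℂ) * Complex.I)‖
      = ‖Complex.exp (((-τx : ℝ) : ℂ) * Complex.I) *
        (Zx - (A : ℂ) * Complex.exp ((px : ℂ) * Complex.I))‖ := by rw [norm_mul, hn, one_mul]
    _ ≤ δ₁ + δ₂ + A * (δ₃ + δ₄) := by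
        rw [e]
        refine (norm_add_le _ _).trans (add_le_add ((norm_add_le _ _).trans (add_le_add h₁ ?_)) ?_)
        · rw [norm_mul, hn, one_mul]; exact h₂
        · rw [norm_mul, Complex.norm_real, Real.norm_of_nonneg hA]
          exact mul_le_mul_of_nonneg_left ((norm_exp_sub_exp_le _ _).trans h5) hA

/-- The uniform asymptotics on the window, for the WKB amplitude. -/
theorem IsAdmissiblePotential.eventually_wkbAmplitude {Φ : ℝ → ℝ} {α β C₀ : ℝ} {ℓ : ℕ}
    {w : ℝ → ℝ → ℝ} (hΦ : IsAdmissiblePotential Φ α β) (hC₀ : 0 < C₀)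
    (hC : Tendsto (fun r => Φ r / r ^ α) (𝓝[>] 0) (𝓝 C₀))
    (hw : ∀ lam > 0, IsRegularSolution Φ ℓ lam (w lam)) {xm xp : ℝ → ℝ}
    (hm : Tendsto (fun lam => lam ^ (2 / (2 + α)) * xm lam) atTop atTop)
    (hp : Tendsto (fun lam => lam ^ (2 / (2 + β)) * xp lam) atTop (𝓝 0)) {δ : ℝ} (hδ : 0 < δ) :
    ∀ᶠ lam : ℝ in atTop, ∀ x ∈ Ioo (xm lam) (xp lam), 0 < x ∧
      ‖((lam ^ (besselOrder α ℓ - 1 / 2) : ℝ) : ℂ) * wkbAmplitude Φ (w lam) lam x -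
        (limitAmplitude α C₀ ℓ : ℂ) *
          Complex.exp (((langerPhase Φ ℓ lam x : ℝ) : ℂ) * Complex.I)‖ ≤ δ := by
  have hα := hΦ.neg_two_lt
  have hβ := hΦ.lt_neg_two
  have hκ : 0 < 1 + α / 2 := by linarith
  have hκ' : 0 < -(1 + β / 2) := by linarith
  set A := limitAmplitude α C₀ ℓ with hA'
  have hA : 0 < A := limitAmplitude_pos hα hC₀
  obtain ⟨C, hCpos, hb⟩ := hΦ.exists_le_rpow
  obtain ⟨K₁, hK₁, h₁⟩ := hΦ.exists_phase_sub_le ℓ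
  obtain ⟨K₂, hK₂, h₂⟩ := hΦ.exists_wkbAmplitude_le ℓ
  -- `η` bounds `(errorPrimitive x - errorPrimitive a) / lam` on the window
  obtain ⟨η, hη, hη1, hη2, hη3⟩ : ∃ η > 0, K₂ * η ≤ 1 / 2 ∧ 2 * (K₂ * η) * (A + δ / 4) ≤ δ / 4 ∧
      A * (K₁ * η) ≤ δ / 8 := by
    have t : Tendsto (fun η : ℝ => η) (𝓝[>] 0) (𝓝 0) := nhdsWithin_le_nhds
    have t1 := t.const_mul K₂
    have t2 := ((t.const_mul K₂).const_mul 2).mul_const (A + δ / 4)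
    have t3 := (t.const_mul K₁).const_mul A
    simp only [mul_zero, zero_mul] at t1 t2 t3
    obtain ⟨η, a1, a2, a3, a4⟩ := ((t1.eventually_le_const (show (0 : ℝ) < 1 / 2 by norm_num)).and
      ((t2.eventually_le_const (show (0 : ℝ) < δ / 4 by positivity)).and
      ((t3.eventually_le_const (show (0 : ℝ) < δ / 8 by positivity)).and
        self_mem_nhdsWithin))).exists
    exact ⟨η, a4, a1, a2, a3⟩
  -- the choice of the matching parameter `S`
  have hz : Tendsto (fun S : ℝ => besselScale α C₀ * S) atTop atTop :=
    tendsto_id.const_mul_atTop (besselScale_pos hα hC₀)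
  have hphase := (tendsto_besselPhase_sub (besselOrder_pos (ℓ := ℓ) hα)).comp hz
  have hδA : 0 < δ / (16 * A) := by positivity
  obtain ⟨S, hS1, hS2, hS3, hS⟩ := ((eventually_wkbAmplitude_matchingPoint hΦ hC₀ hC hw
    (show 0 < δ / 4 by positivity)).and
    ((hphase.eventually (Metric.closedBall_mem_nhds _ hδA)).and
    ((eventually_ge_atTop (2 / ((1 + α / 2) * η))).and (eventually_gt_atTop 0)))).exists
  have hSη : 1 / (S * (1 + α / 2)) ≤ η / 2 := by
    rw [div_le_iff₀ (by positivity)] at hS3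
    rw [div_le_div_iff₀ (by positivity) two_pos]
    linarith
  have hσ : 0 < η / 2 * -(1 + β / 2) := by positivity
  have hlim := tendsto_phase_matchingPoint (ℓ := ℓ) hα hS hC₀ hCpos.le hΦ.continuousOn
    (fun y hy => (hΦ.pos y hy).le) hb hC
  filter_upwards [hS1, hlim.eventually (Metric.closedBall_mem_nhds _ hδA),
    eventually_matchingPoint_le hα hS hm, eventually_rpow_div_le hβ hσ hp, eventually_gt_atTop 0]
    with lam k1 k2 k3 k4 hlam x hx
  set a := matchingPoint α S lam with ha'
  have ha : 0 < a := matchingPoint_pos hS hlam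
  have haS : lam * a ^ (1 + α / 2) = S := matchingPoint_rpow hα hS hlam
  have hax : a ≤ x := k3.trans hx.1.le
  have hx0 : 0 < x := ha.trans_le hax
  refine ⟨hx0, ?_⟩
  have hE : 1 / lam * (errorPrimitive α β x - errorPrimitive α β a) ≤ η := by
    have e1 : 1 / lam * (a ^ (-(1 + α / 2)) / (1 + α / 2)) = 1 / (S * (1 + α / 2)) := by
      have : a ^ (1 + α / 2) ≠ 0 := (Real.rpow_pos_of_pos ha _).ne'
      rw [Real.rpow_neg ha.le, ← haS]
      field_simp
    have e2 : 1 / lam * (x ^ (-(1 + β / 2)) / (-(1 + β / 2))) ≤ η / 2 := by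
      rw [show 1 / lam * (x ^ (-(1 + β / 2)) / (-(1 + β / 2))) =
        x ^ (-(1 + β / 2)) / lam / (-(1 + β / 2)) by ring, div_le_iff₀ hκ']
      exact k4 x hx0 hx.2
    have e3 := mul_le_mul_of_nonneg_left (errorPrimitive_sub_le hα hβ ha hx0)
      (show 0 ≤ 1 / lam by positivity)
    rw [mul_add, e1] at e3
    linarith
  have hE' : ∀ K > 0, K / lam * (errorPrimitive α β x - errorPrimitive α β a) ≤ K * η := by
    intro K hK
    rw [show K / lam * (errorPrimitive α β x - errorPrimitive α β a) =
      K * (1 / lam * (errorPrimitive α β x - errorPrimitive α β a)) by ring]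
    exact mul_le_mul_of_nonneg_left hE hK.le
  have p1 := (h₁ lam hlam a ha x hax).trans (hE' K₁ hK₁)
  have p2 := h₂ lam hlam (w lam) (hw lam hlam) a ha x hax ((hE' K₂ hK₂).trans hη1)
  set l := lam ^ (besselOrder α ℓ - 1 / 2) with hl
  have hlpos : 0 < l := Real.rpow_pos_of_pos hlam _
  have hZa : l * ‖wkbAmplitude Φ (w lam) lam a‖ ≤ A + δ / 4 := by
    have h5 := norm_le_norm_add_norm_sub' ((l : ℂ) * wkbAmplitude Φ (w lam) lam a)
      ((A : ℂ) * Complex.exp (((besselScale α C₀ * S - besselShift α ℓ : ℝ) : ℂ) * Complex.I))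
    rw [norm_mul, norm_mul, Complex.norm_exp_ofReal_mul_I, Complex.norm_real, Complex.norm_real,
      Real.norm_of_nonneg hlpos.le, Real.norm_of_nonneg hA.le, mul_one] at h5
    linarith
  have q1 : ‖Complex.exp (((-wkbPhase Φ lam x : ℝ) : ℂ) * Complex.I) *
        ((l : ℂ) * wkbAmplitude Φ (w lam) lam x) -
      Complex.exp (((-wkbPhase Φ lam a : ℝ) : ℂ) * Complex.I) *
        ((l : ℂ) * wkbAmplitude Φ (w lam) lam a)‖ ≤ δ / 4 := by
    rw [mul_left_comm, mul_left_comm _ (l : ℂ) (wkbAmplitude Φ (w lam) lam a), ← mul_sub, norm_mul,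
      Complex.norm_real, Real.norm_of_nonneg hlpos.le]
    calc _ ≤ l * (2 * (K₂ / lam * (errorPrimitive α β x - errorPrimitive α β a)) *
          ‖wkbAmplitude Φ (w lam) lam a‖) := mul_le_mul_of_nonneg_left p2 hlpos.le
      _ ≤ l * (2 * (K₂ * η) * ‖wkbAmplitude Φ (w lam) lam a‖) := by
          have := hE' K₂ hK₂
          gcongr
      _ = 2 * (K₂ * η) * (l * ‖wkbAmplitude Φ (w lam) lam a‖) := by ring
      _ ≤ 2 * (K₂ * η) * (A + δ / 4) := mul_le_mul_of_nonneg_left hZa (by positivity)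
      _ ≤ δ / 4 := hη2
  have q3 : |langerPhase Φ ℓ lam a - (besselScale α C₀ * S - besselShift α ℓ)| ≤ δ / (8 * A) := by
    rw [Real.dist_eq] at k2 hS2
    simp only [Function.comp] at hS2
    change |_ - besselPhase (besselOrder α ℓ) (besselScale α C₀ * S)| ≤ _ at k2
    rw [abs_le] at k2 hS2
    have e : δ / (8 * A) = 2 * (δ / (16 * A)) := by field_simp; norm_num
    rw [langerPhase, besselShift, abs_le, e]
    constructor <;> linarith [k2.1, k2.2, hS2.1, hS2.2]
  refine (norm_sub_mul_exp_le hA.le _ _ _ _ _ _ _ q1 k1 q3 p1).trans ?_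
  have e5 : A * (δ / (8 * A)) = δ / 8 := by field_simp
  rw [mul_add, e5]
  linarith

theorem theorem3p13 (Φ : ℝ → ℝ) (α β : ℝ) (hΦ : IsAdmissiblePotential Φ α β) (ℓ : ℕ) :
    -- existence and uniqueness (on `(0, ∞)`) of the regular solution
    (∀ lam > 0, ∃ w : ℝ → ℝ, IsRegularSolution Φ ℓ lam w ∧
      ∀ v : ℝ → ℝ, IsRegularSolution Φ ℓ lam v → EqOn v w (Ioi 0)) ∧
    -- the integral in the phase is a convergent one
    (∀ lam > 0, ∀ x > 0,
      IntervalIntegrable (langerIntegrand Φ ℓ lam) MeasureTheory.volume 0 x) ∧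
    -- the asymptotic form; the factor `a lam` depends on neither `x` nor the interval
    ∀ w : ℝ → ℝ → ℝ, (∀ lam > 0, IsRegularSolution Φ ℓ lam (w lam)) →
      ∃ a : ℝ → ℝ, (∀ lam > 0, a lam ≠ 0) ∧
        ∀ xm xp : ℝ → ℝ,
          Tendsto (fun lam => lam ^ (2 / (2 + α)) * xm lam) atTop atTop →
          Tendsto (fun lam => lam ^ (2 / (2 + β)) * xp lam) atTop (𝓝 0) →
          ∃ err : ℝ → ℝ → ℝ,
            (∀ δ > 0, ∀ᶠ lam in atTop, ∀ x ∈ Ioo (xm lam) (xp lam), |err lam x| ≤ δ) ∧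
            ∀ lam > 0, ∀ x ∈ Ioo (xm lam) (xp lam), 0 < x →
              w lam x = a lam * Φ x ^ (-(1 / 4) : ℝ) *
                (Real.cos (langerPhase Φ ℓ lam x) + err lam x) := by
  have hα := hΦ.neg_two_lt
  refine ⟨fun lam _ => hΦ.exists_isRegularSolution ℓ lam, fun lam hlam x hx => ?_, fun w hw => ?_⟩
  · obtain ⟨C, hC, hb⟩ := hΦ.exists_le_rpow
    exact intervalIntegrable_langerIntegrand hα hlam hC.le hΦ.continuousOn
      (fun y hy => (hΦ.pos y hy).le) hb hx.le
  · obtain ⟨C₀, hC₀, hC⟩ := hΦ.tendsto_div_zero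
    set A := limitAmplitude α C₀ ℓ with hA'
    have hA : 0 < A := limitAmplitude_pos hα hC₀
    set a : ℝ → ℝ := fun lam => A / (lam ^ (besselOrder α ℓ - 1 / 2) * lam) with ha'
    have ha : ∀ lam > 0, 0 < a lam := fun lam hlam =>
      div_pos hA (mul_pos (Real.rpow_pos_of_pos hlam _) hlam)
    refine ⟨a, fun lam hlam => (ha lam hlam).ne', fun xm xp hm hp => ?_⟩
    refine ⟨fun lam x => w lam x * Φ x ^ (1 / 4 : ℝ) / a lam - Real.cos (langerPhase Φ ℓ lam x),
      fun δ hδ => ?_, fun lam hlam x _ hx => ?_⟩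
    · filter_upwards [hΦ.eventually_wkbAmplitude hC₀ hC hw hm hp (mul_pos hA hδ),
        eventually_gt_atTop 0] with lam h hlam x hx
      have h1 := (Complex.abs_re_le_norm _).trans (h x hx).2
      have hl : 0 < lam ^ (besselOrder α ℓ - 1 / 2) := Real.rpow_pos_of_pos hlam _
      rw [Complex.sub_re, Complex.re_ofReal_mul, Complex.re_ofReal_mul,
        Complex.exp_ofReal_mul_I_re, wkbAmplitude, Complex.sub_re, Complex.ofReal_re,
        Complex.re_ofReal_mul, Complex.I_re, mul_zero, sub_zero] at h1
      have e : w lam x * Φ x ^ (1 / 4 : ℝ) / a lam - Real.cos (langerPhase Φ ℓ lam x) =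
          (lam ^ (besselOrder α ℓ - 1 / 2) * (lam * (Φ x ^ (1 / 4 : ℝ) * w lam x)) -
            A * Real.cos (langerPhase Φ ℓ lam x)) / A := by
        simp only [ha']
        field_simp
      rw [e, abs_div, abs_of_pos hA, div_le_iff₀ hA, mul_comm δ]
      exact h1
    · have hf : 0 < Φ x ^ (1 / 4 : ℝ) := Real.rpow_pos_of_pos (hΦ.pos x hx) _
      have ha0 := (ha lam hlam).ne'
      rw [Real.rpow_neg (hΦ.pos x hx).le, add_sub_cancel]
      field_simp
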